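/- **Theorem (Hadamard integral representation).** Let $L\subseteq\mathbb R^d$ be uniformly discrete, i.e. there is $\varepsilon>0$ with $|x-y|>\varepsilon$ for all distinct $x,y\in L$, and let $\lambda>0$. Let $\hat{\mathbb 1}_L$ be the Fourier transform (with kernel $e^{-2\pi i x\cdot\xi}$) of the tempered distribution $\mathbb 1_L=\sum_{z\in L}\delta_z$, and let $L^*=\operatorname{sing\,supp}\hat{\mathbb 1}_L$. For a tempered distribution $u$ and a Schwartz function $\varphi$ write $(u*\varphi)(y)=u(\varphi(y-\cdot))$, and for $\mu\in\mathbb C$ let $$G_\mu(z)=\int_{-1}^1|t|^{-\mu}e^{-\pi |z|^2/t^2}\,\frac{dt}{|t|}\quad(z\in\mathbb R^d\setminus\{0\}),\qquad G_\mu(0)=-\frac2\mu .$$ 1. The function $\psi_L(t,y)=\big(\hat{\mathbb 1}_L*e^{-\pi|\cdot|^2/t^2}\big)(y)$, $t>0$, $y\in\mathbb R^d\setminus L^*$, extends to a function in $C^\infty\big([0,\infty)\times(\mathbb R^d\setminus L^*)\big)$; in particular $\psi_L\in C^\infty([0,1]\times(\mathbb R^d\setminus L^*))$. 2. For every $y\in\mathbb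 R^d\setminus L^*$ the integral $\int_0^1 t^{\nu-d-1}\psi_L(t/\lambda,y)\,dt$ converges absolutely for $\operatorname{Re}\nu$ large and has a meromorphic continuation to $\nu\in\mathbb C$, the Hadamard integral $\operatorname{f.p.}\!\int_0^1 t^{\nu-d-1}\psi_L(t/\lambda,y)\,dt$. The function $$H_\nu(y)=\frac{2}{\Gamma(\nu/2)}\,\operatorname{f.p.}\!\int_0^1 t^{\nu-d-1}\psi_L(t/\lambda,y)\,dt$$ is defined for all $\nu\in\mathbb C\setminus\{0,-2,-4,\dots\}$ and extends to an entire function of $\nu$. 3. $H$ represents the convolution of $\hat{\mathbb 1}_L$ with $G_{d-\nu}(\lambda\,\cdot)$: for $y\in\mathbb R^d\setminus L^*$, $$\frac1{\Gamma(\nu/2)}\big(\hat{\mathbb 1}_L*G_{d-\nu}(\lambda\,\cdot)\big)(y)=H_\nu(y)$$ in the following sense. The distribution $\hat{\mathbb 1}_L$ has finite order. If it has order at most $k$ and $\operatorname{Re}\nu>d+k$, then $G_{d-\nu}(\lambda\,\cdot)$ belongs to the space $\mathcal S^k(\mathbb R^d)$ of $C^k$ functions all of whose derivatives up to order $k$ decay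 superalgebraically, and the equality holds pointwise, the left-hand side being the value at $G_{d-\nu}(\lambda(y-\cdot))$ of the continuous extension of $\hat{\mathbb 1}_L$ to $\mathcal S^k(\mathbb R^d)$. If $\operatorname{Re}\nu>0$, the equality holds in the sense of distributions on $\mathbb R^d\setminus L^*$, where $(u*g)(\varphi)=u(\check g*\varphi)$ with $\check g(z)=g(-z)$. For all other $\nu\in\mathbb C$ the left-hand side is understood as the analytic continuation in $\nu$, which is $H_\nu(y)$. 4. For every $\nu\in\mathbb C$ the function $H_\nu$ is smooth on $\mathbb R^d\setminus L^*$. -/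

import Mathlib

open MeasureTheory Set Filter
open scoped SchwartzMap ContDiff FourierTransform Topology

noncomputable section

namespace SetZeta

/-- `ℝ^d` with the Euclidean norm. -/
abbrev Space (d : ℕ) : Type := EuclideanSpace ℝ (Fin d)

variable {d : ℕ}

/-- `L` is uniformly discrete: distinct points of `L` have distance larger than some `ε > 0`. -/
def UniformlyDiscrete (L : Set (Space d)) : Prop :=
  ∃ ε : ℝ, 0 < ε ∧ ∀ x ∈ L, ∀ y ∈ L, x ≠ y → ε < dist x y

/-! ### The Dirac comb and the form factor -/

/-- The measure `∑_{z ∈ L} δ_z`. -/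
def combMeasure (L : Set (Space d)) : Measure (Space d) :=
  Measure.sum fun z : L => Measure.dirac (z : Space d)

theorem combMeasure_hasTemperateGrowth {L : Set (Space d)} (hL : UniformlyDiscrete L) :
    (combMeasure L).HasTemperateGrowth := by
  obtain ⟨ε, hε, hsep⟩ := hL
  set r : ℝ := min (ε / 2) 1 with hr
  have hr0 : 0 < r := lt_min (by linarith) one_pos
  have hdisj : Pairwise (Function.onFun Disjoint
      fun z : L => Metric.ball (z : Space d) r) := by
    intro z w hzw
    refine Metric.ball_disjoint_ball ?_
    have h1 := hsep z z.2 w w.2 (fun h => hzw (Subtype.ext h))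
    have h2 : r ≤ ε / 2 := min_le_left _ _
    linarith
  have hcount : Countable L := by
    have := Set.PairwiseDisjoint.countable_of_isOpen (ι := L) (a := univ)
      (s := fun z : L => Metric.ball (z : Space d) r)
      (fun z _ w _ hzw => hdisj hzw) (fun z _ => Metric.isOpen_ball)
      (fun z _ => ⟨z, Metric.mem_ball_self hr0⟩)
    exact Set.countable_univ_iff.mp this
  refine ⟨d + 1, ?_⟩
  set s : ℝ := ((d + 1 : ℕ) : ℝ) with hs
  have hs0 : 0 ≤ s := Nat.cast_nonneg _
  set f : Space d → ℝ := fun x => (1 + ‖x‖) ^ (-s) with hf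
  have hfpos : ∀ x, 0 ≤ f x := fun x => by positivity
  have hfcont : Continuous f := by
    refine Continuous.rpow_const (by fun_prop) (fun x => Or.inl ?_)
    positivity
  have hint : Integrable f (volume : Measure (Space d)) := by
    refine integrable_one_add_norm ?_
    simp [hs]
  have hfin : ∫⁻ x, ENNReal.ofReal (f x) < ⊤ := by
    have := hint.hasFiniteIntegral
    rwa [hasFiniteIntegral_iff_ofReal (Eventually.of_forall hfpos)] at this
  refine ⟨hfcont.aestronglyMeasurable, ?_⟩
  rw [hasFiniteIntegral_iff_ofReal (Eventually.of_forall hfpos), combMeasure,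
    lintegral_sum_measure]
  have hmeas : Measurable fun x => ENNReal.ofReal (f x) :=
    hfcont.measurable.ennreal_ofReal
  set V := (volume : Measure (Space d)) (Metric.ball 0 r) with hV
  have hV0 : V ≠ 0 := (Metric.measure_ball_pos _ _ hr0).ne'
  have hVt : V ≠ ⊤ := measure_ball_lt_top.ne
  have key : ∀ z : L, ENNReal.ofReal (f z) * V ≤
      ENNReal.ofReal (2 ^ s) * ∫⁻ x in Metric.ball (z : Space d) r, ENNReal.ofReal (f x) := by
    intro z
    have hVz : V = (volume : Measure (Space d)) (Metric.ball (z : Space d) r) := by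
      exact (Measure.addHaar_ball_center volume (z : Space d) r).symm
    rw [hVz, ← setLIntegral_const, ← lintegral_const_mul _ hmeas]
    refine setLIntegral_mono (by fun_prop) fun x hx => ?_
    rw [← ENNReal.ofReal_mul (by positivity)]
    refine ENNReal.ofReal_le_ofReal ?_
    have hx1 : ‖x - z‖ < 1 := by
      rw [← dist_eq_norm]
      exact (Metric.mem_ball.mp hx).trans_le (min_le_right _ _)
    have hx2 : 1 + ‖x‖ ≤ 2 * (1 + ‖(z : Space d)‖) := by
      have := norm_add_le (x - z) (z : Space d)
      rw [sub_add_cancel] at this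
      have := norm_nonneg (z : Space d)
      linarith
    have h3 : (2 * (1 + ‖(z : Space d)‖)) ^ (-s) ≤ (1 + ‖x‖) ^ (-s) :=
      Real.rpow_le_rpow_of_nonpos (by positivity) hx2 (by linarith)
    rw [Real.mul_rpow (by positivity) (by positivity)] at h3
    calc f z = 2 ^ s * (2 ^ (-s) * (1 + ‖(z : Space d)‖) ^ (-s)) := by
          rw [← mul_assoc, ← Real.rpow_add two_pos]; simp [hf]
      _ ≤ 2 ^ s * f x := by gcongr
  have hsum : (∑' z : L, ENNReal.ofReal (f z)) * V < ⊤ := by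
    rw [← ENNReal.tsum_mul_right]
    refine (ENNReal.tsum_le_tsum key).trans_lt ?_
    rw [ENNReal.tsum_mul_left, ← lintegral_iUnion (fun _ => measurableSet_ball) hdisj]
    exact ENNReal.mul_lt_top ENNReal.ofReal_lt_top
      ((setLIntegral_le_lintegral _ _).trans_lt hfin)
  simp only [lintegral_dirac]
  by_contra hcon
  rw [not_lt, top_le_iff] at hcon
  rw [hcon, ENNReal.top_mul hV0] at hsum
  exact lt_irrefl _ hsum

/-- The generalized Dirac comb `𝟙_L = ∑_{z ∈ L} δ_z` as a tempered distribution. -/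
def diracComb (L : Set (Space d)) (hL : UniformlyDiscrete L) : 𝓢'(Space d, ℂ) :=
  haveI := combMeasure_hasTemperateGrowth hL
  (combMeasure L).toTemperedDistribution

/-- The form factor, the Fourier transform of the Dirac comb. -/
def formFactor (L : Set (Space d)) (hL : UniformlyDiscrete L) : 𝓢'(Space d, ℂ) :=
  𝓕 (diracComb L hL)

/-- The singular support of `u`: the complement of the set of all points that have an open
neighbourhood on which `u` is given by a smooth function. -/
def singSupp (u : 𝓢'(Space d, ℂ)) : Set (Space d) :=
  {x | ∃ Ω : Set (Space d), IsOpen Ω ∧ x ∈ Ω ∧ ∃ f : Space d → ℂ, ContDiffOn ℝ ∞ f Ω ∧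
    ∀ φ : 𝓢(Space d, ℂ), HasCompactSupport φ → tsupport φ ⊆ Ω →
      u φ = ∫ z, f z * φ z}ᶜ

/-- The set `L* = sing supp 𝟙̂_L`. -/
def dualSet (L : Set (Space d)) (hL : UniformlyDiscrete L) : Set (Space d) :=
  singSupp (formFactor L hL)

/-! ### Convolution with a Schwartz function, and the function `ψ_L` -/

/-- The Schwartz function `z ↦ φ (y - z)`. -/
def reflect (φ : 𝓢(Space d, ℂ)) (y : Space d) : 𝓢(Space d, ℂ) :=
  SchwartzMap.compSubConstCLM ℂ y
    (SchwartzMap.compCLMOfContinuousLinearEquiv ℂ (ContinuousLinearEquiv.neg ℝ) φ)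

theorem reflect_apply (φ : 𝓢(Space d, ℂ)) (y z : Space d) : reflect φ y z = φ (y - z) := by
  simp [reflect]

/-- The convolution `(u ∗ φ)(y) = u (φ (y - ·))` of a tempered distribution and a Schwartz
function. -/
def conv (u : 𝓢'(Space d, ℂ)) (φ : 𝓢(Space d, ℂ)) (y : Space d) : ℂ :=
  u (reflect φ y)

theorem gaussian_iteratedFDeriv_le (a : ℝ) (N : ℕ) :
    ∃ (K : ℕ) (C : ℝ), 0 ≤ C ∧ ∀ n ≤ N, ∀ x : Space d,
      ‖iteratedFDeriv ℝ n (fun x : Space d => Real.exp (-(a * ‖x‖ ^ 2))) x‖ ≤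
        C * (1 + ‖x‖) ^ K * Real.exp (-(a * ‖x‖ ^ 2)) := by
  set f : Space d → ℝ := fun x => Real.exp (-(a * ‖x‖ ^ 2)) with hf
  have hfs : ContDiff ℝ ∞ f := by
    have : ContDiff ℝ ∞ fun x : Space d => ‖x‖ ^ 2 := contDiff_norm_sq ℝ
    fun_prop
  set g : Space d →L[ℝ] (Space d →L[ℝ] ℝ) := (-(2 * a)) • innerSL ℝ with hg
  have hder : fderiv ℝ f = fun x => f x • g x := by
    funext x
    have h1 : HasFDerivAt (fun x : Space d => ‖x‖ ^ 2) (2 • (innerSL ℝ x)) x :=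
      (hasStrictFDerivAt_norm_sq x).hasFDerivAt
    have h2 := ((h1.const_mul a).fun_neg).exp
    rw [h2.fderiv]
    ext v
    have h3 : (innerSL ℝ x : Space d →L[ℝ] ℝ) v = inner ℝ x v := rfl
    have h4 : (g x) v = -(2 * a) * inner ℝ x v := rfl
    simp only [smul_apply, neg_apply, h3, h4, hf, smul_eq_mul, nsmul_eq_mul]
    push_cast
    ring
  induction N with
  | zero =>
    refine ⟨0, 1, zero_le_one, fun n hn x => ?_⟩
    obtain rfl : n = 0 := by omega
    simp [hf]
  | succ N ih =>
    obtain ⟨K, C, hC, h⟩ := ih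
    obtain ⟨K', C', hC', h'⟩ := g.hasTemperateGrowth.norm_iteratedFDeriv_le_uniform N
    refine ⟨K + K', C + 2 ^ N * (C * C'), by positivity, fun n hn x => ?_⟩
    have hx1 : 1 ≤ 1 + ‖x‖ := by linarith [norm_nonneg x]
    have hfx : 0 < f x := Real.exp_pos _
    rcases Nat.lt_or_ge n (N + 1) with hn' | hn'
    · refine (h n (by omega) x).trans ?_
      have hp : (1 + ‖x‖) ^ K ≤ (1 + ‖x‖) ^ (K + K') := pow_le_pow_right₀ hx1 (by omega)
      have hq : C ≤ C + 2 ^ N * (C * C') := le_add_of_nonneg_right (by positivity)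
      gcongr
    · obtain rfl : n = N + 1 := by omega
      rw [← norm_iteratedFDeriv_fderiv, hder]
      refine (norm_iteratedFDeriv_smul_le (N := ∞) hfs (g.contDiff) x
        (by exact_mod_cast le_top)).trans ?_
      calc _ ≤ ∑ i ∈ Finset.range (N + 1), (N.choose i : ℝ) *
              ((C * C') * (1 + ‖x‖) ^ (K + K') * f x) := by
            refine Finset.sum_le_sum fun i hi => ?_
            have hi' : i ≤ N := by simpa [Nat.lt_succ_iff] using hi
            rw [mul_assoc]
            refine mul_le_mul_of_nonneg_left ?_ (Nat.cast_nonneg _)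
            calc _ ≤ (C * (1 + ‖x‖) ^ K * f x) * (C' * (1 + ‖x‖) ^ K') :=
                  mul_le_mul (h i hi' x) (h' (N - i) (Nat.sub_le _ _) x) (norm_nonneg _)
                    (by positivity)
              _ = _ := by ring
        _ = 2 ^ N * (C * C') * (1 + ‖x‖) ^ (K + K') * f x := by
            rw [← Finset.sum_mul, ← Nat.cast_sum, Nat.sum_range_choose]
            push_cast
            ring
        _ ≤ _ := by
            gcongr
            exact le_add_of_nonneg_left hC

/-- The real-valued Gaussian `x ↦ exp (-a |x|²)`, `a > 0`, as a Schwartz function. -/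
def realGaussian (a : ℝ) (ha : 0 < a) : 𝓢(Space d, ℝ) where
  toFun x := Real.exp (-(a * ‖x‖ ^ 2))
  smooth' := by
    have : ContDiff ℝ ∞ fun x : Space d => ‖x‖ ^ 2 := contDiff_norm_sq ℝ
    fun_prop
  decay' := by
    intro k n
    obtain ⟨K, C, hC, h⟩ := gaussian_iteratedFDeriv_le (d := d) a n
    refine ⟨C * ((k + K).factorial * Real.exp (1 + 1 / (4 * a))), fun x => ?_⟩
    have h0 := norm_nonneg x
    calc _ ≤ (1 + ‖x‖) ^ k * (C * (1 + ‖x‖) ^ K * Real.exp (-(a * ‖x‖ ^ 2))) := by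
          gcongr
          · linarith
          · exact h n le_rfl x
      _ = C * ((1 + ‖x‖) ^ (k + K) * Real.exp (-(a * ‖x‖ ^ 2))) := by ring
      _ ≤ C * (((k + K).factorial * Real.exp (1 + ‖x‖)) * Real.exp (-(a * ‖x‖ ^ 2))) := by
          gcongr
          have := Real.pow_div_factorial_le_exp (1 + ‖x‖) (by positivity) (k + K)
          rwa [div_le_iff₀ (by positivity), mul_comm] at this
      _ ≤ _ := by
          rw [mul_assoc, ← Real.exp_add]
          refine mul_le_mul_of_nonneg_left (mul_le_mul_of_nonneg_left
            (Real.exp_le_exp.mpr ?_) (Nat.cast_nonneg _)) hC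
          have : 1 / (4 * a) - ‖x‖ + a * ‖x‖ ^ 2 = a * (‖x‖ - 1 / (2 * a)) ^ 2 := by
            field_simp
            ring
          nlinarith [mul_nonneg ha.le (sq_nonneg (‖x‖ - 1 / (2 * a)))]

/-- The Gaussian `z ↦ exp (-π |z|² / t²)`, `t > 0`, as a Schwartz function. -/
def gaussian (t : ℝ) (ht : 0 < t) : 𝓢(Space d, ℂ) :=
  SchwartzMap.postcompCLM Complex.ofRealCLM
    (realGaussian (Real.pi / t ^ 2) (by positivity))

theorem gaussian_apply (t : ℝ) (ht : 0 < t) (z : Space d) :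
    gaussian t ht z = Complex.exp (-(Real.pi * ‖z‖ ^ 2 / t ^ 2 : ℝ)) := by
  have : gaussian t ht z = ((Real.exp (-(Real.pi / t ^ 2 * ‖z‖ ^ 2)) : ℝ) : ℂ) := rfl
  rw [this]
  push_cast
  congr 2
  ring

/-- `ψ_L(t, y) = (𝟙̂_L ∗ exp (-π |·|² / t²))(y)` for `t > 0`. -/
def psi (L : Set (Space d)) (hL : UniformlyDiscrete L) (t : ℝ) (ht : 0 < t) (y : Space d) : ℂ :=
  conv (formFactor L hL) (gaussian t ht) y

/-! ### The Crandall function `G_ν` and the convolution with it -/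

/-- `G_ν(z) = ∫_{-1}^{1} |t|^{-ν} exp (-π |z|² / t²) dt / |t|` for `z ≠ 0`, and
`G_ν(0) = -2/ν`. -/
def crandallG (ν : ℂ) (z : Space d) : ℂ :=
  open Classical in
  if z = 0 then -2 / ν
  else ∫ t in (-1 : ℝ)..1,
    ((|t| : ℝ) : ℂ) ^ (-ν) * Complex.exp (-(Real.pi * ‖z‖ ^ 2 / t ^ 2 : ℝ)) / ((|t| : ℝ) : ℂ)

/-- `u` has order at most `k`: it is bounded by Schwartz seminorms that involve derivatives of
order at most `k` only. -/
def HasOrderLE (u : 𝓢'(Space d, ℂ)) (k : ℕ) : Prop :=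
  ∃ (m : ℕ) (C : ℝ), ∀ φ : 𝓢(Space d, ℂ),
    ‖u φ‖ ≤ C * ((Finset.Iic (m, k)).sup (schwartzSeminormFamily ℂ (Space d) ℂ)) φ

/-- The space `𝓢^k(ℝ^d)`: functions of class `C^k` of superalgebraic decay in all derivatives up
to order `k`. -/
def MemSk (k : ℕ) (g : Space d → ℂ) : Prop :=
  ContDiff ℝ k g ∧ ∀ m j : ℕ, j ≤ k → ∃ C : ℝ, ∀ x, ‖x‖ ^ m * ‖iteratedFDeriv ℝ j g x‖ ≤ C

/-- Convergence of a sequence of Schwartz functions to `g` in the topology of `𝓢^k(ℝ^d)`. -/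
def TendstoSk (k : ℕ) (φ : ℕ → 𝓢(Space d, ℂ)) (g : Space d → ℂ) : Prop :=
  ∀ m j : ℕ, j ≤ k → ∀ ε : ℝ, 0 < ε → ∀ᶠ n in atTop, ∀ x,
    ‖x‖ ^ m * ‖iteratedFDeriv ℝ j (fun z => φ n z - g z) x‖ ≤ ε

/-- `(u ∗ g)(y) = c` for `g ∈ 𝓢^k(ℝ^d)`: the value at `g (y - ·)` of the continuous extension of
`u` from `𝓢(ℝ^d)` to `𝓢^k(ℝ^d)` exists and is `c`. -/
def HasConvAt (u : 𝓢'(Space d, ℂ)) (k : ℕ) (g : Space d → ℂ) (y : Space d) (c : ℂ) : Prop :=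
  MemSk k (fun z => g (y - z)) ∧
  (∃ φ : ℕ → 𝓢(Space d, ℂ), TendstoSk k φ (fun z => g (y - z))) ∧
  ∀ φ : ℕ → 𝓢(Space d, ℂ), TendstoSk k φ (fun z => g (y - z)) →
    Tendsto (fun n => u (φ n)) atTop (𝓝 c)

/-- The distribution `u ∗ g`, defined by `(u ∗ g)(φ) = u (ǧ ∗ φ)` with `ǧ(z) = g(-z)`, is given on
the set `U` by the function `F`. -/
def IsConvOn (u : 𝓢'(Space d, ℂ)) (g : Space d → ℂ) (U : Set (Space d)) (F : Space d → ℂ) :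
    Prop :=
  ∀ φ : 𝓢(Space d, ℂ), HasCompactSupport φ → tsupport φ ⊆ U →
    ∃ θ : 𝓢(Space d, ℂ),
      (∀ x, Integrable (fun y => g (y - x) * φ y) ∧ θ x = ∫ y, g (y - x) * φ y) ∧
      u θ = ∫ y, F y * φ y

/-! ### The Hadamard integral -/

/-- `M` is the meromorphic continuation to `ν ∈ ℂ` of the integral `∫_0^1 I ν t dt`, which
converges absolutely when the real part of `ν` is large. (At the isolated points where `M` is not
analytic its value has no meaning.) -/
def IsHadamardIntegral (I : ℂ → ℝ → ℂ) (M : ℂ → ℂ) : Prop :=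
  MeromorphicOn M univ ∧ ∃ σ : ℝ, ∀ ν : ℂ, σ < ν.re →
    IntervalIntegrable (I ν) volume 0 1 ∧ M ν = ∫ t in (0 : ℝ)..1, I ν t

end SetZeta

end

noncomputable section

namespace SetZeta

variable {d : ℕ}

/-! ### The regularized trigonometric sums -/

/-! Write `μ` for the comb measure, so that the form factor is `φ ↦ ∫ φ̂ dμ` (`formFactor_apply`).
The Fourier transform of a Gaussian of width `t` centred at `y` turns `ψ_L(t, y)` into `t^d Θ(t²,
y)`, where `Θ(s, y) = ∫ exp (-π s |ξ|² - 2 π i ⟨ξ, y⟩) dμ(ξ)` solves a heat equation for `s > 0`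
(`pairing_reflect_gaussian`, `heatMul_eq_sum`). Everything is proved for `Θ_P`, with a symbol `P` of
temperate growth in the integrand, because every derivative of `Θ_P` is built from functions `Θ_Q`
with `Q` of the same kind (`hasFDerivAt_theta`).

Smoothness up to `s = 0`: if the distribution with symbol `P` is a smooth function `f` near a point,
then `Θ_P(s, y)` tends to `f`. The Gaussian is an approximate identity, and the part of the
distribution away from its centre contributes only `O(t)` (`tendsto_theta_sq`). The derivatives of
the distribution are smooth at the same points, so the limits exist for all derivatives of `Θ`. A
function on a half-space that is continuous up to the boundary together with its derivative is
differentiable there, and induction gives `contDiffOn_thetaExt`.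

Finite part: with `s = t²` the integral becomes the Mellin integral `∫_0^1 s^(w-1) Θ(s/λ², y) ds` at
`w = ν/2`, up to a constant factor. Integration by parts expresses it by the same integral at `w +
1`, with a division by `w` that the factor `1/Γ(w)` absorbs (`mul_heatInt`, `heatCont_succ`).
Iteration gives an entire function of `w` that is smooth in `y`.

Convolution: `G_{d-ν}(λ ·)` is a superposition of Gaussians of width `t/λ` with weight `2 t^(ν-d-1)
dt`, so applying the distribution under the integral gives the finite-part integral. This is done in
two ways. For `Re ν > d + k` the superposition converges in `𝓢^k`, since `j` derivatives cost
`t^(-j)` (`hasConvAt_gaussMix`). For `Re ν > 0` it converges after smearing with a test function,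
since all derivatives then fall on the test function and a Gaussian has mass of order `t^d`
(`isConvOn_crandallG`). -/

/-- The exponent `-π s |ξ|² - 2 π i ⟨ξ, y⟩`, as a real-linear function of `(s, y)`. -/
def heatPhase (ξ : Space d) : ℝ × Space d →L[ℝ] ℂ :=
  (ContinuousLinearMap.fst ℝ ℝ (Space d)).smulRight (-(Real.pi * ‖ξ‖ ^ 2 : ℝ) : ℂ) +
    ((innerSL ℝ ξ).comp (ContinuousLinearMap.snd ℝ ℝ (Space d))).smulRight
      (-(2 * Real.pi * Complex.I) : ℂ)

theorem heatPhase_apply (ξ : Space d) (p : ℝ × Space d) :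
    heatPhase ξ p = -((Real.pi * p.1 * ‖ξ‖ ^ 2 : ℝ) : ℂ) -
      2 * Real.pi * Complex.I * (inner ℝ ξ p.2 : ℝ) := by
  have : heatPhase ξ p = p.1 • (-(Real.pi * ‖ξ‖ ^ 2 : ℝ) : ℂ) +
      (inner ℝ ξ p.2 : ℝ) • (-(2 * Real.pi * Complex.I) : ℂ) := rfl
  rw [this]
  simp only [Complex.real_smul]
  push_cast
  ring

theorem norm_exp_heatPhase (ξ : Space d) (p : ℝ × Space d) :
    ‖Complex.exp (heatPhase ξ p)‖ = Real.exp (-(Real.pi * p.1 * ‖ξ‖ ^ 2)) := by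
  rw [heatPhase_apply, Complex.norm_exp]
  congr 1
  have h : (2 * Real.pi * Complex.I * (inner ℝ ξ p.2 : ℝ) : ℂ).re = 0 := by simp
  rw [Complex.sub_re, h, Complex.neg_re, Complex.ofReal_re, sub_zero]

theorem norm_heatPhase_le (ξ : Space d) :
    ‖heatPhase ξ‖ ≤ 2 * Real.pi * (1 + ‖ξ‖ ^ 2) := by
  have hpi := Real.pi_pos
  refine ContinuousLinearMap.opNorm_le_bound _ (by positivity) fun p => ?_
  rw [heatPhase_apply]
  have h1 : ‖p.1‖ ≤ ‖p‖ := norm_fst_le p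
  have h2 : ‖p.2‖ ≤ ‖p‖ := norm_snd_le p
  have h3 : ‖(inner ℝ ξ p.2 : ℝ)‖ ≤ ‖ξ‖ * ‖p.2‖ := norm_inner_le_norm _ _
  calc _ ≤ Real.pi * ‖p.1‖ * ‖ξ‖ ^ 2 + 2 * Real.pi * ‖(inner ℝ ξ p.2 : ℝ)‖ := by
        refine (norm_sub_le _ _).trans_eq ?_
        rw [norm_neg, Complex.norm_real, norm_mul, norm_mul, norm_mul, norm_mul, norm_mul,
          Complex.norm_real]
        simp [abs_of_pos hpi]
    _ ≤ Real.pi * ‖p‖ * ‖ξ‖ ^ 2 + 2 * Real.pi * (‖ξ‖ * ‖p‖) := by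
        gcongr
        exact h3.trans (by gcongr)
    _ ≤ _ := by
        have : 2 * ‖ξ‖ ≤ 1 + ‖ξ‖ ^ 2 := by nlinarith [sq_nonneg (‖ξ‖ - 1)]
        have h5 := mul_le_mul_of_nonneg_left this (mul_nonneg hpi.le (norm_nonneg p))
        nlinarith [mul_nonneg hpi.le (norm_nonneg p)]

theorem continuous_heatPhase_apply (p : ℝ × Space d) : Continuous fun ξ => heatPhase ξ p := by
  simp only [heatPhase_apply]
  fun_prop

theorem continuous_heatPhase : Continuous (heatPhase : Space d → ℝ × Space d →L[ℝ] ℂ) :=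
  continuous_clm_apply.2 continuous_heatPhase_apply

/-- `∫ P(ξ) exp (-π s |ξ|² - 2 π i ⟨ξ, y⟩) dμ(ξ)`. -/
def theta (μ : Measure (Space d)) (P : Space d → ℂ) (s : ℝ) (y : Space d) : ℂ :=
  ∫ ξ, P ξ * Complex.exp (heatPhase ξ (s, y)) ∂μ

/-- A multiplier of temperate growth maps the Gaussian to a Schwartz function, and Schwartz
functions are integrable against measures of temperate growth. -/
theorem integrable_mul_exp {μ : Measure (Space d)} [μ.HasTemperateGrowth] {P : Space d → ℂ}
    (hP : P.HasTemperateGrowth) {s : ℝ} (hs : 0 < s) :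
    Integrable (fun ξ => ‖P ξ‖ * Real.exp (-(Real.pi * s * ‖ξ‖ ^ 2))) μ := by
  have hs' : 0 < Real.pi * s := mul_pos Real.pi_pos hs
  have := (SchwartzMap.smulLeftCLM ℂ P (SchwartzMap.postcompCLM Complex.ofRealCLM
    (realGaussian (d := d) (Real.pi * s) hs'))).integrable (μ := μ)
  refine this.norm.congr (Eventually.of_forall fun ξ => ?_)
  simp only [SchwartzMap.smulLeftCLM_apply_apply hP, smul_eq_mul, norm_mul]
  congr 1
  have h1 : (SchwartzMap.postcompCLM Complex.ofRealCLM (realGaussian (d := d) (Real.pi * s) hs')) ξ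
    = ((Real.exp (-(Real.pi * s * ‖ξ‖ ^ 2)) : ℝ) : ℂ) := rfl
  rw [h1, Complex.norm_real, Real.norm_eq_abs, abs_of_pos (Real.exp_pos _)]

theorem integrable_theta {μ : Measure (Space d)} [μ.HasTemperateGrowth] {P : Space d → ℂ}
    (hP : P.HasTemperateGrowth) {s : ℝ} (hs : 0 < s) (y : Space d) :
    Integrable (fun ξ => P ξ * Complex.exp (heatPhase ξ (s, y))) μ := by
  refine (integrable_mul_exp hP hs).mono' ?_ (Eventually.of_forall fun ξ => ?_)
  · exact (hP.1.continuous.mul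
      (Complex.continuous_exp.comp (continuous_heatPhase_apply _))).aestronglyMeasurable
  · rw [norm_mul, norm_exp_heatPhase]

/-- The symbol of the derivative in `s`. -/
def heatMul (P : Space d → ℂ) (ξ : Space d) : ℂ := -((Real.pi * ‖ξ‖ ^ 2 : ℝ) : ℂ) * P ξ

/-- The symbol of the derivative in the direction of the `i`th coordinate. -/
def dirMul (i : Fin d) (P : Space d → ℂ) (ξ : Space d) : ℂ :=
  -(2 * Real.pi * Complex.I * (ξ i : ℝ)) * P ξ

/-- The linear form `(s, y) ↦ s A + ∑ i, y i B i`. -/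
def gradCLM (A : ℂ) (B : Fin d → ℂ) : ℝ × Space d →L[ℝ] ℂ :=
  (ContinuousLinearMap.fst ℝ ℝ (Space d)).smulRight A +
    ∑ i, ((EuclideanSpace.proj i : Space d →L[ℝ] ℝ).comp
      (ContinuousLinearMap.snd ℝ ℝ (Space d))).smulRight (B i)

theorem gradCLM_apply (A : ℂ) (B : Fin d → ℂ) (p : ℝ × Space d) :
    gradCLM A B p = p.1 * A + ∑ i, (p.2 i : ℂ) * B i := by
  simp [gradCLM, Complex.real_smul]

theorem hasTemperateGrowth_coord (i : Fin d) :
    (fun ξ : Space d => ((ξ i : ℝ) : ℂ)).HasTemperateGrowth :=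
  (Complex.ofRealCLM.comp (EuclideanSpace.proj i : Space d →L[ℝ] ℝ)).hasTemperateGrowth

theorem hasTemperateGrowth_dirMul {P : Space d → ℂ} (hP : P.HasTemperateGrowth) (i : Fin d) :
    (dirMul i P).HasTemperateGrowth := by
  have := ((Function.HasTemperateGrowth.const (-(2 * Real.pi * Complex.I) : ℂ)).mul
    (hasTemperateGrowth_coord i)).mul hP
  have h : dirMul i P = ((fun _ => (-(2 * Real.pi * Complex.I) : ℂ)) *
      fun ξ : Space d => ((ξ i : ℝ) : ℂ)) * P := by
    funext ξ
    simp [dirMul]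
  rw [h]
  exact this

/-- The heat equation `∂_s = (4π)⁻¹ Δ_y` on symbols. It reduces every closure property under
`heatMul` to the one under `dirMul`. -/
theorem heatMul_eq_sum (P : Space d → ℂ) :
    heatMul P = ∑ i, (1 / (4 * Real.pi) : ℂ) • dirMul i (dirMul i P) := by
  funext ξ
  have hpi : (Real.pi : ℂ) ≠ 0 := by exact_mod_cast Real.pi_ne_zero
  simp only [heatMul, dirMul, Finset.sum_apply, Pi.smul_apply, smul_eq_mul,
    EuclideanSpace.norm_sq_eq, Real.norm_eq_abs, sq_abs]
  push_cast
  rw [Finset.mul_sum, ← Finset.sum_neg_distrib, Finset.sum_mul]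
  refine Finset.sum_congr rfl fun i _ => ?_
  field_simp
  linear_combination (-4 * (ξ i : ℂ) ^ 2 * P ξ) * Complex.I_sq

theorem hasTemperateGrowth_heatMul {P : Space d → ℂ} (hP : P.HasTemperateGrowth) :
    (heatMul P).HasTemperateGrowth := by
  rw [heatMul_eq_sum]
  have : ∀ i ∈ (Finset.univ : Finset (Fin d)), Function.HasTemperateGrowth
      ((1 / (4 * Real.pi) : ℂ) • dirMul i (dirMul i P)) := fun i _ =>
    (Function.HasTemperateGrowth.const _).mul
      (hasTemperateGrowth_dirMul (hasTemperateGrowth_dirMul hP i) i)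
  convert Function.HasTemperateGrowth.sum this using 1
  funext ξ
  simp

theorem mul_heatPhase (P : Space d → ℂ) (ξ : Space d) (e : ℂ) :
    (P ξ * e) • heatPhase ξ = gradCLM (heatMul P ξ * e) (fun i => dirMul i P ξ * e) := by
  refine ContinuousLinearMap.ext fun p => ?_
  rw [gradCLM_apply]
  have h : ((P ξ * e) • heatPhase ξ) p = P ξ * e * heatPhase ξ p := rfl
  rw [h, heatPhase_apply]
  simp only [heatMul, dirMul, PiLp.inner_apply, RCLike.inner_apply, conj_trivial]
  push_cast
  rw [mul_sub, Finset.mul_sum, Finset.mul_sum, sub_eq_add_neg, ← Finset.sum_neg_distrib]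
  congr 1
  · ring
  · exact Finset.sum_congr rfl fun i _ => by ring

/-- Differentiation under the integral sign. On the half-space where the first variable exceeds `s /
2`, the Gaussian of parameter `s / 2` dominates, and the linear growth of the derivative of the
phase is absorbed into the symbol. -/
theorem hasFDerivAt_theta {μ : Measure (Space d)} [μ.HasTemperateGrowth] {P : Space d → ℂ}
    (hP : P.HasTemperateGrowth) {s : ℝ} (hs : 0 < s) (y : Space d) :
    HasFDerivAt (fun p : ℝ × Space d => theta μ P p.1 p.2)
      (gradCLM (theta μ (heatMul P) s y) (fun i => theta μ (dirMul i P) s y)) (s, y) := by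
  have hbound : Integrable (fun ξ => ‖(2 * Real.pi * (1 + (‖ξ‖ ^ 2 : ℝ)) : ℂ) * P ξ‖ *
      Real.exp (-(Real.pi * (s / 2) * ‖ξ‖ ^ 2))) μ := by
    refine integrable_mul_exp (P := fun ξ => (2 * Real.pi * (1 + (‖ξ‖ ^ 2 : ℝ)) : ℂ) * P ξ) ?_
      (half_pos hs)
    refine Function.HasTemperateGrowth.mul ?_ hP
    refine (Function.HasTemperateGrowth.const _).mul ((Function.HasTemperateGrowth.const _).add ?_)
    exact Function.HasTemperateGrowth.comp Function.Complex.hasTemperateGrowth_ofReal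
      (Function.hasTemperateGrowth_norm_sq _)
  have hmem : {p : ℝ × Space d | s / 2 < p.1} ∈ 𝓝 ((s, y) : ℝ × Space d) :=
    (isOpen_lt continuous_const continuous_fst).mem_nhds (by simp [hs])
  have hmeas : ∀ p : ℝ × Space d,
      AEStronglyMeasurable (fun ξ => P ξ * Complex.exp (heatPhase ξ p)) μ := fun p =>
    (hP.1.continuous.mul
      (Complex.continuous_exp.comp (continuous_heatPhase_apply _))).aestronglyMeasurable
  have hle : ∀ (ξ : Space d) (p : ℝ × Space d), s / 2 < p.1 →
      ‖(P ξ * Complex.exp (heatPhase ξ p)) • heatPhase ξ‖ ≤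
        ‖(2 * Real.pi * (1 + (‖ξ‖ ^ 2 : ℝ)) : ℂ) * P ξ‖ *
          Real.exp (-(Real.pi * (s / 2) * ‖ξ‖ ^ 2)) := by
    intro ξ p hp
    have hpi := Real.pi_pos
    have h1 : ‖(2 * Real.pi * (1 + (‖ξ‖ ^ 2 : ℝ)) : ℂ)‖ = 2 * Real.pi * (1 + ‖ξ‖ ^ 2) := by
      rw [show (2 * Real.pi * (1 + (‖ξ‖ ^ 2 : ℝ)) : ℂ) =
        ((2 * Real.pi * (1 + ‖ξ‖ ^ 2) : ℝ) : ℂ) by push_cast; ring, Complex.norm_real,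
        Real.norm_of_nonneg (by positivity)]
    rw [norm_smul, norm_mul, norm_mul, norm_exp_heatPhase, h1]
    calc _ ≤ ‖P ξ‖ * Real.exp (-(Real.pi * (s / 2) * ‖ξ‖ ^ 2)) *
          (2 * Real.pi * (1 + ‖ξ‖ ^ 2)) := by
          gcongr
          exact norm_heatPhase_le ξ
      _ = _ := by ring
  have key := hasFDerivAt_integral_of_dominated_of_fderiv_le (𝕜 := ℝ) (μ := μ)
    (F := fun (p : ℝ × Space d) ξ => P ξ * Complex.exp (heatPhase ξ p))
    (F' := fun p ξ => (P ξ * Complex.exp (heatPhase ξ p)) • heatPhase ξ)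
    (x₀ := (s, y)) hmem (Eventually.of_forall hmeas) (integrable_theta hP hs y)
    ((hmeas _).smul continuous_heatPhase.aestronglyMeasurable)
    (Eventually.of_forall hle) hbound
    (Eventually.of_forall fun ξ p _ => ?_)
  · have hval : gradCLM (theta μ (heatMul P) s y) (fun i => theta μ (dirMul i P) s y) =
        ∫ ξ, (P ξ * Complex.exp (heatPhase ξ (s, y))) • heatPhase ξ ∂μ := ?_
    · rw [hval]
      exact key
    simp_rw [mul_heatPhase]
    have hA := integrable_theta (μ := μ) (hasTemperateGrowth_heatMul hP) hs y
    have hB := fun i => integrable_theta (μ := μ) (hasTemperateGrowth_dirMul hP i) hs y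
    have hint : Integrable (fun ξ => gradCLM (heatMul P ξ * Complex.exp (heatPhase ξ (s, y)))
        (fun i => dirMul i P ξ * Complex.exp (heatPhase ξ (s, y)))) μ := by
      simp only [← mul_heatPhase]
      refine hbound.mono' ((hmeas _).smul continuous_heatPhase.aestronglyMeasurable)
        (Eventually.of_forall fun ξ => hle ξ _ (by simp [hs]))
    refine ContinuousLinearMap.ext fun p => ?_
    rw [ContinuousLinearMap.integral_apply hint]
    simp only [gradCLM_apply]
    rw [integral_add (hA.const_mul _) (integrable_finsetSum _ fun i _ => (hB i).const_mul _),
      integral_finsetSum _ fun i _ => (hB i).const_mul _]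
    simp only [integral_const_mul, theta]
  · have h1 := ((heatPhase ξ).hasFDerivAt (x := p)).cexp.const_mul (P ξ)
    rwa [smul_smul] at h1

/-! ### Pairings and Gaussians -/

/-- Continuity involves finitely many seminorms, and these fit into one box of indices. Used both
for the finite order of the form factor and to estimate its action on Gaussian tails. -/
theorem exists_bound_of_continuous (u : 𝓢(Space d, ℂ) →ₗ[ℂ] ℂ) (hu : Continuous u) :
    ∃ (m k : ℕ) (C : ℝ), 0 ≤ C ∧ ∀ φ : 𝓢(Space d, ℂ),
      ‖u φ‖ ≤ C * ((Finset.Iic (m, k)).sup (schwartzSeminormFamily ℂ (Space d) ℂ)) φ := by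
  obtain ⟨s, C, -, h⟩ := Seminorm.bound_of_continuous
    (schwartz_withSeminorms ℂ (Space d) ℂ) ((normSeminorm ℂ ℂ).comp u)
    (continuous_norm.comp hu)
  refine ⟨s.sup Prod.fst, s.sup Prod.snd, C, C.2, fun φ => (h φ).trans ?_⟩
  have hs : s ⊆ Finset.Iic (s.sup Prod.fst, s.sup Prod.snd) := fun p hp =>
    Finset.mem_Iic.2 ⟨Finset.le_sup (f := Prod.fst) hp, Finset.le_sup (f := Prod.snd) hp⟩
  have h2 : (s.sup (schwartzSeminormFamily ℂ (Space d) ℂ)) φ ≤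
      ((Finset.Iic (s.sup Prod.fst, s.sup Prod.snd)).sup
        (schwartzSeminormFamily ℂ (Space d) ℂ)) φ := Seminorm.le_def.1 (Finset.sup_mono hs) φ
  exact mul_le_mul_of_nonneg_left h2 C.2

/-- The functional `φ ↦ ∫ P(ξ) φ̂(ξ) dμ(ξ)`. -/
def pairing (μ : Measure (Space d)) [μ.HasTemperateGrowth] (P : Space d → ℂ) :
    𝓢(Space d, ℂ) →L[ℂ] ℂ :=
  (SchwartzMap.integralCLM ℂ μ).comp
    ((SchwartzMap.smulLeftCLM ℂ P).comp (SchwartzMap.fourierTransformCLM ℂ))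

theorem pairing_apply {μ : Measure (Space d)} [μ.HasTemperateGrowth] {P : Space d → ℂ}
    (hP : P.HasTemperateGrowth) (φ : 𝓢(Space d, ℂ)) :
    pairing μ P φ = ∫ ξ, P ξ * 𝓕 φ ξ ∂μ := by
  have : pairing μ P φ = ∫ ξ, SchwartzMap.smulLeftCLM ℂ P (𝓕 φ) ξ ∂μ := rfl
  rw [this]
  simp only [SchwartzMap.smulLeftCLM_apply_apply hP, smul_eq_mul]

theorem fourier_reflect (φ : 𝓢(Space d, ℂ)) (y ξ : Space d) :
    𝓕 (reflect φ y) ξ = Complex.exp (-(2 * Real.pi * Complex.I * (inner ℝ ξ y : ℝ))) *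
      𝓕 φ (-ξ) := by
  rw [SchwartzMap.fourier_coe, SchwartzMap.fourier_coe, Real.fourier_eq', Real.fourier_eq',
    ← integral_sub_left_eq_self _ _ y, ← integral_const_mul]
  refine integral_congr_ae (Eventually.of_forall fun x => ?_)
  simp only [reflect_apply, smul_eq_mul, sub_sub_cancel]
  rw [← mul_assoc, ← Complex.exp_add]
  congr 2
  rw [inner_neg_right, inner_sub_left, real_inner_comm ξ y]
  push_cast
  ring

theorem fourier_gaussian_apply (t : ℝ) (ht : 0 < t) (ξ : Space d) :
    𝓕 (gaussian t ht) ξ = (t : ℂ) ^ d * Complex.exp (-((Real.pi * t ^ 2 * ‖ξ‖ ^ 2 : ℝ) : ℂ)) := by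
  have hb : 0 < ((Real.pi / t ^ 2 : ℝ) : ℂ).re := by
    rw [Complex.ofReal_re]; positivity
  have hcoe : (gaussian t ht : Space d → ℂ) =
      fun v => Complex.exp (-((Real.pi / t ^ 2 : ℝ) : ℂ) * (‖v‖ : ℂ) ^ 2) := by
    funext v
    rw [gaussian_apply]
    congr 1
    push_cast
    ring
  rw [SchwartzMap.fourier_coe, hcoe, fourier_gaussian_innerProductSpace hb]
  have htc : (t : ℂ) ≠ 0 := by exact_mod_cast ht.ne'
  have hpi : (Real.pi : ℂ) ≠ 0 := by exact_mod_cast Real.pi_ne_zero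
  congr 1
  · rw [finrank_euclideanSpace_fin]
    have h1 : (Real.pi : ℂ) / ((Real.pi / t ^ 2 : ℝ) : ℂ) = ((t ^ 2 : ℝ) : ℂ) := by
      push_cast; field_simp
    have h2 : (d / 2 : ℂ) = ((d / 2 : ℝ) : ℂ) := by push_cast; rfl
    rw [h1, h2, ← Complex.ofReal_cpow (by positivity), ← Complex.ofReal_pow]
    congr 1
    rw [← Real.rpow_natCast t 2, ← Real.rpow_mul ht.le, ← Real.rpow_natCast t d]
    congr 1
    push_cast
    ring
  · congr 1
    push_cast
    field_simp

theorem fourier_reflect_gaussian (t : ℝ) (ht : 0 < t) (y ξ : Space d) :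
    𝓕 (reflect (gaussian t ht) y) ξ = (t : ℂ) ^ d * Complex.exp (heatPhase ξ (t ^ 2, y)) := by
  rw [fourier_reflect, fourier_gaussian_apply, heatPhase_apply, mul_left_comm, ← Complex.exp_add,
    norm_neg]
  congr 2
  ring

/-- The bridge from Gaussian convolutions to `theta`: the heat parameter is the square of the width,
and the factor `t ^ d` is the mass of the Gaussian. -/
theorem pairing_reflect_gaussian {μ : Measure (Space d)} [μ.HasTemperateGrowth]
    {P : Space d → ℂ} (hP : P.HasTemperateGrowth) (t : ℝ) (ht : 0 < t) (y : Space d) :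
    pairing μ P (reflect (gaussian t ht) y) = (t : ℂ) ^ d * theta μ P (t ^ 2) y := by
  rw [pairing_apply hP, theta, ← integral_const_mul]
  refine integral_congr_ae (Eventually.of_forall fun ξ => ?_)
  simp only [fourier_reflect_gaussian]
  ring

/-! ### Seminorms of rescaled Gaussians. -/

theorem iteratedFDeriv_comp_smul_sub {g : Space d → ℂ} (hg : ContDiff ℝ ∞ g) (c : ℝ)
    (y z : Space d) (j : ℕ) :
    iteratedFDeriv ℝ j (fun z => g (c • (y - z))) z =
      (-c) ^ j • iteratedFDeriv ℝ j g (c • (y - z)) := by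
  have h1 : (fun z => g (c • (y - z))) = fun z => (fun w => g ((-c) • w)) (z - y) := by
    funext z
    simp only [neg_smul, ← smul_neg, neg_sub]
  rw [h1, iteratedFDeriv_comp_sub (f := fun w => g ((-c) • w)),
    iteratedFDeriv_comp_const_smul (-c) (hg.of_le (by exact_mod_cast le_top))]
  simp only [neg_smul, ← smul_neg, neg_sub]

theorem gaussian_eq_gaussian_one (t : ℝ) (ht : 0 < t) (z : Space d) :
    gaussian t ht z = gaussian 1 one_pos (t⁻¹ • z) := by
  rw [gaussian_apply, gaussian_apply, norm_smul, Real.norm_of_nonneg (by positivity)]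
  congr 3
  rw [one_pow]
  field_simp

theorem norm_iteratedFDeriv_reflect_gaussian (t : ℝ) (ht : 0 < t) (y z : Space d) (j : ℕ) :
    ‖iteratedFDeriv ℝ j (reflect (gaussian t ht) y) z‖ =
      (t⁻¹) ^ j * ‖iteratedFDeriv ℝ j (gaussian (d := d) 1 one_pos) (t⁻¹ • (y - z))‖ := by
  have h : (reflect (gaussian t ht) y : Space d → ℂ) =
      fun z => gaussian (d := d) 1 one_pos (t⁻¹ • (y - z)) := by
    funext z
    rw [reflect_apply, gaussian_eq_gaussian_one]
  rw [h, iteratedFDeriv_comp_smul_sub ((gaussian (d := d) 1 one_pos).smooth ⊤), norm_smul]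
  simp [abs_of_pos ht]

theorem schwartz_decay_uniform (φ : 𝓢(Space d, ℂ)) (M n : ℕ) :
    ∃ C : ℝ, 0 ≤ C ∧ ∀ j ≤ n, ∀ x, (1 + ‖x‖) ^ M * ‖iteratedFDeriv ℝ j φ x‖ ≤ C :=
  ⟨2 ^ M * (Finset.Iic (M, n)).sup (fun m => SchwartzMap.seminorm ℂ m.1 m.2) φ,
    mul_nonneg (by positivity) (apply_nonneg _ _), fun _ hj x =>
    SchwartzMap.one_add_le_sup_seminorm_apply (𝕜 := ℂ) (m := (M, n)) le_rfl hj φ x⟩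

/-- Away from its centre, a Gaussian of width `t` is `O(t^(d+1))` in every Schwartz seminorm. -/
theorem seminorm_smulLeft_gaussian_le {η : Space d → ℂ} (hη : η.HasTemperateGrowth)
    (y₀ : Space d) {r : ℝ} (hr : 0 < r) (hη0 : ∀ z ∈ Metric.ball y₀ r, η z = 0) (m n : ℕ) :
    ∃ C : ℝ, 0 ≤ C ∧ ∀ (t : ℝ) (ht : 0 < t), t ≤ 1 → ∀ y ∈ Metric.ball y₀ (r / 2),
      SchwartzMap.seminorm ℂ m n (SchwartzMap.smulLeftCLM ℂ η (reflect (gaussian t ht) y)) ≤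
        C * t ^ (d + 1) := by
  obtain ⟨K, C₁, hC₁, h₁⟩ := hη.norm_iteratedFDeriv_le_uniform n
  -- Of this decay, `m + K` pays for the weight and for the growth of `η`, `n` for the factor `t⁻¹ ^
  -- n` produced by rescaling the derivatives, and `d + 1` remains as the asserted power of `t`.
  obtain ⟨C₂, hC₂, h₂⟩ := schwartz_decay_uniform (gaussian (d := d) 1 one_pos)
    (m + K + (n + d + 1)) n
  set A : ℝ := 1 + ‖y₀‖ + r with hA
  have hA0 : 0 < A := by positivity
  refine ⟨2 ^ n * (C₁ * C₂ * A ^ (m + K) * (2 / r) ^ (n + d + 1)), by positivity, ?_⟩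
  intro t ht ht1 y hy
  refine SchwartzMap.seminorm_le_bound ℂ m n _ (by positivity) fun z => ?_
  rw [SchwartzMap.smulLeftCLM_apply hη]
  by_cases hz : z ∈ Metric.ball y₀ r
  · have h0 : (fun x => η x • reflect (gaussian t ht) y x) =ᶠ[𝓝 z] fun _ => 0 := by
      filter_upwards [Metric.isOpen_ball.mem_nhds hz] with x hx
      rw [hη0 x hx, zero_smul]
    rw [(h0.iteratedFDeriv ℝ n).eq_of_nhds]
    have : iteratedFDeriv ℝ n (fun _ : Space d => (0 : ℂ)) z = 0 := by
      rw [iteratedFDeriv_fun_zero]; rfl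
    rw [this, norm_zero, mul_zero]
    positivity
  have hyz : r / 2 ≤ ‖y - z‖ := by
    rw [Metric.mem_ball, not_lt] at hz
    rw [Metric.mem_ball] at hy
    have := dist_triangle z y y₀
    rw [← dist_eq_norm, dist_comm y z]
    linarith
  set w : Space d := t⁻¹ • (y - z) with hw
  have hwn : ‖w‖ = ‖y - z‖ / t := by
    rw [hw, norm_smul, norm_inv, Real.norm_of_nonneg ht.le, inv_mul_eq_div]
  have hw1 : ‖y - z‖ ≤ ‖w‖ := by
    rw [hwn, le_div_iff₀ ht]
    exact mul_le_of_le_one_right (norm_nonneg _) ht1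
  -- Outside the ball the distance to `y` is at least `r / 2`. Multiplying by powers of this
  -- quantity therefore trades decay in the rescaled variable `w` for powers of `t`.
  have hw2 : 1 ≤ (2 / r * t) * (1 + ‖w‖) := by
    have : r / 2 ≤ t * (1 + ‖w‖) := by
      rw [mul_add, hwn, mul_div_cancel₀ _ ht.ne']
      linarith
    calc (1 : ℝ) = 2 / r * (r / 2) := by field_simp
      _ ≤ 2 / r * (t * (1 + ‖w‖)) := by gcongr
      _ = _ := by ring
  have hz1 : 1 + ‖z‖ ≤ A * (1 + ‖w‖) := by
    have h3 : ‖z‖ ≤ ‖y‖ + ‖y - z‖ := by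
      have := norm_sub_le y (y - z)
      rwa [sub_sub_cancel] at this
    have h4 : ‖y‖ ≤ ‖y₀‖ + r / 2 := by
      have h5 : ‖y - y₀‖ < r / 2 := by rwa [← dist_eq_norm]
      have := norm_add_le (y - y₀) y₀
      rw [sub_add_cancel] at this
      linarith
    have h6 : 1 ≤ A := by linarith [norm_nonneg y₀]
    nlinarith [norm_nonneg w, norm_nonneg y₀]
  have hterm : ∀ i ∈ Finset.range (n + 1),
      ‖z‖ ^ m * ((n.choose i : ℝ) * ‖iteratedFDeriv ℝ i η z‖ *
        ‖iteratedFDeriv ℝ (n - i) (reflect (gaussian t ht) y) z‖) ≤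
      (n.choose i : ℝ) * (C₁ * C₂ * A ^ (m + K) * (2 / r) ^ (n + d + 1) * t ^ (d + 1)) := by
    intro i hi
    have hi' : i ≤ n := Nat.lt_succ_iff.1 (Finset.mem_range.1 hi)
    rw [norm_iteratedFDeriv_reflect_gaussian]
    set D := ‖iteratedFDeriv ℝ (n - i) (gaussian (d := d) 1 one_pos) w‖ with hD
    have hD2 : (1 + ‖w‖) ^ (m + K + (n + d + 1)) * D ≤ C₂ := h₂ _ (Nat.sub_le _ _) w
    have hti : (t⁻¹) ^ (n - i) ≤ (t⁻¹) ^ n :=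
      pow_le_pow_right₀ ((one_le_inv₀ ht).2 ht1) (Nat.sub_le _ _)
    have hzm : ‖z‖ ^ m ≤ (1 + ‖z‖) ^ m := by gcongr; linarith
    calc ‖z‖ ^ m * ((n.choose i : ℝ) * ‖iteratedFDeriv ℝ i η z‖ * ((t⁻¹) ^ (n - i) * D))
        ≤ (1 + ‖z‖) ^ m * ((n.choose i : ℝ) * (C₁ * (1 + ‖z‖) ^ K) * ((t⁻¹) ^ n * D)) := by
          gcongr
          exact h₁ i hi' z
      _ = (n.choose i : ℝ) * C₁ * (1 + ‖z‖) ^ (m + K) * ((t⁻¹) ^ n * D) * 1 := by ring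
      _ ≤ (n.choose i : ℝ) * C₁ * (A * (1 + ‖w‖)) ^ (m + K) * ((t⁻¹) ^ n * D) *
          ((2 / r * t) * (1 + ‖w‖)) ^ (n + d + 1) := by
          gcongr
          exact one_le_pow₀ hw2
      _ = (n.choose i : ℝ) * C₁ * A ^ (m + K) * (2 / r) ^ (n + d + 1) *
          ((t⁻¹) ^ n * t ^ n * t ^ (d + 1)) * ((1 + ‖w‖) ^ (m + K + (n + d + 1)) * D) := by
          rw [mul_pow, mul_pow, mul_pow]; ring
      _ ≤ (n.choose i : ℝ) * C₁ * A ^ (m + K) * (2 / r) ^ (n + d + 1) *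
          ((t⁻¹) ^ n * t ^ n * t ^ (d + 1)) * C₂ := by gcongr
      _ = _ := by
          rw [← mul_pow, inv_mul_cancel₀ ht.ne', one_pow]; ring
  calc ‖z‖ ^ m * ‖iteratedFDeriv ℝ n (fun x => η x • reflect (gaussian t ht) y x) z‖
      ≤ ‖z‖ ^ m * ∑ i ∈ Finset.range (n + 1), (n.choose i : ℝ) * ‖iteratedFDeriv ℝ i η z‖ *
        ‖iteratedFDeriv ℝ (n - i) (reflect (gaussian t ht) y) z‖ := by
        gcongr
        exact norm_iteratedFDeriv_smul_le (N := ∞) hη.1 ((reflect (gaussian t ht) y).smooth ⊤) z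
          (by exact_mod_cast le_top)
    _ ≤ ∑ i ∈ Finset.range (n + 1), (n.choose i : ℝ) *
        (C₁ * C₂ * A ^ (m + K) * (2 / r) ^ (n + d + 1) * t ^ (d + 1)) := by
        rw [Finset.mul_sum]
        exact Finset.sum_le_sum hterm
    _ = _ := by
        rw [← Finset.sum_mul, ← Nat.cast_sum, Nat.sum_range_choose]
        push_cast
        ring

/-! ### Regular points of the form factor -/

/-- The distribution `φ ↦ ∫ P(ξ) φ̂(ξ) dμ(ξ)` is given on `Ω` by the smooth function `f`. -/
def Represents (μ : Measure (Space d)) [μ.HasTemperateGrowth] (Ω : Set (Space d))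
    (P f : Space d → ℂ) : Prop :=
  ContDiffOn ℝ ∞ f Ω ∧ ∀ φ : 𝓢(Space d, ℂ), HasCompactSupport φ → tsupport φ ⊆ Ω →
    pairing μ P φ = ∫ z, f z * φ z

/-- `P` is a symbol of temperate growth whose distribution is smooth on `Ω`. -/
def RegularOn (μ : Measure (Space d)) [μ.HasTemperateGrowth] (Ω : Set (Space d))
    (P : Space d → ℂ) : Prop :=
  P.HasTemperateGrowth ∧ ∃ f, Represents μ Ω P f

theorem continuous_mul_of_tsupport_subset {Ω : Set (Space d)} (hΩ : IsOpen Ω)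
    {g φ : Space d → ℂ} (hg : ContinuousOn g Ω) (hφ : Continuous φ) (hs : tsupport φ ⊆ Ω) :
    Continuous fun z => g z * φ z :=
  (hg.mul hφ.continuousOn).continuous_of_tsupport_subset hΩ
    ((tsupport_mul_subset_right (f := g) (g := φ)).trans hs)

theorem integrable_mul_of_tsupport_subset {Ω : Set (Space d)} (hΩ : IsOpen Ω)
    {g φ : Space d → ℂ} (hg : ContinuousOn g Ω) (hφ : Continuous φ) (hc : HasCompactSupport φ)
    (hs : tsupport φ ⊆ Ω) : Integrable fun z => g z * φ z :=
  (continuous_mul_of_tsupport_subset hΩ hg hφ hs).integrable_of_hasCompactSupport hc.mul_left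

/-! ### Stability of regular points under differentiation. -/

section Closure

variable {μ : Measure (Space d)} [μ.HasTemperateGrowth] {Ω : Set (Space d)}

open LineDeriv in
-- Multiplying the symbol by `-2πi ξ_i` differentiates the distribution: the factor moves onto the
-- test function as `-∂_i`, and integration by parts against a test function supported in `Ω` moves
-- the derivative onto `f`.
theorem Represents.dirMul (hΩ : IsOpen Ω) {P f : Space d → ℂ} (hP : P.HasTemperateGrowth)
    (hf : Represents μ Ω P f) (i : Fin d) :
    Represents μ Ω (dirMul i P) fun z => fderiv ℝ f z (EuclideanSpace.single i 1) := by
  have hfd : ContDiffOn ℝ ∞ (fderiv ℝ f) Ω := hf.1.fderiv_of_isOpen hΩ (by simp)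
  refine ⟨hfd.clm_apply contDiffOn_const, fun φ hc hs => ?_⟩
  set v : Space d := EuclideanSpace.single i 1 with hv
  have hd : ∀ x, (∂_{v} φ) x = fderiv ℝ φ x v := fun x =>
    SchwartzMap.lineDerivOp_apply_eq_fderiv v φ x
  have hs' : tsupport (∂_{v} φ : 𝓢(Space d, ℂ)) ⊆ tsupport φ :=
    SchwartzMap.tsupport_lineDerivOp_subset v φ
  have hc' : HasCompactSupport (∂_{v} φ : 𝓢(Space d, ℂ)) :=
    hc.of_isClosed_subset (isClosed_tsupport _) hs'
  have h1 : pairing μ (SetZeta.dirMul i P) φ = - pairing μ P (∂_{v} φ) := by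
    rw [pairing_apply (hasTemperateGrowth_dirMul hP i), pairing_apply hP, ← integral_neg]
    refine integral_congr_ae (Eventually.of_forall fun ξ => ?_)
    have h2 : 𝓕 (∂_{v} φ : 𝓢(Space d, ℂ)) ξ = (2 * Real.pi * Complex.I) * ((ξ i : ℝ) * 𝓕 φ ξ) := by
      rw [SchwartzMap.fourier_lineDerivOp_eq]
      have h3 : (inner ℝ · v : Space d → ℝ).HasTemperateGrowth :=
        Function.hasTemperateGrowth_inner_left v
      change (2 * Real.pi * Complex.I) • (SchwartzMap.smulLeftCLM ℂ (inner ℝ · v) (𝓕 φ) ξ) = _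
      rw [SchwartzMap.smulLeftCLM_apply_apply h3, smul_eq_mul, Complex.real_smul]
      simp [hv, EuclideanSpace.inner_single_right]
    simp only [h2, SetZeta.dirMul]
    ring
  rw [h1, hf.2 _ hc' (hs'.trans hs)]
  simp only [hd]
  have hφ1 : Continuous fun x => fderiv ℝ φ x v :=
    ((φ.smooth 1).continuous_fderiv (by simp)).clm_apply continuous_const
  rw [integral_mul_fderiv_eq_neg_fderiv_mul_of_integrable, neg_neg]
  · exact integrable_mul_of_tsupport_subset hΩ
      (hfd.continuousOn.clm_apply continuousOn_const) φ.continuous hc hs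
  · have := integrable_mul_of_tsupport_subset hΩ hf.1.continuousOn
      (∂_{v} φ : 𝓢(Space d, ℂ)).continuous hc' (hs'.trans hs)
    simpa only [hd] using this
  · exact integrable_mul_of_tsupport_subset hΩ hf.1.continuousOn φ.continuous hc hs
  · exact fun x hx => (hf.1.differentiableOn (by simp)).differentiableAt (hΩ.mem_nhds (hs hx))
  · exact fun x _ => φ.differentiableAt

theorem RegularOn.dirMul (hΩ : IsOpen Ω) {P : Space d → ℂ} (hP : RegularOn μ Ω P) (i : Fin d) :
    RegularOn μ Ω (dirMul i P) :=
  ⟨hasTemperateGrowth_dirMul hP.1 i, _, hP.2.choose_spec.dirMul hΩ hP.1 i⟩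

theorem RegularOn.smul {P : Space d → ℂ} (hP : RegularOn μ Ω P) (c : ℂ) :
    RegularOn μ Ω (c • P) := by
  obtain ⟨hP, f, hf, h⟩ := hP
  have hcP : (c • P).HasTemperateGrowth := (Function.HasTemperateGrowth.const c).mul hP
  refine ⟨hcP, fun z => c * f z, contDiffOn_const.mul hf, fun φ hc hs => ?_⟩
  have h1 := h φ hc hs
  rw [pairing_apply hP] at h1
  rw [pairing_apply hcP]
  simp only [Pi.smul_apply, smul_eq_mul, mul_assoc, integral_const_mul, h1]

theorem RegularOn.add (hΩ : IsOpen Ω) {P Q : Space d → ℂ} (hP : RegularOn μ Ω P)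
    (hQ : RegularOn μ Ω Q) : RegularOn μ Ω (P + Q) := by
  obtain ⟨hP, f, hf, h⟩ := hP
  obtain ⟨hQ, g, hg, h'⟩ := hQ
  refine ⟨hP.add hQ, fun z => f z + g z, hf.add hg, fun φ hc hs => ?_⟩
  have h1 := h φ hc hs
  have h2 := h' φ hc hs
  have hint : ∀ {R : Space d → ℂ}, R.HasTemperateGrowth →
      Integrable (fun ξ => R ξ * 𝓕 φ ξ) μ := by
    intro R hR
    refine (SchwartzMap.smulLeftCLM ℂ R (𝓕 φ)).integrable.congr (Eventually.of_forall fun ξ => ?_)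
    simp only [SchwartzMap.smulLeftCLM_apply_apply hR, smul_eq_mul]
  rw [pairing_apply hP] at h1
  rw [pairing_apply hQ] at h2
  rw [pairing_apply (hP.add hQ)]
  simp only [Pi.add_apply, add_mul]
  rw [integral_add (hint hP) (hint hQ), integral_add
    (integrable_mul_of_tsupport_subset hΩ hf.continuousOn φ.continuous hc hs)
    (integrable_mul_of_tsupport_subset hΩ hg.continuousOn φ.continuous hc hs), h1, h2]

theorem RegularOn.zero : RegularOn μ Ω 0 :=
  ⟨Function.HasTemperateGrowth.zero, fun _ => 0, contDiffOn_const, fun φ _ _ => by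
    rw [pairing_apply (P := 0) Function.HasTemperateGrowth.zero]; simp⟩

theorem RegularOn.heatMul (hΩ : IsOpen Ω) {P : Space d → ℂ} (hP : RegularOn μ Ω P) :
    RegularOn μ Ω (heatMul P) := by
  rw [heatMul_eq_sum]
  refine Finset.sum_induction _ (RegularOn μ Ω) (fun _ _ h h' => h.add hΩ h') RegularOn.zero
    fun i _ => ((hP.dirMul hΩ i).dirMul hΩ i).smul _

end Closure

/-! ### The limit at `s = 0` -/

theorem integral_gaussian_one : ∫ v : Space d, gaussian 1 one_pos v = 1 := by
  have h := fourier_gaussian_apply (d := d) 1 one_pos 0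
  rw [SchwartzMap.fourier_coe, Real.fourier_eq'] at h
  simpa using h

/-- The approximate identity in rescaled form. Dominated convergence gives the limit jointly in
width and centre, which continuity at the boundary requires later. -/
theorem tendsto_integral_gaussian {F : Space d → ℂ} (hF : Continuous F) {C : ℝ}
    (hC : ∀ x, ‖F x‖ ≤ C) (y₀ : Space d) :
    Tendsto (fun p : ℝ × Space d => ∫ v, F (p.2 - p.1 • v) * gaussian 1 one_pos v)
      (𝓝 (0, y₀)) (𝓝 (F y₀)) := by
  have h1 : F y₀ = ∫ v : Space d, F y₀ * gaussian 1 one_pos v := by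
    rw [integral_const_mul, integral_gaussian_one, mul_one]
  rw [h1]
  refine tendsto_integral_filter_of_dominated_convergence
    (fun v => C * ‖gaussian (d := d) 1 one_pos v‖) ?_ ?_ ?_ ?_
  · refine Eventually.of_forall fun p => Continuous.aestronglyMeasurable ?_
    exact (hF.comp (by fun_prop)).mul (gaussian 1 one_pos).continuous
  · refine Eventually.of_forall fun p => Eventually.of_forall fun v => ?_
    rw [norm_mul]
    gcongr
    exact hC _
  · exact (gaussian 1 one_pos).integrable.norm.const_mul C
  · refine Eventually.of_forall fun v => Tendsto.mul_const _ ?_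
    have : Continuous fun p : ℝ × Space d => F (p.2 - p.1 • v) := hF.comp (by fun_prop)
    simpa using this.tendsto (0, y₀)

theorem integral_mul_reflect_gaussian (F : Space d → ℂ) (t : ℝ) (ht : 0 < t) (y : Space d) :
    ∫ z, F z * reflect (gaussian t ht) y z =
      (t : ℂ) ^ d * ∫ v, F (y - t • v) * gaussian 1 one_pos v := by
  rw [← integral_sub_left_eq_self _ _ y]
  simp only [reflect_apply, sub_sub_cancel]
  have h := Measure.integral_comp_smul volume
    (fun v : Space d => F (y - v) * gaussian t ht v) t
  simp only [gaussian_eq_gaussian_one t ht, inv_smul_smul₀ ht.ne'] at h ⊢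
  rw [h, finrank_euclideanSpace_fin, abs_of_pos (by positivity), Complex.real_smul, ← mul_assoc]
  push_cast
  rw [mul_inv_cancel₀ (pow_ne_zero _ (by exact_mod_cast ht.ne')), one_mul]

/-- Cut the Gaussian with a bump `χ` that is `1` near `y₀` and supported in `Ω`. On the part with
`χ` the distribution is `f`, which yields a Gaussian average of `f χ`. The part with `1 - χ` avoids
the centre, so it is `O(t^(d+1))` in the finitely many seminorms that bound the distribution and
stays `O(t)` after division by `t ^ d`. -/
theorem tendsto_theta_sq {μ : Measure (Space d)} [μ.HasTemperateGrowth] {Ω : Set (Space d)}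
    (hΩ : IsOpen Ω) {P f : Space d → ℂ} (hP : P.HasTemperateGrowth)
    (hf : Represents μ Ω P f) {y₀ : Space d} (hy₀ : y₀ ∈ Ω) :
    Tendsto (fun p : ℝ × Space d => theta μ P (p.1 ^ 2) p.2) (𝓝[Ioi 0 ×ˢ univ] (0, y₀))
      (𝓝 (f y₀)) := by
  obtain ⟨R, hR, hball⟩ := Metric.nhds_basis_closedBall.mem_iff.1 (hΩ.mem_nhds hy₀)
  set r := R / 2 with hr
  have hr0 : 0 < r := half_pos hR
  let b : ContDiffBump y₀ := ⟨r, R, hr0, half_lt_self hR⟩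
  set χ : Space d → ℂ := fun z => ((b z : ℝ) : ℂ) with hχ
  have hχs : ContDiff ℝ ∞ χ := Complex.ofRealCLM.contDiff.comp b.contDiff
  have hts : tsupport χ ⊆ Metric.closedBall y₀ R := by
    have h1 : tsupport χ ⊆ tsupport b := closure_mono fun z hz h => hz (by simp [hχ, h])
    exact h1.trans b.tsupport_eq.le
  have hχc : HasCompactSupport χ :=
    (isCompact_closedBall y₀ R).of_isClosed_subset (isClosed_tsupport _) hts
  have hχt : χ.HasTemperateGrowth := hχc.hasTemperateGrowth hχs
  set η : Space d → ℂ := fun z => 1 - χ z with hη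
  have hηt : η.HasTemperateGrowth := (Function.HasTemperateGrowth.const 1).sub hχt
  have hη0 : ∀ z ∈ Metric.ball y₀ r, η z = 0 := by
    intro z hz
    have : b z = 1 := b.one_of_mem_closedBall (Metric.ball_subset_closedBall hz)
    simp [hη, hχ, this]
  set F : Space d → ℂ := fun z => f z * χ z with hFdef
  have hFc : Continuous F := continuous_mul_of_tsupport_subset hΩ hf.1.continuousOn
    hχs.continuous (hts.trans hball)
  obtain ⟨CF, hCF⟩ := hFc.bounded_above_of_compact_support (hχc.mul_left (f := f))
  have hFy : F y₀ = f y₀ := by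
    have : b y₀ = 1 := b.one_of_mem_closedBall (Metric.mem_closedBall_self hr0.le)
    simp [hFdef, hχ, this]
  obtain ⟨m, k, C, hC, hbd⟩ := exists_bound_of_continuous (pairing μ P).toLinearMap
    (pairing μ P).continuous
  choose B hB hBle using fun q : ℕ × ℕ =>
    seminorm_smulLeft_gaussian_le hηt y₀ hr0 hη0 q.1 q.2
  set B' := ∑ q ∈ Finset.Iic (m, k), B q with hB'
  have herr : ∀ (t : ℝ) (ht : 0 < t), t ≤ 1 → ∀ y ∈ Metric.ball y₀ (r / 2),
      ‖pairing μ P (SchwartzMap.smulLeftCLM ℂ η (reflect (gaussian t ht) y))‖ ≤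
        C * (B' * t ^ (d + 1)) := by
    intro t ht ht1 y hy
    refine (hbd _).trans (mul_le_mul_of_nonneg_left ?_ hC)
    refine Seminorm.finset_sup_apply_le (mul_nonneg (Finset.sum_nonneg fun q _ => hB q)
      (by positivity)) fun q hq => (hBle q t ht ht1 y hy).trans ?_
    gcongr
    exact Finset.single_le_sum (f := B) (fun q _ => hB q) hq
  have hsplit : ∀ (t : ℝ) (ht : 0 < t) (y : Space d), theta μ P (t ^ 2) y =
      (∫ v, F (y - t • v) * gaussian 1 one_pos v) +
        ((t : ℂ) ^ d)⁻¹ *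
          pairing μ P (SchwartzMap.smulLeftCLM ℂ η (reflect (gaussian t ht) y)) := by
    intro t ht y
    have htd : (t : ℂ) ^ d ≠ 0 := pow_ne_zero _ (by exact_mod_cast ht.ne')
    set h := reflect (gaussian t ht) y with hh
    have h1 : h = SchwartzMap.smulLeftCLM ℂ χ h + SchwartzMap.smulLeftCLM ℂ η h := by
      ext z
      rw [add_apply, SchwartzMap.smulLeftCLM_apply_apply hχt,
        SchwartzMap.smulLeftCLM_apply_apply hηt]
      simp only [hη, smul_eq_mul]
      ring
    have hsub : tsupport (SchwartzMap.smulLeftCLM ℂ χ h) ⊆ tsupport χ := by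
      rw [SchwartzMap.smulLeftCLM_apply hχt]
      exact tsupport_smul_subset_left _ _
    have h2 : pairing μ P (SchwartzMap.smulLeftCLM ℂ χ h) =
        (t : ℂ) ^ d * ∫ v, F (y - t • v) * gaussian 1 one_pos v := by
      rw [hf.2 _ (hχc.of_isClosed_subset (isClosed_tsupport _) hsub)
        (hsub.trans (hts.trans hball)), ← integral_mul_reflect_gaussian F t ht y]
      refine integral_congr_ae (Eventually.of_forall fun z => ?_)
      simp only [SchwartzMap.smulLeftCLM_apply_apply hχt, smul_eq_mul, hFdef, ← hh]
      ring
    have h3 := pairing_reflect_gaussian (μ := μ) hP t ht y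
    rw [← hh, h1, map_add, h2] at h3
    rw [eq_comm, ← mul_right_inj' htd, ← h3, mul_add, mul_inv_cancel_left₀ htd]
  rw [← hFy, ← add_zero (F y₀)]
  have hmem : ∀ᶠ p : ℝ × Space d in 𝓝[Ioi 0 ×ˢ univ] (0, y₀),
      0 < p.1 ∧ p.1 ≤ 1 ∧ p.2 ∈ Metric.ball y₀ (r / 2) := by
    have h1 : ∀ᶠ p : ℝ × Space d in 𝓝 ((0 : ℝ), y₀), p.1 ≤ 1 ∧ p.2 ∈ Metric.ball y₀ (r / 2) :=
      (((continuous_fst.tendsto ((0 : ℝ), y₀)).eventually (gt_mem_nhds one_pos)).mono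
        fun _ h => le_of_lt h).and
      ((continuous_snd.tendsto ((0 : ℝ), y₀)).eventually (Metric.ball_mem_nhds _ (half_pos hr0)))
    filter_upwards [self_mem_nhdsWithin, nhdsWithin_le_nhds h1] with p hp hp'
    exact ⟨hp.1, hp'⟩
  have hE : Tendsto (fun p : ℝ × Space d => theta μ P (p.1 ^ 2) p.2 -
      ∫ v, F (p.2 - p.1 • v) * gaussian 1 one_pos v) (𝓝[Ioi 0 ×ˢ univ] (0, y₀)) (𝓝 0) := by
    refine squeeze_zero_norm' (a := fun p : ℝ × Space d => C * B' * p.1) ?_ ?_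
    · filter_upwards [hmem] with p hp
      rw [hsplit p.1 hp.1 p.2, add_sub_cancel_left, norm_mul, norm_inv, norm_pow,
        Complex.norm_real, Real.norm_of_nonneg hp.1.le]
      have hpd : 0 < p.1 ^ d := pow_pos hp.1 d
      rw [inv_mul_le_iff₀ hpd]
      refine (herr p.1 hp.1 hp.2.1 p.2 hp.2.2).trans_eq ?_
      ring
    · have : Continuous fun p : ℝ × Space d => C * B' * p.1 := by fun_prop
      simpa using (this.tendsto ((0 : ℝ), y₀)).mono_left nhdsWithin_le_nhds
  refine (((tendsto_integral_gaussian hFc hCF y₀).mono_left nhdsWithin_le_nhds).add hE).congr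
    fun p => ?_
  ring

theorem tendsto_theta {μ : Measure (Space d)} [μ.HasTemperateGrowth] {Ω : Set (Space d)}
    (hΩ : IsOpen Ω) {P f : Space d → ℂ} (hP : P.HasTemperateGrowth)
    (hf : Represents μ Ω P f) {y₀ : Space d} (hy₀ : y₀ ∈ Ω) :
    Tendsto (fun p : ℝ × Space d => theta μ P p.1 p.2) (𝓝[Ioi 0 ×ˢ univ] (0, y₀))
      (𝓝 (f y₀)) := by
  have h1 : Tendsto (fun p : ℝ × Space d => (√p.1, p.2)) (𝓝[Ioi 0 ×ˢ univ] (0, y₀))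
      (𝓝[Ioi 0 ×ˢ univ] (0, y₀)) := by
    refine tendsto_nhdsWithin_iff.2 ⟨?_, ?_⟩
    · have : Continuous fun p : ℝ × Space d => (√p.1, p.2) := by fun_prop
      simpa using (this.tendsto ((0 : ℝ), y₀)).mono_left nhdsWithin_le_nhds
    · filter_upwards [self_mem_nhdsWithin] with p hp
      exact ⟨Real.sqrt_pos.2 hp.1, trivial⟩
  refine ((tendsto_theta_sq hΩ hP hf hy₀).comp h1).congr' ?_
  filter_upwards [self_mem_nhdsWithin] with p hp
  simp only [Function.comp, Real.sq_sqrt (le_of_lt (show (0 : ℝ) < p.1 from hp.1))]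

/-! ### Smoothness up to `s = 0` -/

/-- The extension of `theta` to `s ≤ 0` by its limit at `s = 0`. -/
def thetaExt (μ : Measure (Space d)) (P : Space d → ℂ) (s : ℝ) (y : Space d) : ℂ :=
  open Classical in
  if 0 < s then theta μ P s y else limUnder (𝓝[>] (0 : ℝ)) fun s => theta μ P s y

theorem thetaExt_of_pos (μ : Measure (Space d)) (P : Space d → ℂ) {s : ℝ} (hs : 0 < s)
    (y : Space d) : thetaExt μ P s y = theta μ P s y := by
  rw [thetaExt, if_pos hs]

theorem thetaExt_eventuallyEq (μ : Measure (Space d)) (P : Space d → ℂ) {s : ℝ} (hs : 0 < s)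
    (y : Space d) :
    (fun p : ℝ × Space d => thetaExt μ P p.1 p.2) =ᶠ[𝓝 (s, y)]
      fun p => theta μ P p.1 p.2 := by
  filter_upwards [(isOpen_lt continuous_const continuous_fst).mem_nhds
    (show (s, y) ∈ {p : ℝ × Space d | 0 < p.1} from hs)] with p hp
  exact thetaExt_of_pos μ P hp p.2

theorem continuousOn_gradCLM {S : Set (ℝ × Space d)} {A : ℝ × Space d → ℂ}
    {B : ℝ × Space d → Fin d → ℂ} (hA : ContinuousOn A S)
    (hB : ∀ i, ContinuousOn (fun p => B p i) S) :
    ContinuousOn (fun p => gradCLM (A p) (B p)) S := by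
  refine continuousOn_clm_apply.2 fun q => ?_
  simp only [gradCLM_apply]
  exact (continuousOn_const.mul hA).add
    (continuousOn_finsetSum _ fun i _ => continuousOn_const.mul (hB i))

theorem contDiffOn_gradCLM {S : Set (ℝ × Space d)} {n : WithTop ℕ∞} {A : ℝ × Space d → ℂ}
    {B : ℝ × Space d → Fin d → ℂ} (hA : ContDiffOn ℝ n A S)
    (hB : ∀ i, ContDiffOn ℝ n (fun p => B p i) S) :
    ContDiffOn ℝ n (fun p => gradCLM (A p) (B p)) S := by
  refine contDiffOn_clm_apply.2 fun q => ?_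
  simp only [gradCLM_apply]
  exact (contDiffOn_const.mul hA).add
    (ContDiffOn.sum fun i _ => contDiffOn_const.mul (hB i))

section Ext

variable {μ : Measure (Space d)} [μ.HasTemperateGrowth] {Ω : Set (Space d)}

theorem thetaExt_zero (hΩ : IsOpen Ω) {P f : Space d → ℂ} (hP : P.HasTemperateGrowth)
    (hf : Represents μ Ω P f) {y : Space d} (hy : y ∈ Ω) : thetaExt μ P 0 y = f y := by
  rw [thetaExt, if_neg (lt_irrefl _)]
  have h : Tendsto (fun s : ℝ => (s, y)) (𝓝[>] 0) (𝓝[Ioi 0 ×ˢ univ] (0, y)) := by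
    refine tendsto_nhdsWithin_iff.2 ⟨?_, ?_⟩
    · exact ((Continuous.prodMk_left y).tendsto 0).mono_left nhdsWithin_le_nhds
    · filter_upwards [self_mem_nhdsWithin] with s hs using ⟨hs, trivial⟩
  exact ((tendsto_theta hΩ hP hf hy).comp h).limUnder_eq

theorem hasFDerivAt_thetaExt {P : Space d → ℂ} (hP : P.HasTemperateGrowth) {s : ℝ} (hs : 0 < s)
    (y : Space d) :
    HasFDerivAt (fun p : ℝ × Space d => thetaExt μ P p.1 p.2)
      (gradCLM (thetaExt μ (heatMul P) s y) (fun i => thetaExt μ (dirMul i P) s y)) (s, y) := by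
  simp only [thetaExt_of_pos μ _ hs]
  exact (hasFDerivAt_theta hP hs y).congr_of_eventuallyEq (thetaExt_eventuallyEq μ P hs y)

/-- The limit `tendsto_theta` approaches a boundary point only through `s > 0`. On the boundary
itself the extension equals `f`, and the two one-sided statements are glued. -/
theorem continuousOn_thetaExt (hΩ : IsOpen Ω) {P : Space d → ℂ} (hP : RegularOn μ Ω P) :
    ContinuousOn (fun p : ℝ × Space d => thetaExt μ P p.1 p.2) (Ici 0 ×ˢ Ω) := by
  obtain ⟨hP, f, hf⟩ := hP
  rintro ⟨s, y⟩ ⟨hs, hy⟩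
  rcases (show (0 : ℝ) ≤ s from hs).eq_or_lt with rfl | hs
  · have hsub : (Ici (0 : ℝ) ×ˢ Ω : Set (ℝ × Space d)) ⊆ Ioi 0 ×ˢ univ ∪ {0} ×ˢ Ω := by
      rintro ⟨a, b⟩ ⟨ha, hb⟩
      rcases (show (0 : ℝ) ≤ a from ha).eq_or_lt with rfl | ha
      · exact Or.inr ⟨rfl, hb⟩
      · exact Or.inl ⟨ha, trivial⟩
    refine ContinuousWithinAt.mono ?_ hsub
    have h0 : thetaExt μ P 0 y = f y := thetaExt_zero hΩ hP hf hy
    refine ContinuousWithinAt.union ?_ ?_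
    · change Tendsto _ _ (𝓝 (thetaExt μ P 0 y))
      rw [h0]
      refine (tendsto_theta hΩ hP hf hy).congr' ?_
      filter_upwards [self_mem_nhdsWithin] with p hp
      exact (thetaExt_of_pos μ P hp.1 p.2).symm
    · have h1 : ContinuousWithinAt (fun p : ℝ × Space d => f p.2) ({0} ×ˢ Ω) ((0 : ℝ), y) :=
        ContinuousWithinAt.comp (t := Ω) (hf.1.continuousOn y hy)
          continuous_snd.continuousWithinAt fun p hp => hp.2
      refine h1.congr (fun p hp => ?_) h0
      have : p.1 = 0 := hp.1
      rw [this, thetaExt_zero hΩ hP hf hp.2]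
  · exact (hasFDerivAt_thetaExt hP hs y).continuousAt.continuousWithinAt

/-- At `s = 0` nothing is differentiated directly. The interior derivative consists of extensions
for the symbols `heatMul P` and `dirMul i P`, which are again regular, so it has a limit at the
boundary, and a mean value argument makes this limit the derivative. -/
theorem hasFDerivWithinAt_thetaExt (hΩ : IsOpen Ω) {P : Space d → ℂ} (hP : RegularOn μ Ω P)
    {p : ℝ × Space d} (hp : p ∈ (Ici 0 ×ˢ Ω : Set (ℝ × Space d))) :
    HasFDerivWithinAt (fun p : ℝ × Space d => thetaExt μ P p.1 p.2)
      (gradCLM (thetaExt μ (heatMul P) p.1 p.2) (fun i => thetaExt μ (dirMul i P) p.1 p.2))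
      (Ici 0 ×ˢ Ω) p := by
  obtain ⟨s, y⟩ := p
  obtain ⟨hs, hy⟩ := hp
  rcases (show (0 : ℝ) ≤ s from hs).eq_or_lt with rfl | hs
  · obtain ⟨r, hr, hball⟩ := Metric.nhds_basis_closedBall.mem_iff.1 (hΩ.mem_nhds hy)
    -- An open convex half-box: convexity is what the boundary derivative criterion needs, and its
    -- closure is a neighbourhood of `(0, y)` within the half-space.
    set U : Set (ℝ × Space d) := Ioo 0 1 ×ˢ Metric.ball y r with hU
    have hUc : closure U = Icc 0 1 ×ˢ Metric.closedBall y r := by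
      rw [hU, closure_prod_eq, closure_Ioo zero_ne_one, closure_ball y hr.ne']
    have hUs : U ⊆ Ici 0 ×ˢ Ω := prod_mono (fun x hx => hx.1.le)
      (Metric.ball_subset_closedBall.trans hball)
    have hUcs : closure U ⊆ Ici 0 ×ˢ Ω := by
      rw [hUc]
      exact prod_mono (fun x hx => hx.1) hball
    have h0 : ((0 : ℝ), y) ∈ (Ici 0 ×ˢ Ω : Set (ℝ × Space d)) :=
      ⟨mem_Ici.2 le_rfl, hy⟩
    have key : HasFDerivWithinAt (fun p : ℝ × Space d => thetaExt μ P p.1 p.2)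
        (gradCLM (thetaExt μ (heatMul P) 0 y) (fun i => thetaExt μ (dirMul i P) 0 y))
        (closure U) (0, y) := by
      refine hasFDerivWithinAt_closure_of_tendsto_fderiv ?_ ?_ ?_ ?_ ?_
      · rintro ⟨a, b⟩ hab
        exact (hasFDerivAt_thetaExt hP.1 hab.1.1 b).differentiableAt.differentiableWithinAt
      · exact (convex_Ioo 0 1).prod (convex_ball y r)
      · exact isOpen_Ioo.prod Metric.isOpen_ball
      · exact fun q hq => (continuousOn_thetaExt hΩ hP q (hUcs hq)).mono hUs
      · have h1 : ContinuousWithinAt (fun q : ℝ × Space d => gradCLM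
            (thetaExt μ (heatMul P) q.1 q.2) (fun i => thetaExt μ (dirMul i P) q.1 q.2))
            U (0, y) :=
          (continuousOn_gradCLM (continuousOn_thetaExt hΩ (hP.heatMul hΩ))
            (fun i => continuousOn_thetaExt hΩ (hP.dirMul hΩ i)) _ h0).mono hUs
        have h2 : Tendsto _ _ _ := h1
        refine h2.congr' ?_
        filter_upwards [self_mem_nhdsWithin] with q hq
        exact (hasFDerivAt_thetaExt hP.1 hq.1.1 q.2).fderiv.symm
    refine key.mono_of_mem_nhdsWithin ?_
    rw [hUc, mem_nhdsWithin]
    refine ⟨Iio 1 ×ˢ Metric.ball y r, isOpen_Iio.prod Metric.isOpen_ball,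
      ⟨one_pos, Metric.mem_ball_self hr⟩, ?_⟩
    rintro ⟨a, b⟩ ⟨⟨ha, hb⟩, ha', -⟩
    exact ⟨⟨ha', le_of_lt ha⟩, Metric.ball_subset_closedBall hb⟩
  · exact (hasFDerivAt_thetaExt hP.1 hs y).hasFDerivWithinAt

/-- The induction runs over all regular symbols at once, since differentiating changes the symbol.
-/
theorem contDiffOn_thetaExt_nat (hΩ : IsOpen Ω) (n : ℕ) : ∀ {P : Space d → ℂ}, RegularOn μ Ω P →
    ContDiffOn ℝ n (fun p : ℝ × Space d => thetaExt μ P p.1 p.2) (Ici 0 ×ˢ Ω) := by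
  have huniq : UniqueDiffOn ℝ (Ici (0 : ℝ) ×ˢ Ω) := (uniqueDiffOn_Ici 0).prod hΩ.uniqueDiffOn
  induction n with
  | zero => exact fun hP => contDiffOn_zero.2 (continuousOn_thetaExt hΩ hP)
  | succ n ih =>
    intro P hP
    push_cast
    refine (contDiffOn_succ_iff_fderivWithin huniq).2
      ⟨fun p hp => (hasFDerivWithinAt_thetaExt hΩ hP hp).differentiableWithinAt,
        fun h => absurd h (by simp), ?_⟩
    refine (contDiffOn_gradCLM (ih (hP.heatMul hΩ)) fun i => ih (hP.dirMul hΩ i)).congr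
      fun p hp => ?_
    exact (hasFDerivWithinAt_thetaExt hΩ hP hp).fderivWithin (huniq p hp)

theorem contDiffOn_thetaExt (hΩ : IsOpen Ω) {P : Space d → ℂ} (hP : RegularOn μ Ω P) :
    ContDiffOn ℝ ∞ (fun p : ℝ × Space d => thetaExt μ P p.1 p.2) (Ici 0 ×ˢ Ω) :=
  contDiffOn_infty.2 fun n => contDiffOn_thetaExt_nat hΩ n hP

end Ext

/-! ### Finite-part integrals -/

/-- `∫_0^1 s^(w-1) Θ_P(c s, y) ds`, convergent for `Re w > 0` at regular points `y`. -/
def heatInt (μ : Measure (Space d)) (c : ℝ) (P : Space d → ℂ) (w : ℂ) (y : Space d) : ℂ :=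
  ∫ s in (0 : ℝ)..1, (s : ℂ) ^ (w - 1) * thetaExt μ P (c * s) y

section Hadamard

variable {μ : Measure (Space d)} [μ.HasTemperateGrowth] {Ω : Set (Space d)} {c : ℝ}

theorem continuousOn_thetaExt_slice (hΩ : IsOpen Ω) (hc : 0 ≤ c) {P : Space d → ℂ}
    (hP : RegularOn μ Ω P) {y : Space d} (hy : y ∈ Ω) :
    ContinuousOn (fun s => thetaExt μ P (c * s) y) (Ici 0) :=
  (continuousOn_thetaExt hΩ hP).comp (f := fun s : ℝ => (c * s, y)) (by fun_prop)
    fun _ hs => ⟨mul_nonneg hc hs, hy⟩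

theorem intervalIntegrable_heatInt (hΩ : IsOpen Ω) (hc : 0 ≤ c) {P : Space d → ℂ}
    (hP : RegularOn μ Ω P) {y : Space d} (hy : y ∈ Ω) {w : ℂ} (hw : 0 < w.re) :
    IntervalIntegrable (fun s : ℝ => (s : ℂ) ^ (w - 1) * thetaExt μ P (c * s) y) volume 0 1 := by
  refine IntervalIntegrable.mul_continuousOn
    (intervalIntegral.intervalIntegrable_cpow' (by simpa using hw)) ?_
  refine (continuousOn_thetaExt_slice hΩ hc hP hy).mono fun s hs => ?_
  rw [uIcc_of_le zero_le_one] at hs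
  exact hs.1

theorem hasDerivAt_thetaExt_slice (hc : 0 < c) {P : Space d → ℂ} (hP : P.HasTemperateGrowth)
    (y : Space d) {s : ℝ} (hs : 0 < s) :
    HasDerivAt (fun s => thetaExt μ P (c * s) y) (c * thetaExt μ (heatMul P) (c * s) y) s := by
  have h1 : HasDerivAt (fun s : ℝ => (c * s, y)) ((c, 0) : ℝ × Space d) s := by
    have := (hasDerivAt_id s).const_mul c
    simpa using this.prodMk (hasDerivAt_const s y)
  have h2 := (hasFDerivAt_thetaExt (μ := μ) hP (mul_pos hc hs) y).comp_hasDerivAt s h1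
  rw [gradCLM_apply] at h2
  simpa [Function.comp_def] using h2

/-- Integration by parts. -/
theorem mul_heatInt (hΩ : IsOpen Ω) (hc : 0 < c) {P : Space d → ℂ}
    (hP : RegularOn μ Ω P) {y : Space d} (hy : y ∈ Ω) {w : ℂ} (hw : 0 < w.re) :
    w * heatInt μ c P w y =
      thetaExt μ P c y - c * heatInt μ c (heatMul P) (w + 1) y := by
  have hw0 : w ≠ 0 := fun h => by simp [h] at hw
  have hsub : uIcc (0 : ℝ) 1 ⊆ Ici 0 := fun s hs => by
    rw [uIcc_of_le zero_le_one] at hs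
    exact hs.1
  have hu : ContinuousOn (fun s : ℝ => (s : ℂ) ^ w) (uIcc 0 1) :=
    (Complex.continuous_ofReal_cpow_const hw).continuousOn
  have key := intervalIntegral.integral_mul_deriv_eq_deriv_mul_of_hasDeriv_right
    (u := fun s : ℝ => (s : ℂ) ^ w) (v := fun s : ℝ => thetaExt μ P (c * s) y)
    (u' := fun s : ℝ => w * (s : ℂ) ^ (w - 1))
    (v' := fun s : ℝ => c * thetaExt μ (heatMul P) (c * s) y) (a := 0) (b := 1)
    hu ((continuousOn_thetaExt_slice hΩ hc.le hP hy).mono hsub)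
    (fun s hs => by
      rw [min_eq_left zero_le_one] at hs
      exact (hasDerivAt_ofReal_cpow_const hs.1.ne' hw0).hasDerivWithinAt)
    (fun s hs => by
      rw [min_eq_left zero_le_one] at hs
      exact (hasDerivAt_thetaExt_slice hc hP.1 y hs.1).hasDerivWithinAt)
    ((intervalIntegral.intervalIntegrable_cpow' (by simpa using hw)).const_mul w)
    ((continuousOn_const.mul
      (continuousOn_thetaExt_slice hΩ hc.le (hP.heatMul hΩ) hy)).mono hsub).intervalIntegrable
  -- The boundary term at `0` vanishes because `w ≠ 0` makes `0 ^ w` zero.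
  simp only [Complex.ofReal_one, Complex.one_cpow, Complex.ofReal_zero, Complex.zero_cpow hw0,
    mul_one, one_mul, zero_mul, sub_zero] at key
  have h1 : ∫ s in (0 : ℝ)..1, w * (s : ℂ) ^ (w - 1) * thetaExt μ P (c * s) y =
      w * heatInt μ c P w y := by
    simp only [heatInt, mul_assoc, intervalIntegral.integral_const_mul]
  have h2 : ∫ s in (0 : ℝ)..1, (s : ℂ) ^ w * (c * thetaExt μ (heatMul P) (c * s) y) =
      c * heatInt μ c (heatMul P) (w + 1) y := by
    simp only [heatInt, add_sub_cancel_right, mul_left_comm _ (c : ℂ),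
      intervalIntegral.integral_const_mul]
  rw [h1, h2] at key
  linear_combination key

theorem mellin_indicator_Ioc (f : ℝ → ℂ) (w : ℂ) :
    mellin ((Ioc 0 1).indicator f) w = ∫ s in (0 : ℝ)..1, (s : ℂ) ^ (w - 1) * f s := by
  have hset : Ioi (0 : ℝ) ∩ Ioc 0 1 = Ioc 0 1 := inter_eq_right.2 Ioc_subset_Ioi_self
  rw [intervalIntegral.integral_of_le zero_le_one, mellin,
    ← hset, ← setIntegral_indicator measurableSet_Ioc]
  refine setIntegral_congr_fun measurableSet_Ioi fun s _ => ?_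
  rw [hset]
  by_cases hs : s ∈ Ioc (0 : ℝ) 1
  · simp only [indicator_of_mem hs, smul_eq_mul]
  · simp only [indicator_of_notMem hs, smul_zero]

theorem differentiableAt_heatInt (hΩ : IsOpen Ω) (hc : 0 ≤ c) {P : Space d → ℂ}
    (hP : RegularOn μ Ω P) {y : Space d} (hy : y ∈ Ω) {w : ℂ} (hw : 0 < w.re) :
    DifferentiableAt ℂ (fun w => heatInt μ c P w y) w := by
  set g : ℝ → ℂ := (Ioc 0 1).indicator fun s => thetaExt μ P (c * s) y with hg
  have hcont := continuousOn_thetaExt_slice hΩ hc hP hy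
  have hmel : (fun w => heatInt μ c P w y) = mellin g :=
    funext fun w => (mellin_indicator_Ioc _ w).symm
  have hint : IntegrableOn g (Ioi 0) := by
    refine Integrable.integrableOn ((integrable_indicator_iff measurableSet_Ioc).2 ?_)
    exact ((hcont.mono fun s hs => hs.1).integrableOn_compact isCompact_Icc).mono_set
      Ioc_subset_Icc_self
  rw [hmel]
  -- The integrand is cut off beyond `1`, so any `a > Re w` serves at infinity; `b = 0` records
  -- boundedness near `0`.
  refine mellin_differentiableAt_of_isBigO_rpow (a := w.re + 1) (b := 0) ?_ ?_ (by simp) ?_ hw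
  · exact hint.locallyIntegrableOn
  · refine Asymptotics.IsBigO.of_bound 0 ?_
    filter_upwards [eventually_gt_atTop 1] with s hs
    rw [hg, indicator_of_notMem (fun h => by linarith [h.2])]
    simp
  · obtain ⟨C, hC⟩ := (isCompact_Icc (a := (0 : ℝ)) (b := 1)).exists_bound_of_continuousOn
      (hcont.mono fun s hs => hs.1)
    refine Asymptotics.IsBigO.of_bound C ?_
    filter_upwards [Ioc_mem_nhdsGT one_pos] with s hs
    rw [hg, indicator_of_mem hs]
    simpa using hC s ⟨hs.1.le, hs.2⟩

/-! ### Smoothness of the Mellin integral in `y`. -/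

/-- The form `v ↦ ∑ i, v i B i`. -/
def gradY (B : Fin d → ℂ) : Space d →L[ℝ] ℂ :=
  (gradCLM 0 B).comp (ContinuousLinearMap.inr ℝ ℝ (Space d))

theorem gradY_apply (B : Fin d → ℂ) (v : Space d) : gradY B v = ∑ i, (v i : ℂ) * B i := by
  simp [gradY, gradCLM_apply]

theorem continuous_gradY : Continuous (gradY : (Fin d → ℂ) → Space d →L[ℝ] ℂ) := by
  refine continuous_clm_apply.2 fun v => ?_
  simp only [gradY_apply]
  fun_prop

theorem norm_gradY_le (B : Fin d → ℂ) : ‖gradY B‖ ≤ ∑ i, ‖B i‖ := by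
  refine ContinuousLinearMap.opNorm_le_bound _ (Finset.sum_nonneg fun i _ => norm_nonneg _)
    fun v => ?_
  rw [gradY_apply, Finset.sum_mul]
  refine (norm_sum_le _ _).trans (Finset.sum_le_sum fun i _ => ?_)
  rw [norm_mul, mul_comm, Complex.norm_real]
  gcongr
  exact PiLp.norm_apply_le v i

theorem hasFDerivAt_thetaExt_right {P : Space d → ℂ} (hP : P.HasTemperateGrowth) {s : ℝ}
    (hs : 0 < s) (y : Space d) :
    HasFDerivAt (thetaExt μ P s) (gradY fun i => thetaExt μ (dirMul i P) s y) y := by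
  have h1 : HasFDerivAt (fun y : Space d => (s, y)) (ContinuousLinearMap.inr ℝ ℝ (Space d)) y :=
    hasFDerivAt_prodMk_right s y
  have h2 := (hasFDerivAt_thetaExt (μ := μ) hP hs y).comp y h1
  have h3 : gradY (fun i => thetaExt μ (dirMul i P) s y) =
      (gradCLM (thetaExt μ (heatMul P) s y) fun i => thetaExt μ (dirMul i P) s y).comp
        (ContinuousLinearMap.inr ℝ ℝ (Space d)) := by
    refine ContinuousLinearMap.ext fun v => ?_
    simp [gradY, gradCLM_apply]
  rw [h3]
  exact h2

theorem exists_bound_thetaExt (hΩ : IsOpen Ω) {P : Space d → ℂ} (hP : RegularOn μ Ω P)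
    {K : Set (Space d)} (hK : IsCompact K) (hKΩ : K ⊆ Ω) (c : ℝ) :
    ∃ C, 0 ≤ C ∧ ∀ s ∈ Icc 0 c, ∀ y ∈ K, ‖thetaExt μ P s y‖ ≤ C := by
  obtain ⟨C, hC⟩ := ((isCompact_Icc (a := (0 : ℝ)) (b := c)).prod hK).exists_bound_of_continuousOn
    ((continuousOn_thetaExt hΩ hP).mono (prod_mono (fun s hs => hs.1) hKΩ))
  exact ⟨max C 0, le_max_right _ _, fun s hs y hy => (hC (s, y) ⟨hs, hy⟩).trans (le_max_left _ _)⟩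

/-- Continuity up to `s = 0` bounds the `y`-derivatives uniformly on `[0, c]` times a compact ball,
so a multiple of `s ^ (Re w - 1)` dominates. -/
theorem hasFDerivAt_heatInt (hΩ : IsOpen Ω) (hc : 0 < c) {P : Space d → ℂ}
    (hP : RegularOn μ Ω P) {y : Space d} (hy : y ∈ Ω) {w : ℂ} (hw : 0 < w.re) :
    HasFDerivAt (heatInt μ c P w) (gradY fun i => heatInt μ c (dirMul i P) w y) y := by
  obtain ⟨r, hr, hball⟩ := Metric.nhds_basis_closedBall.mem_iff.1 (hΩ.mem_nhds hy)
  choose C hC hCle using fun i : Fin d =>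
    exists_bound_thetaExt hΩ (hP.dirMul hΩ i) (isCompact_closedBall y r) hball c
  have hint : ∀ i, IntervalIntegrable
      (fun s : ℝ => (s : ℂ) ^ (w - 1) * thetaExt μ (dirMul i P) (c * s) y) volume 0 1 :=
    fun i => intervalIntegrable_heatInt hΩ hc.le (hP.dirMul hΩ i) hy hw
  have hmeas : AEStronglyMeasurable (fun s : ℝ => gradY fun i =>
      (s : ℂ) ^ (w - 1) * thetaExt μ (dirMul i P) (c * s) y) (volume.restrict (uIoc 0 1)) := by
    refine continuous_gradY.comp_aestronglyMeasurable (AEMeasurable.aestronglyMeasurable ?_)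
    refine aemeasurable_pi_iff.2 fun i => ?_
    rw [uIoc_of_le zero_le_one]
    exact (hint i).1.aestronglyMeasurable.aemeasurable
  have hbint : IntervalIntegrable (fun s : ℝ => ‖(s : ℂ) ^ (w - 1)‖ * ∑ i, C i) volume 0 1 :=
    (intervalIntegral.intervalIntegrable_cpow' (by simpa using hw)).norm.mul_const _
  have hle : ∀ᵐ s : ℝ ∂volume.restrict (uIoc 0 1), ∀ x ∈ Metric.ball y r,
      ‖gradY fun i => (s : ℂ) ^ (w - 1) * thetaExt μ (dirMul i P) (c * s) x‖ ≤
        ‖(s : ℂ) ^ (w - 1)‖ * ∑ i, C i := by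
    rw [uIoc_of_le zero_le_one]
    refine (ae_restrict_iff' measurableSet_Ioc).2 (Eventually.of_forall fun s hs x hx => ?_)
    refine (norm_gradY_le _).trans ?_
    rw [Finset.mul_sum]
    refine Finset.sum_le_sum fun i _ => ?_
    rw [norm_mul]
    gcongr
    exact hCle i _ ⟨mul_nonneg hc.le hs.1.le, mul_le_of_le_one_right hc.le hs.2⟩ x
      (Metric.ball_subset_closedBall hx)
  have key := hasFDerivAt_integral_of_dominated_of_fderiv_le'' (μ := volume) (a := 0) (b := 1)
    (F := fun (x : Space d) (s : ℝ) => (s : ℂ) ^ (w - 1) * thetaExt μ P (c * s) x)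
    (F' := fun x s => gradY fun i => (s : ℂ) ^ (w - 1) * thetaExt μ (dirMul i P) (c * s) x)
    (x₀ := y) (s := Metric.ball y r) (Metric.ball_mem_nhds y hr) ?_
    (intervalIntegrable_heatInt hΩ hc.le hP hy hw) hmeas hle hbint ?_
  · have hval : gradY (fun i => heatInt μ c (dirMul i P) w y) = ∫ s in (0 : ℝ)..1, gradY fun i =>
        (s : ℂ) ^ (w - 1) * thetaExt μ (dirMul i P) (c * s) y := by
      refine ContinuousLinearMap.ext fun v => ?_
      have hi : IntervalIntegrable (fun s : ℝ => gradY fun i =>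
          (s : ℂ) ^ (w - 1) * thetaExt μ (dirMul i P) (c * s) y) volume 0 1 := by
        refine hbint.mono_fun hmeas ?_
        filter_upwards [hle] with s hs
        exact (hs y (Metric.mem_ball_self hr)).trans (le_abs_self _)
      rw [ContinuousLinearMap.intervalIntegral_apply hi]
      simp only [gradY_apply]
      rw [intervalIntegral.integral_finsetSum fun i _ => (hint i).const_mul _]
      simp only [intervalIntegral.integral_const_mul, heatInt]
    rw [hval]
    exact key
  · filter_upwards [Metric.ball_mem_nhds y hr] with x hx
    rw [uIoc_of_le zero_le_one]
    exact (intervalIntegrable_heatInt hΩ hc.le hP (hball (Metric.ball_subset_closedBall hx))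
      hw).1.aestronglyMeasurable
  · rw [uIoc_of_le zero_le_one]
    refine (ae_restrict_iff' measurableSet_Ioc).2 (Eventually.of_forall fun s hs x _ => ?_)
    have h := (hasFDerivAt_thetaExt_right (μ := μ) hP.1 (mul_pos hc hs.1) x).const_mul
      ((s : ℂ) ^ (w - 1))
    have h2 : gradY (fun i => (s : ℂ) ^ (w - 1) * thetaExt μ (dirMul i P) (c * s) x) =
        (s : ℂ) ^ (w - 1) • gradY fun i => thetaExt μ (dirMul i P) (c * s) x := by
      refine ContinuousLinearMap.ext fun v => ?_
      change _ = (s : ℂ) ^ (w - 1) * gradY _ v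
      simp only [gradY_apply, Finset.mul_sum]
      exact Finset.sum_congr rfl fun i _ => by ring
    rw [h2]
    exact h

theorem contDiffOn_heatInt_nat (hΩ : IsOpen Ω) (hc : 0 < c) {w : ℂ} (hw : 0 < w.re) (n : ℕ) :
    ∀ {P : Space d → ℂ}, RegularOn μ Ω P → ContDiffOn ℝ n (heatInt μ c P w) Ω := by
  induction n with
  | zero =>
    exact fun hP => contDiffOn_zero.2 fun y hy =>
      (hasFDerivAt_heatInt hΩ hc hP hy hw).continuousAt.continuousWithinAt
  | succ n ih =>
    intro P hP
    push_cast
    refine (contDiffOn_succ_iff_fderiv_of_isOpen hΩ).2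
      ⟨fun y hy => (hasFDerivAt_heatInt hΩ hc hP hy hw).differentiableAt.differentiableWithinAt,
        fun h => absurd h (by simp), ?_⟩
    refine ContDiffOn.congr (f := fun y => gradY fun i => heatInt μ c (dirMul i P) w y) ?_
      fun y hy => (hasFDerivAt_heatInt hΩ hc hP hy hw).fderiv
    refine contDiffOn_clm_apply.2 fun v => ?_
    simp only [gradY_apply]
    exact ContDiffOn.sum fun i _ => contDiffOn_const.mul (ih (hP.dirMul hΩ i))

/-! ### Continuation by repeated integration by parts. -/

/-- The continuation of `Γ(w)⁻¹ ∫_0^1 s^(w-1) Θ_P(c s, y) ds` to `Re w > -n`, by `n` integrations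
by parts. -/
def heatCont (μ : Measure (Space d)) (c : ℝ) : ℕ → (Space d → ℂ) → ℂ → Space d → ℂ
  | 0, P, w, y => (Complex.Gamma w)⁻¹ * heatInt μ c P w y
  | n + 1, P, w, y => (Complex.Gamma (w + 1))⁻¹ * thetaExt μ P c y -
      c * heatCont μ c n (heatMul P) (w + 1) y

/-- The base case is `mul_heatInt` divided by `Γ(w + 1) = w Γ(w)`, so no pole appears. The inductive
step is the same statement for `heatMul P` at `w + 1`. -/
theorem heatCont_succ (hΩ : IsOpen Ω) (hc : 0 < c) (n : ℕ) :
    ∀ {P : Space d → ℂ}, RegularOn μ Ω P → ∀ {y : Space d}, y ∈ Ω → ∀ {w : ℂ}, -(n : ℝ) < w.re →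
      heatCont μ c (n + 1) P w y = heatCont μ c n P w y := by
  induction n with
  | zero =>
    intro P hP y hy w hw
    have hw' : 0 < w.re := by simpa using hw
    have hw0 : w ≠ 0 := fun h => by simp [h] at hw'
    have hG : Complex.Gamma w ≠ 0 := Complex.Gamma_ne_zero_of_re_pos hw'
    have h := mul_heatInt hΩ hc hP hy hw'
    simp only [heatCont]
    rw [Complex.Gamma_add_one w hw0]
    field_simp
    linear_combination -h
  | succ n ih =>
    intro P hP y hy w hw
    rw [heatCont, ih (hP.heatMul hΩ) hy (w := w + 1) (by push_cast at hw; simp; linarith)]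
    rfl

theorem heatCont_eq_of_le (hΩ : IsOpen Ω) (hc : 0 < c) {P : Space d → ℂ} (hP : RegularOn μ Ω P)
    {y : Space d} (hy : y ∈ Ω) {w : ℂ} {m n : ℕ} (hmn : m ≤ n) (hm : -(m : ℝ) < w.re) :
    heatCont μ c n P w y = heatCont μ c m P w y := by
  induction n, hmn using Nat.le_induction with
  | base => rfl
  | succ n hn ih =>
    rw [heatCont_succ hΩ hc n hP hy, ih]
    have : (m : ℝ) ≤ n := by exact_mod_cast hn
    linarith

theorem differentiableAt_heatCont (hΩ : IsOpen Ω) (hc : 0 < c) (n : ℕ) :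
    ∀ {P : Space d → ℂ}, RegularOn μ Ω P → ∀ {y : Space d}, y ∈ Ω → ∀ {w : ℂ}, -(n : ℝ) < w.re →
      DifferentiableAt ℂ (fun w => heatCont μ c n P w y) w := by
  induction n with
  | zero =>
    intro P hP y hy w hw
    exact (Complex.differentiable_one_div_Gamma w).mul
      (differentiableAt_heatInt hΩ hc.le hP hy (by simpa using hw))
  | succ n ih =>
    intro P hP y hy w hw
    have h1 : DifferentiableAt ℂ (fun w : ℂ => (Complex.Gamma (w + 1))⁻¹) w :=
      DifferentiableAt.comp (g := fun w : ℂ => (Complex.Gamma w)⁻¹) w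
        (Complex.differentiable_one_div_Gamma (w + 1)) (by fun_prop)
    have h2 : DifferentiableAt ℂ (fun w => heatCont μ c n (heatMul P) (w + 1) y) w :=
      DifferentiableAt.comp (g := fun w => heatCont μ c n (heatMul P) w y) w
        (ih (hP.heatMul hΩ) hy (by push_cast at hw; simp; linarith)) (by fun_prop)
    exact (h1.mul_const _).sub (h2.const_mul _)

theorem contDiffOn_heatCont (hΩ : IsOpen Ω) (hc : 0 < c) (n : ℕ) :
    ∀ {P : Space d → ℂ}, RegularOn μ Ω P → ∀ {w : ℂ}, -(n : ℝ) < w.re →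
      ContDiffOn ℝ ∞ (heatCont μ c n P w) Ω := by
  induction n with
  | zero =>
    intro P hP w hw
    exact contDiffOn_const.mul (contDiffOn_infty.2 fun k =>
      contDiffOn_heatInt_nat hΩ hc (by simpa using hw) k hP)
  | succ n ih =>
    intro P hP w hw
    have h1 : ContDiffOn ℝ ∞ (thetaExt μ P c) Ω :=
      (contDiffOn_thetaExt hΩ hP).comp (f := fun y : Space d => (c, y)) (by fun_prop)
        fun y hy => ⟨hc.le, hy⟩
    exact (contDiffOn_const.mul h1).sub
      (contDiffOn_const.mul (ih (hP.heatMul hΩ) (by push_cast at hw; simp; linarith)))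

end Hadamard

/-- The entire function of `w` that equals `Γ(w)⁻¹ ∫_0^1 s^(w-1) Θ_P(c s, y) ds` for `Re w > 0`. -/
def heatEntire (μ : Measure (Space d)) (c : ℝ) (P : Space d → ℂ) (w : ℂ) (y : Space d) : ℂ :=
  heatCont μ c (⌊|w.re|⌋₊ + 1) P w y

section Entire

variable {μ : Measure (Space d)} [μ.HasTemperateGrowth] {Ω : Set (Space d)} {c : ℝ}

theorem neg_floor_lt_re (w : ℂ) : -((⌊|w.re|⌋₊ + 1 : ℕ) : ℝ) < w.re := by
  have h1 := Nat.lt_floor_add_one |w.re|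
  have h2 := neg_abs_le w.re
  push_cast
  linarith

theorem heatEntire_eq_heatCont (hΩ : IsOpen Ω) (hc : 0 < c) {P : Space d → ℂ}
    (hP : RegularOn μ Ω P) {y : Space d} (hy : y ∈ Ω) {w : ℂ} {n : ℕ} (hn : -(n : ℝ) < w.re) :
    heatEntire μ c P w y = heatCont μ c n P w y := by
  rcases le_total n (⌊|w.re|⌋₊ + 1) with h | h
  · exact heatCont_eq_of_le hΩ hc hP hy h hn
  · exact (heatCont_eq_of_le hΩ hc hP hy h (neg_floor_lt_re w)).symm

theorem heatEntire_eq (hΩ : IsOpen Ω) (hc : 0 < c) {P : Space d → ℂ}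
    (hP : RegularOn μ Ω P) {y : Space d} (hy : y ∈ Ω) {w : ℂ} (hw : 0 < w.re) :
    heatEntire μ c P w y = (Complex.Gamma w)⁻¹ * heatInt μ c P w y :=
  heatEntire_eq_heatCont (n := 0) hΩ hc hP hy (by simpa using hw)

/-- The number of integrations by parts in `heatEntire` jumps with `Re w`. The number chosen at a
given point remains valid nearby, so locally the function agrees with a single holomorphic
`heatCont`. -/
theorem differentiable_heatEntire (hΩ : IsOpen Ω) (hc : 0 < c) {P : Space d → ℂ}
    (hP : RegularOn μ Ω P) {y : Space d} (hy : y ∈ Ω) :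
    Differentiable ℂ fun w => heatEntire μ c P w y := by
  intro w
  refine (differentiableAt_heatCont hΩ hc (⌊|w.re|⌋₊ + 1) hP hy
    (neg_floor_lt_re w)).congr_of_eventuallyEq ?_
  filter_upwards [(isOpen_lt continuous_const Complex.continuous_re).mem_nhds
    (neg_floor_lt_re w)] with z hz
  exact heatEntire_eq_heatCont hΩ hc hP hy hz

theorem contDiffOn_heatEntire (hΩ : IsOpen Ω) (hc : 0 < c) {P : Space d → ℂ}
    (hP : RegularOn μ Ω P) (w : ℂ) : ContDiffOn ℝ ∞ (heatEntire μ c P w) Ω :=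
  contDiffOn_heatCont hΩ hc _ hP (neg_floor_lt_re w)

end Entire

/-! ### Superpositions of smooth functions -/

theorem integrable_prod_of_norm_le {α β : Type*} [MeasurableSpace α] [MeasurableSpace β]
    {ρ : Measure α} {σ : Measure β} [SFinite ρ] [SFinite σ] {h : α × β → ℂ} {f : α → ℝ} {g : β → ℝ}
    (hm : AEStronglyMeasurable h (ρ.prod σ)) (hf : Integrable f ρ) (hg : Integrable g σ)
    (hle : ∀ᵐ a ∂ρ, ∀ b, ‖h (a, b)‖ ≤ f a * g b) : Integrable h (ρ.prod σ) := by
  refine (hf.mul_prod hg).mono' hm ?_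
  have := Measure.quasiMeasurePreserving_fst (μ := ρ) (ν := σ) |>.ae hle
  filter_upwards [this] with p hp using hp p.2

section Superposition

variable {X : Type*} [MeasurableSpace X] {ρ : Measure X} {F : X → Space d → ℂ}
  {B : ℕ → ℕ → X → ℝ}

/-- Directional derivatives are pointwise limits of measurable difference quotients, and in finite
dimension the full derivative is assembled from those along a basis. -/
theorem aestronglyMeasurable_fderiv {G : Type*} [NormedAddCommGroup G] [NormedSpace ℝ G]
    {F : X → Space d → G} (hF : ∀ a, Differentiable ℝ (F a))
    (hm : ∀ x, AEStronglyMeasurable (fun a => F a x) ρ) (x : Space d) :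
    AEStronglyMeasurable (fun a => fderiv ℝ (F a) x) ρ := by
  have hv : ∀ v, AEStronglyMeasurable (fun a => fderiv ℝ (F a) x v) ρ := by
    intro v
    refine aestronglyMeasurable_of_tendsto_ae atTop
      (f := fun (n : ℕ) a => (n : ℝ) • (F a (x + (n : ℝ)⁻¹ • v) - F a x))
      (fun n => ((hm _).sub (hm _)).const_smul _) (Eventually.of_forall fun a => ?_)
    exact ((hF a x).hasFDerivAt.lim_real v).comp tendsto_natCast_atTop_atTop
  have hsum : ∀ a, fderiv ℝ (F a) x = ∑ i, ContinuousLinearMap.smulRightL ℝ (Space d) G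
      (EuclideanSpace.proj i : Space d →L[ℝ] ℝ)
      (fderiv ℝ (F a) x (EuclideanSpace.single i 1)) := by
    intro a
    refine ContinuousLinearMap.ext fun v => ?_
    conv_lhs => rw [← (EuclideanSpace.basisFun (Fin d) ℝ).sum_repr v]
    simp [map_sum]
  rw [funext hsum]
  refine Finset.aestronglyMeasurable_fun_sum _ fun i _ => ?_
  exact (ContinuousLinearMap.continuous _).comp_aestronglyMeasurable (hv _)

theorem norm_pow_mul_integral_le {G : Type*} [NormedAddCommGroup G] [NormedSpace ℝ G]
    {F : X → Space d → G} {b : X → ℝ} (m : ℕ) (x : Space d) (hb : Integrable b ρ)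
    (hle : ∀ᵐ a ∂ρ, ∀ x, ‖x‖ ^ m * ‖iteratedFDeriv ℝ 0 (F a) x‖ ≤ b a) :
    ‖x‖ ^ m * ‖iteratedFDeriv ℝ 0 (fun x => ∫ a, F a x ∂ρ) x‖ ≤ ∫ a, b a ∂ρ := by
  have h1 : ‖x‖ ^ m * ‖∫ a, F a x ∂ρ‖ = ‖∫ a, (‖x‖ ^ m) • F a x ∂ρ‖ := by
    rw [integral_smul, norm_smul, norm_pow, norm_norm]
  rw [norm_iteratedFDeriv_zero, h1]
  refine norm_integral_le_of_norm_le hb ?_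
  filter_upwards [hle] with a ha
  rw [norm_smul, norm_pow, norm_norm, ← norm_iteratedFDeriv_zero (𝕜 := ℝ)]
  exact ha x

/-- Repeated differentiation under the integral. The target space varies in the induction, because
the derivative takes values in linear maps. Bounds are required only up to order `k`, so the lemma
serves `𝓢^k` as well as Schwartz space. -/
theorem contDiff_integral_and_bound (k : ℕ) : ∀ {G : Type} [NormedAddCommGroup G]
    [NormedSpace ℝ G] {F : X → Space d → G} {B : ℕ → ℕ → X → ℝ},
    (∀ a, ContDiff ℝ ∞ (F a)) → (∀ x, AEStronglyMeasurable (fun a => F a x) ρ) →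
    (∀ m, ∀ j ≤ k, Integrable (B m j) ρ) →
    (∀ m, ∀ j ≤ k, ∀ᵐ a ∂ρ, ∀ x, ‖x‖ ^ m * ‖iteratedFDeriv ℝ j (F a) x‖ ≤ B m j a) →
    ContDiff ℝ k (fun x => ∫ a, F a x ∂ρ) ∧ ∀ m, ∀ j ≤ k, ∀ x,
      ‖x‖ ^ m * ‖iteratedFDeriv ℝ j (fun x => ∫ a, F a x ∂ρ) x‖ ≤ ∫ a, B m j a ∂ρ := by
  induction k with
  | zero =>
    intro G _ _ F B hF hm hB hle
    refine ⟨contDiff_zero.2 ?_, fun m j hj x => ?_⟩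
    · refine continuous_of_dominated (bound := B 0 0) hm (fun x => ?_) (hB 0 0 le_rfl)
        (Eventually.of_forall fun a => (hF a).continuous)
      filter_upwards [hle 0 0 le_rfl] with a ha
      simpa using ha x
    · obtain rfl : j = 0 := by omega
      exact norm_pow_mul_integral_le m x (hB m 0 le_rfl) (hle m 0 le_rfl)
  | succ k ih =>
    intro G _ _ F B hF hm hB hle
    have hF1 : ∀ a, ContDiff ℝ ∞ (fderiv ℝ (F a)) := fun a => (hF a).fderiv_right (by simp)
    have hm1 := aestronglyMeasurable_fderiv (fun a => (hF a).differentiable (by simp)) hm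
    obtain ⟨h1, h2⟩ := ih (F := fun a => fderiv ℝ (F a)) (B := fun m j => B m (j + 1)) hF1 hm1
      (fun m j hj => hB m (j + 1) (by omega)) (fun m j hj => by
        filter_upwards [hle m (j + 1) (by omega)] with a ha x
        rw [norm_iteratedFDeriv_fderiv]
        exact ha x)
    have hder : ∀ x, HasFDerivAt (fun x => ∫ a, F a x ∂ρ) (∫ a, fderiv ℝ (F a) x ∂ρ) x := by
      intro x
      refine hasFDerivAt_integral_of_dominated_of_fderiv_le (bound := B 0 1)
        (F' := fun x a => fderiv ℝ (F a) x) univ_mem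
        (Eventually.of_forall hm) ?_ (hm1 x) ?_ (hB 0 1 (by omega)) ?_
      · refine (hB 0 0 (by omega)).mono' (hm x) ?_
        filter_upwards [hle 0 0 (by omega)] with a ha
        simpa using ha x
      · filter_upwards [hle 0 1 (by omega)] with a ha z _
        have := ha z
        rwa [pow_zero, one_mul, ← norm_iteratedFDeriv_fderiv, norm_iteratedFDeriv_zero] at this
      · exact Eventually.of_forall fun a z _ =>
          ((hF a).differentiable (by simp) z).hasFDerivAt
    have hfd : fderiv ℝ (fun x => ∫ a, F a x ∂ρ) = fun x => ∫ a, fderiv ℝ (F a) x ∂ρ :=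
      funext fun x => (hder x).fderiv
    refine ⟨?_, fun m j hj x => ?_⟩
    · push_cast
      refine contDiff_succ_iff_fderiv.2 ⟨fun x => (hder x).differentiableAt,
        fun h => absurd h (by simp), ?_⟩
      rw [hfd]
      exact h1
    · rcases j with _ | j
      · exact norm_pow_mul_integral_le m x (hB m 0 hj) (hle m 0 hj)
      · rw [← norm_iteratedFDeriv_fderiv, hfd]
        exact h2 m j (by omega) x

/-- A superposition of smooth functions with integrable Schwartz bounds is a Schwartz function. -/
def schwartzIntegral (hF : ∀ a, ContDiff ℝ ∞ (F a))
    (hm : ∀ x, AEStronglyMeasurable (fun a => F a x) ρ)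
    (hB : ∀ m j, Integrable (B m j) ρ)
    (hle : ∀ m j, ∀ᵐ a ∂ρ, ∀ x, ‖x‖ ^ m * ‖iteratedFDeriv ℝ j (F a) x‖ ≤ B m j a) :
    𝓢(Space d, ℂ) where
  toFun x := ∫ a, F a x ∂ρ
  smooth' := contDiff_infty.2 fun k =>
    (contDiff_integral_and_bound k hF hm (fun m j _ => hB m j) fun m j _ => hle m j).1
  decay' m j := ⟨_, (contDiff_integral_and_bound j hF hm (fun m j _ => hB m j)
    fun m j _ => hle m j).2 m j le_rfl⟩

theorem fourier_integral_superposition [SFinite ρ] (hmF : AEStronglyMeasurable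
    (Function.uncurry F) (ρ.prod volume)) {b : X → ℝ} (hb : Integrable b ρ)
    (hle : ∀ᵐ a ∂ρ, ∀ x, ‖F a x‖ ≤ b a * (1 + ‖x‖) ^ (-((d + 1 : ℕ) : ℝ))) (ξ : Space d) :
    𝓕 (fun x => ∫ a, F a x ∂ρ) ξ = ∫ a, 𝓕 (F a) ξ ∂ρ := by
  simp only [Real.fourier_eq', smul_eq_mul]
  simp only [← integral_const_mul]
  symm
  refine integral_integral_swap (integrable_prod_of_norm_le ?_ hb
    (integrable_one_add_norm (E := Space d) (r := ((d + 1 : ℕ) : ℝ)) (by simp)) ?_)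
  · have hc : Continuous fun x : Space d =>
        Complex.exp ((-2 * Real.pi * inner ℝ x ξ : ℝ) * Complex.I) := by fun_prop
    exact (hc.stronglyMeasurable.comp_measurable measurable_snd).aestronglyMeasurable.mul hmF
  · filter_upwards [hle] with a ha x
    have : ‖Complex.exp ((-2 * Real.pi * inner ℝ x ξ : ℝ) * Complex.I)‖ = 1 :=
      Complex.norm_exp_ofReal_mul_I _
    simpa only [Function.uncurry, norm_mul, this, one_mul] using ha x

end Superposition

/-- No integrability is needed: without it both sides are zero by convention. -/
theorem integral_neg_one_one_comp_abs (f : ℝ → ℂ) :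
    ∫ t in (-1 : ℝ)..1, f |t| = 2 * ∫ t in Ioc (0 : ℝ) 1, f t := by
  have h1 : ∫ t in (0 : ℝ)..1, f |t| = ∫ t in Ioc (0 : ℝ) 1, f t := by
    rw [intervalIntegral.integral_of_le zero_le_one]
    exact setIntegral_congr_fun measurableSet_Ioc fun t ht => by rw [abs_of_pos ht.1]
  have h2 : ∫ t in (-1 : ℝ)..0, f |t| = ∫ t in (0 : ℝ)..1, f |t| := by
    have := intervalIntegral.integral_comp_neg (a := 0) (b := 1) fun t : ℝ => f |t|
    simpa using this.symm
  by_cases hi : IntervalIntegrable (fun t => f |t|) volume 0 1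
  · have hi' : IntervalIntegrable (fun t => f |t|) volume (-1) 0 := by
      have := ((IntervalIntegrable.iff_comp_neg (by simp)).1 hi).symm
      simpa using this
    rw [← intervalIntegral.integral_add_adjacent_intervals hi' hi, h2, h1]
    ring
  · have hi' : ¬ IntervalIntegrable (fun t => f |t|) volume (-1) 1 := fun h =>
      hi (h.mono_set (by
        rw [uIcc_of_le zero_le_one, uIcc_of_le (by norm_num)]
        exact Icc_subset_Icc (by norm_num) le_rfl))
    rw [intervalIntegral.integral_undef hi', ← h1, intervalIntegral.integral_undef hi, mul_zero]

/-! ### Superpositions of Gaussians -/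

/-- The Gaussian `exp (-π |z|² / s²)`. -/
def gauss (s : ℝ) (z : Space d) : ℂ := gaussian 1 one_pos (s⁻¹ • z)

theorem gauss_eq_gaussian (s : ℝ) (hs : 0 < s) (z : Space d) : gauss s z = gaussian s hs z :=
  (gaussian_eq_gaussian_one s hs z).symm

theorem gauss_eq_exp (s : ℝ) (z : Space d) :
    gauss s z = Complex.exp (-(Real.pi * (‖z‖ / s) ^ 2 : ℝ)) := by
  rw [gauss, gaussian_apply, norm_smul, norm_inv, Real.norm_eq_abs]
  congr 3
  rw [one_pow, div_one, mul_pow, inv_pow, sq_abs, div_pow]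
  ring

theorem measurable_gauss : Measurable fun p : ℝ × Space d => gauss p.1 p.2 := by
  simp only [gauss_eq_exp]
  fun_prop

/-- Away from the origin this is evenness in `t` and moving `λ` into the width. At the origin the
convention `G_μ(0) = -2/μ` is the value of the integral, which converges there only if `Re ν > d`.
-/
theorem crandallG_smul {lam : ℝ} (hlam : 0 < lam) (ν : ℂ) (z : Space d)
    (h : z ≠ 0 ∨ (d : ℝ) < ν.re) :
    crandallG (d - ν) (lam • z) =
      ∫ t in Ioc (0 : ℝ) 1, 2 * (t : ℂ) ^ (ν - d - 1) * gauss (t / lam) z := by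
  by_cases hz : z = 0
  · have hν : (d : ℝ) < ν.re := h.resolve_left (not_not.2 hz)
    have hre : -1 < (ν - d - 1).re := by simp; linarith
    have hne : ν - d ≠ 0 := fun h0 => by
      have : (ν - d).re = 0 := by rw [h0]; rfl
      simp at this
      linarith
    have h1 : ∀ t : ℝ, gauss (t / lam) z = 1 := fun t => by
      rw [gauss_eq_exp, hz]; simp
    simp only [h1, mul_one]
    rw [crandallG, if_pos (by rw [hz, smul_zero]),
      ← intervalIntegral.integral_of_le zero_le_one, intervalIntegral.integral_const_mul,
      integral_cpow (Or.inl hre), sub_add_cancel]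
    have hne' : (d : ℂ) - ν ≠ 0 := fun h0 => hne (by linear_combination -h0)
    simp only [Complex.ofReal_one, Complex.one_cpow, Complex.ofReal_zero, Complex.zero_cpow hne]
    field_simp
    ring
  · have hlz : lam • z ≠ 0 := smul_ne_zero hlam.ne' hz
    rw [crandallG, if_neg hlz]
    have h1 := integral_neg_one_one_comp_abs fun t : ℝ =>
      (t : ℂ) ^ (-((d : ℂ) - ν)) * Complex.exp (-(Real.pi * ‖lam • z‖ ^ 2 / t ^ 2 : ℝ)) / (t : ℂ)
    simp only [sq_abs] at h1
    rw [h1, ← integral_const_mul]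
    refine setIntegral_congr_fun measurableSet_Ioc fun t ht => ?_
    have ht0 : (t : ℂ) ≠ 0 := by exact_mod_cast ht.1.ne'
    have h2 : (t : ℂ) ^ (ν - d - 1) = (t : ℂ) ^ (-((d : ℂ) - ν)) / t := by
      rw [Complex.cpow_sub _ _ ht0, Complex.cpow_one, neg_sub]
    have h3 : Real.pi * ‖lam • z‖ ^ 2 / t ^ 2 = Real.pi * (‖z‖ / (t / lam)) ^ 2 := by
      rw [norm_smul, Real.norm_of_nonneg hlam.le]
      have := ht.1.ne'
      field_simp
    simp only [gauss_eq_exp, h2, h3]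
    ring

/-- `∫_S 2 t^w exp (-π λ² |y - z|² / t²) dt`. -/
def gaussMix (lam : ℝ) (y : Space d) (w : ℂ) (S : Set ℝ) (z : Space d) : ℂ :=
  ∫ t in S, 2 * (t : ℂ) ^ w * gauss (t / lam) (y - z)

/-- Each derivative of a Gaussian of width `t / λ` costs a factor `λ / t`, while `t ≤ 1` keeps the
spatial weight uniform. With `w = ν - d - 1` the bound is integrable at `t = 0` for all `j ≤ k` when
`Re ν > d + k`. -/
theorem norm_iteratedFDeriv_gauss_le {lam : ℝ} (hlam : 0 < lam) (y : Space d) (w : ℂ) (m j : ℕ) :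
    ∃ K : ℝ, 0 ≤ K ∧ ∀ t ∈ Ioc (0 : ℝ) 1, ∀ z : Space d,
      (1 + ‖z‖) ^ m *
        ‖iteratedFDeriv ℝ j (fun z => 2 * (t : ℂ) ^ w * gauss (t / lam) (y - z)) z‖ ≤
        K * t ^ (w.re - j) := by
  obtain ⟨C, hC, h⟩ := schwartz_decay_uniform (gaussian (d := d) 1 one_pos) m j
  set A : ℝ := 1 + ‖y‖ + lam⁻¹ with hA
  have hA0 : 0 < A := by positivity
  refine ⟨2 * lam ^ j * A ^ m * C, by positivity, fun t ht z => ?_⟩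
  have ht0 := ht.1
  set v : Space d := (t / lam)⁻¹ • (y - z) with hv
  have hsm : ContDiff ℝ ∞ (gaussian (d := d) 1 one_pos) := (gaussian (d := d) 1 one_pos).smooth ⊤
  have hsm' : ContDiff ℝ ∞ fun z : Space d =>
      gaussian (d := d) 1 one_pos ((t / lam)⁻¹ • (y - z)) := hsm.comp (by fun_prop)
  have h1 : iteratedFDeriv ℝ j (fun z => 2 * (t : ℂ) ^ w * gauss (t / lam) (y - z)) z =
      (2 * (t : ℂ) ^ w) • ((-(t / lam)⁻¹) ^ j •
        iteratedFDeriv ℝ j (gaussian (d := d) 1 one_pos) v) := by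
    rw [← iteratedFDeriv_comp_smul_sub hsm]
    exact iteratedFDeriv_const_smul_apply' (a := (2 * (t : ℂ) ^ w))
      (hsm'.of_le (by exact_mod_cast le_top)).contDiffAt
  have h2 : ‖(2 * (t : ℂ) ^ w)‖ = 2 * t ^ w.re := by
    rw [norm_mul, Complex.norm_cpow_eq_rpow_re_of_pos ht0]; simp
  have h3 : ‖(-(t / lam)⁻¹) ^ j‖ = lam ^ j * (t ^ j)⁻¹ := by
    rw [norm_pow, norm_neg, norm_inv, Real.norm_of_nonneg (by positivity), inv_div, div_pow]
    rfl
  have hz : 1 + ‖z‖ ≤ A * (1 + ‖v‖) := by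
    have h4 : ‖y - z‖ ≤ lam⁻¹ * ‖v‖ := by
      rw [hv, norm_smul, norm_inv, Real.norm_of_nonneg (by positivity : 0 ≤ t / lam), inv_div,
        ← mul_assoc, inv_mul_eq_div, div_div_cancel_left' hlam.ne']
      exact le_mul_of_one_le_left (norm_nonneg _) ((one_le_inv₀ ht0).2 ht.2)
    have h5 : ‖z‖ ≤ ‖y‖ + ‖y - z‖ := by
      have := norm_sub_le y (y - z)
      rwa [sub_sub_cancel] at this
    have : 0 ≤ lam⁻¹ := by positivity
    nlinarith [norm_nonneg v, norm_nonneg y, mul_nonneg (norm_nonneg y) (norm_nonneg v)]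
  rw [h1, norm_smul, norm_smul, h2, h3]
  calc (1 + ‖z‖) ^ m * (2 * t ^ w.re * (lam ^ j * (t ^ j)⁻¹ *
        ‖iteratedFDeriv ℝ j (gaussian (d := d) 1 one_pos) v‖))
      ≤ (A * (1 + ‖v‖)) ^ m * (2 * t ^ w.re * (lam ^ j * (t ^ j)⁻¹ *
        ‖iteratedFDeriv ℝ j (gaussian (d := d) 1 one_pos) v‖)) := by gcongr
    _ = 2 * lam ^ j * A ^ m * (t ^ w.re * (t ^ j)⁻¹) *
        ((1 + ‖v‖) ^ m * ‖iteratedFDeriv ℝ j (gaussian (d := d) 1 one_pos) v‖) := by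
        rw [mul_pow]; ring
    _ ≤ 2 * lam ^ j * A ^ m * (t ^ w.re * (t ^ j)⁻¹) * C := by
        gcongr
        exact h j le_rfl v
    _ = _ := by
        rw [Real.rpow_sub ht0, Real.rpow_natCast]
        ring

theorem contDiff_gauss_term (lam : ℝ) (y : Space d) (w : ℂ) (t : ℝ) :
    ContDiff ℝ ∞ fun z => 2 * (t : ℂ) ^ w * gauss (t / lam) (y - z) := by
  have hsm : ContDiff ℝ ∞ (gaussian (d := d) 1 one_pos) := (gaussian (d := d) 1 one_pos).smooth ⊤
  exact contDiff_const.mul (hsm.comp (by fun_prop))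

theorem measurable_gauss_term (lam : ℝ) (y : Space d) (w : ℂ) :
    Measurable fun p : ℝ × Space d => 2 * (p.1 : ℂ) ^ w * gauss (p.1 / lam) (y - p.2) := by
  refine Measurable.mul (by fun_prop) ?_
  exact measurable_gauss.comp (f := fun p : ℝ × Space d => (p.1 / lam, y - p.2)) (by fun_prop)

/-- The constants do not depend on `S`. They control the full mixture and, with `S` shrinking to the
empty set, the error of truncating it. -/
theorem gaussMix_bound {lam : ℝ} (hlam : 0 < lam) (y : Space d) (w : ℂ) :
    ∃ K : ℕ → ℕ → ℝ, (∀ m j, 0 ≤ K m j) ∧ ∀ S : Set ℝ, MeasurableSet S → S ⊆ Ioc 0 1 → ∀ k : ℕ,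
      (∀ j : ℕ, j ≤ k → IntegrableOn (fun t : ℝ => t ^ (w.re - j)) S) →
      ContDiff ℝ k (gaussMix lam y w S) ∧ ∀ m j : ℕ, j ≤ k → ∀ x,
        ‖x‖ ^ m * ‖iteratedFDeriv ℝ j (gaussMix lam y w S) x‖ ≤
          K m j * ∫ t in S, t ^ (w.re - j) := by
  choose K hK hKle using fun m j => norm_iteratedFDeriv_gauss_le hlam y w m j
  refine ⟨K, hK, fun S hS hS1 k hint => ?_⟩
  have := contDiff_integral_and_bound (ρ := volume.restrict S) k
    (F := fun (t : ℝ) z => 2 * (t : ℂ) ^ w * gauss (t / lam) (y - z))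
    (B := fun m j t => K m j * t ^ (w.re - j)) (contDiff_gauss_term lam y w)
    (fun x => ((measurable_gauss_term lam y w).comp
      (measurable_id.prodMk measurable_const)).aestronglyMeasurable)
    (fun m j hj => (hint j hj).const_mul _)
    (fun m j hj => (ae_restrict_iff' hS).2 (Eventually.of_forall fun t ht x => ?_))
  · refine ⟨this.1, fun m j hj x => ?_⟩
    rw [← integral_const_mul]
    exact this.2 m j hj x
  · refine le_trans ?_ (hKle m j t (hS1 ht) x)
    gcongr
    linarith

theorem integrableOn_rpow_Ioc {ε : ℝ} (hε : 0 < ε) (a : ℝ) :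
    IntegrableOn (fun t : ℝ => t ^ a) (Ioc ε 1) := by
  refine IntegrableOn.mono_set (ContinuousOn.integrableOn_compact (K := Icc ε 1) isCompact_Icc ?_)
    Ioc_subset_Icc_self
  exact fun t ht => (Real.continuousAt_rpow_const t a
    (Or.inl (hε.trans_le ht.1).ne')).continuousWithinAt

theorem integrableOn_rpow_Ioc_zero {a : ℝ} (ha : -1 < a) :
    IntegrableOn (fun t : ℝ => t ^ a) (Ioc 0 1) :=
  (intervalIntegrable_iff_integrableOn_Ioc_of_le zero_le_one).1
    (intervalIntegral.intervalIntegrable_rpow' ha)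

theorem exists_schwartz_gaussMix {lam : ℝ} (hlam : 0 < lam) (y : Space d) (w : ℂ) {ε : ℝ}
    (hε : 0 < ε) : ∃ φ : 𝓢(Space d, ℂ), ⇑φ = gaussMix lam y w (Ioc ε 1) := by
  obtain ⟨K, -, h⟩ := gaussMix_bound hlam y w
  have h' := fun k => h (Ioc ε 1) measurableSet_Ioc (Ioc_subset_Ioc_left hε.le) k
    fun j _ => integrableOn_rpow_Ioc hε _
  exact ⟨⟨gaussMix lam y w (Ioc ε 1), contDiff_infty.2 fun k => (h' k).1,
    fun m j => ⟨_, (h' j).2 m j le_rfl⟩⟩, rfl⟩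

theorem one_hasTemperateGrowth : (fun _ : Space d => (1 : ℂ)).HasTemperateGrowth :=
  Function.HasTemperateGrowth.const 1

theorem fourier_gauss_term {lam : ℝ} (hlam : 0 < lam) (y : Space d) (w : ℂ) {t : ℝ} (ht : 0 < t)
    (ξ : Space d) :
    𝓕 (fun z : Space d => 2 * (t : ℂ) ^ w * gauss (t / lam) (y - z)) ξ =
      2 * (t : ℂ) ^ w * (((t / lam : ℝ) : ℂ) ^ d *
        Complex.exp (heatPhase ξ ((t / lam) ^ 2, y))) := by
  rw [← fourier_reflect_gaussian (t / lam) (div_pos ht hlam) y ξ, SchwartzMap.fourier_coe,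
    Real.fourier_eq', Real.fourier_eq', ← integral_const_mul]
  refine integral_congr_ae (Eventually.of_forall fun z => ?_)
  simp only [reflect_apply, gauss_eq_gaussian _ (div_pos ht hlam), smul_eq_mul]
  ring

theorem measurable_exp_heatPhase (y : Space d) :
    Measurable fun p : ℝ × Space d => Complex.exp (heatPhase p.2 (p.1 ^ 2, y)) := by
  simp only [heatPhase_apply]
  fun_prop

/-- Fubini twice: for the Fourier transform and for the integral against `μ`. The cutoff at `ε`
makes the second exchange absolutely convergent, since the Gaussian of parameter `(ε / λ)²`
dominates. -/
theorem pairing_gaussMix {μ : Measure (Space d)} [μ.HasTemperateGrowth] [SFinite μ] {lam : ℝ}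
    (hlam : 0 < lam) (y : Space d) (w : ℂ) {ε : ℝ} (hε : 0 < ε) (φ : 𝓢(Space d, ℂ))
    (hφ : ⇑φ = gaussMix lam y w (Ioc ε 1)) :
    pairing μ (fun _ => 1) φ = ∫ t in Ioc ε 1, 2 * (t : ℂ) ^ w *
      (((t / lam : ℝ) : ℂ) ^ d * theta μ (fun _ => 1) ((t / lam) ^ 2) y) := by
  have hF : ∀ ξ, 𝓕 φ ξ = ∫ t in Ioc ε 1, 2 * (t : ℂ) ^ w * (((t / lam : ℝ) : ℂ) ^ d *
      Complex.exp (heatPhase ξ ((t / lam) ^ 2, y))) := by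
    intro ξ
    obtain ⟨K, hK, hKle⟩ := norm_iteratedFDeriv_gauss_le hlam y w (d + 1) 0
    rw [SchwartzMap.fourier_coe, hφ]
    refine (fourier_integral_superposition (ρ := volume.restrict (Ioc ε 1))
      (F := fun (t : ℝ) z => 2 * (t : ℂ) ^ w * gauss (t / lam) (y - z))
      (measurable_gauss_term lam y w).aestronglyMeasurable
      ((integrableOn_rpow_Ioc hε w.re).const_mul K) ?_ ξ).trans ?_
    · refine (ae_restrict_iff' measurableSet_Ioc).2 (Eventually.of_forall fun t ht x => ?_)
      have := hKle t ⟨hε.trans ht.1, ht.2⟩ x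
      rw [norm_iteratedFDeriv_zero, Nat.cast_zero, sub_zero] at this
      rw [Real.rpow_neg (by positivity), Real.rpow_natCast, ← div_eq_mul_inv,
        le_div_iff₀ (by positivity), mul_comm]
      exact this
    · refine setIntegral_congr_fun measurableSet_Ioc fun t ht => ?_
      exact fourier_gauss_term hlam y w (hε.trans ht.1) ξ
  rw [pairing_apply one_hasTemperateGrowth]
  simp only [one_mul, hF]
  have hswap : Integrable (Function.uncurry fun (t : ℝ) (ξ : Space d) =>
      2 * (t : ℂ) ^ w * (((t / lam : ℝ) : ℂ) ^ d * Complex.exp (heatPhase ξ ((t / lam) ^ 2, y))))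
      ((volume.restrict (Ioc ε 1)).prod μ) := by
    refine integrable_prod_of_norm_le (f := fun t => 2 * lam⁻¹ ^ d * t ^ w.re) ?_
      ((integrableOn_rpow_Ioc hε w.re).const_mul _)
      (integrable_mul_exp (μ := μ) (one_hasTemperateGrowth (d := d)) (s := (ε / lam) ^ 2)
        (by positivity)) ?_
    · refine Measurable.aestronglyMeasurable ?_
      have := (measurable_exp_heatPhase y).comp
        (f := fun p : ℝ × Space d => (p.1 / lam, p.2)) (by fun_prop)
      exact Measurable.mul (by fun_prop) (Measurable.mul (by fun_prop) this)
    · refine (ae_restrict_iff' measurableSet_Ioc).2 (Eventually.of_forall fun t ht ξ => ?_)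
      have ht0 : 0 < t := hε.trans ht.1
      have hpi := Real.pi_pos
      simp only [Function.uncurry, norm_mul, norm_exp_heatPhase, norm_pow, norm_one, one_mul,
        Complex.norm_cpow_eq_rpow_re_of_pos ht0, Complex.norm_real]
      rw [Real.norm_of_nonneg (by positivity : 0 ≤ t / lam)]
      have h1 : (t / lam) ^ d ≤ lam⁻¹ ^ d := by
        gcongr
        rw [div_eq_mul_inv]
        exact mul_le_of_le_one_left (by positivity) ht.2
      have h2 : Real.exp (-(Real.pi * (t / lam) ^ 2 * ‖ξ‖ ^ 2)) ≤
          Real.exp (-(Real.pi * (ε / lam) ^ 2 * ‖ξ‖ ^ 2)) := by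
        have := ht.1.le
        gcongr
      calc _ ≤ ‖(2 : ℂ)‖ * t ^ w.re * (lam⁻¹ ^ d *
            Real.exp (-(Real.pi * (ε / lam) ^ 2 * ‖ξ‖ ^ 2))) := by gcongr
        _ = _ := by
            rw [Complex.norm_ofNat]
            ring
  rw [← integral_integral_swap hswap]
  simp only [integral_const_mul, theta, one_mul]

/-- Two approximating sequences differ by a null sequence in the seminorms that bound `u`. The
extension of `u` to `𝓢^k` can therefore be computed along any single sequence. -/
theorem tendsto_of_tendstoSk {u : 𝓢'(Space d, ℂ)} {k : ℕ} (hu : HasOrderLE u k)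
    {g : Space d → ℂ} (hg : ContDiff ℝ k g) {φ φ' : ℕ → 𝓢(Space d, ℂ)}
    (h : TendstoSk k φ g) (h' : TendstoSk k φ' g) {c : ℂ}
    (hc : Tendsto (fun n => u (φ n)) atTop (𝓝 c)) :
    Tendsto (fun n => u (φ' n)) atTop (𝓝 c) := by
  obtain ⟨m, C, hu⟩ := hu
  have hzero : Tendsto (fun n => u (φ' n) - u (φ n)) atTop (𝓝 0) := by
    rw [Metric.tendsto_nhds]
    intro ε hε
    -- Two errors of size `δ`, multiplied by `|C| + 1`, give `ε / 2`. Nothing is known about the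
    -- sign of `C`, and the `+ 1` excludes division by zero.
    set δ : ℝ := ε / (4 * (|C| + 1)) with hδ
    have hδ0 : 0 < δ := by positivity
    have hev : ∀ᶠ n in atTop, ∀ q ∈ Finset.Iic (m, k), ∀ x,
        ‖x‖ ^ q.1 * ‖iteratedFDeriv ℝ q.2 (fun z => φ n z - g z) x‖ ≤ δ ∧
        ‖x‖ ^ q.1 * ‖iteratedFDeriv ℝ q.2 (fun z => φ' n z - g z) x‖ ≤ δ := by
      refine (Filter.eventually_all_finset _).2 fun q hq => ?_
      have hq2 : q.2 ≤ k := (Finset.mem_Iic.1 hq).2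
      filter_upwards [h q.1 q.2 hq2 δ hδ0, h' q.1 q.2 hq2 δ hδ0] with n h1 h2 x
      exact ⟨h1 x, h2 x⟩
    filter_upwards [hev] with n hn
    have hsup : ((Finset.Iic (m, k)).sup (schwartzSeminormFamily ℂ (Space d) ℂ)) (φ' n - φ n) ≤
        2 * δ := by
      refine Seminorm.finset_sup_apply_le (by positivity) fun q hq => ?_
      have hq2 : q.2 ≤ k := (Finset.mem_Iic.1 hq).2
      refine SchwartzMap.seminorm_le_bound ℂ q.1 q.2 _ (by positivity) fun x => ?_
      have hgq : ContDiff ℝ q.2 g := hg.of_le (by exact_mod_cast hq2)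
      have e : (⇑(φ' n - φ n) : Space d → ℂ) =
          (fun z => φ' n z - g z) - fun z => φ n z - g z := by
        funext z
        simp
      have hs1 : ContDiff ℝ q.2 (fun z => φ' n z - g z) := ((φ' n).smooth q.2).sub hgq
      have hs2 : ContDiff ℝ q.2 (fun z => φ n z - g z) := ((φ n).smooth q.2).sub hgq
      rw [e, iteratedFDeriv_sub_apply hs1.contDiffAt hs2.contDiffAt]
      calc _ ≤ ‖x‖ ^ q.1 * (‖iteratedFDeriv ℝ q.2 (fun z => φ' n z - g z) x‖ +
            ‖iteratedFDeriv ℝ q.2 (fun z => φ n z - g z) x‖) := by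
            gcongr
            exact norm_sub_le _ _
        _ ≤ 2 * δ := by
            rw [mul_add]
            linarith [(hn q hq x).1, (hn q hq x).2]
    rw [dist_zero_right, ← map_sub]
    calc ‖u (φ' n - φ n)‖ ≤ C * _ := hu _
      _ ≤ (|C| + 1) * (2 * δ) := by
          refine mul_le_mul ?_ hsup (apply_nonneg _ _) (by positivity)
          linarith [le_abs_self C]
      _ = ε / 2 := by
          rw [hδ]
          field_simp
          ring
      _ < ε := half_lt_self hε
  simpa using hzero.add hc

/-- The mixtures truncated to `t > 1/(n+1)` are Schwartz and converge in `𝓢^k`, the errors being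
integrals of `t ^ (Re w - j)` over shrinking intervals. Their values under `u` converge to the full
integral by `hint`. -/
theorem hasConvAt_gaussMix {u : 𝓢'(Space d, ℂ)} {μ : Measure (Space d)} [μ.HasTemperateGrowth]
    [SFinite μ] (hu : ∀ φ, u φ = pairing μ (fun _ => 1) φ) {k : ℕ} (hk : HasOrderLE u k)
    {lam : ℝ} (hlam : 0 < lam) {ν : ℂ} (hν : (d : ℝ) + k < ν.re) (y : Space d)
    (hint : IntegrableOn (fun t : ℝ => 2 * (t : ℂ) ^ (ν - d - 1) *
      (((t / lam : ℝ) : ℂ) ^ d * theta μ (fun _ => 1) ((t / lam) ^ 2) y)) (Ioc 0 1)) :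
    HasConvAt u k (fun z => crandallG (d - ν) (lam • z)) y
      (∫ t in Ioc (0 : ℝ) 1, 2 * (t : ℂ) ^ (ν - d - 1) *
        (((t / lam : ℝ) : ℂ) ^ d * theta μ (fun _ => 1) ((t / lam) ^ 2) y)) := by
  set w : ℂ := ν - d - 1 with hw
  have hdν : (d : ℝ) < ν.re := by
    have : (0 : ℝ) ≤ k := Nat.cast_nonneg k
    linarith
  have hre : ∀ j : ℕ, j ≤ k → -1 < w.re - j := by
    intro j hj
    have : (j : ℝ) ≤ k := by exact_mod_cast hj
    simp only [hw, Complex.sub_re, Complex.natCast_re, Complex.one_re]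
    linarith
  have hg : (fun z => crandallG ((d : ℂ) - ν) (lam • (y - z))) = gaussMix lam y w (Ioc 0 1) :=
    funext fun z => crandallG_smul hlam ν (y - z) (Or.inr hdν)
  obtain ⟨K, hK, hmix⟩ := gaussMix_bound hlam y w
  have h01 := hmix (Ioc 0 1) measurableSet_Ioc subset_rfl k
    fun j hj => integrableOn_rpow_Ioc_zero (hre j hj)
  set ε : ℕ → ℝ := fun n => 1 / ((n : ℝ) + 1) with hε
  have hε0 : ∀ n, 0 < ε n := fun n => by positivity
  have hε1 : ∀ n, ε n ≤ 1 := fun n => by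
    rw [hε]
    exact div_le_one_of_le₀ (by linarith [Nat.cast_nonneg (α := ℝ) n]) (by positivity)
  have hεanti : Antitone ε := fun a b hab => by
    have : (a : ℝ) ≤ b := by exact_mod_cast hab
    simp only [hε]
    gcongr
  choose φ hφ using fun n => exists_schwartz_gaussMix hlam y w (hε0 n)
  have hTφ : TendstoSk k φ (fun z => crandallG ((d : ℂ) - ν) (lam • (y - z))) := by
    intro m j hj δ hδ
    have hdiff : ∀ n, (fun z => φ n z - crandallG ((d : ℂ) - ν) (lam • (y - z))) =
        -gaussMix lam y w (Ioc 0 (ε n)) := by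
      intro n
      funext z
      have h1 : crandallG ((d : ℂ) - ν) (lam • (y - z)) = gaussMix lam y w (Ioc 0 1) z :=
        congrFun hg z
      obtain ⟨K0, hK0, hK0le⟩ := norm_iteratedFDeriv_gauss_le hlam y w 0 0
      have hi : IntegrableOn (fun t : ℝ => 2 * (t : ℂ) ^ w * gauss (t / lam) (y - z))
          (Ioc 0 1) := by
        refine ((integrableOn_rpow_Ioc_zero (hre 0 (Nat.zero_le k))).const_mul K0).mono'
          ((measurable_gauss_term lam y w).comp
            (measurable_id.prodMk measurable_const)).aestronglyMeasurable
          ((ae_restrict_iff' measurableSet_Ioc).2 (Eventually.of_forall fun t ht => ?_))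
        have := hK0le t ht z
        rwa [pow_zero, one_mul, norm_iteratedFDeriv_zero] at this
      rw [hφ, h1, Pi.neg_apply, gaussMix, gaussMix, gaussMix,
        ← Ioc_union_Ioc_eq_Ioc (hε0 n).le (hε1 n),
        setIntegral_union (Ioc_disjoint_Ioc_of_le le_rfl) measurableSet_Ioc
          (hi.mono_set (Ioc_subset_Ioc_right (hε1 n)))
          (hi.mono_set (Ioc_subset_Ioc_left (hε0 n).le))]
      ring
    have hlim : Tendsto (fun n => K m j * ∫ t in Ioc 0 (ε n), t ^ (w.re - j)) atTop (𝓝 0) := by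
      have h1 := tendsto_setIntegral_of_antitone (μ := volume) (s := fun n => Ioc 0 (ε n))
        (f := fun t : ℝ => t ^ (w.re - j)) (fun n => measurableSet_Ioc)
        (fun a b hab => Ioc_subset_Ioc_right (hεanti hab))
        ⟨0, (integrableOn_rpow_Ioc_zero (hre j hj)).mono_set (Ioc_subset_Ioc_right (hε1 0))⟩
      have h2 : ⋂ n, Ioc 0 (ε n) = ∅ := by
        refine eq_empty_of_forall_notMem fun t ht => ?_
        have ht' := mem_iInter.1 ht
        obtain ⟨n, hn⟩ := exists_nat_one_div_lt (ht' 0).1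
        exact absurd (ht' n).2 (not_le.2 hn)
      rw [h2, Measure.restrict_empty, integral_zero_measure] at h1
      simpa using h1.const_mul (K m j)
    filter_upwards [hlim.eventually (gt_mem_nhds hδ)] with n hn x
    rw [hdiff n, iteratedFDeriv_neg, Pi.neg_apply, norm_neg]
    refine ((hmix (Ioc 0 (ε n)) measurableSet_Ioc (Ioc_subset_Ioc_right (hε1 n)) k
      fun i hi => (integrableOn_rpow_Ioc_zero (hre i hi)).mono_set
        (Ioc_subset_Ioc_right (hε1 n))).2 m j hj x).trans (le_of_lt hn)
  have hlimu : Tendsto (fun n => u (φ n)) atTop (𝓝 (∫ t in Ioc (0 : ℝ) 1, 2 * (t : ℂ) ^ w *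
        (((t / lam : ℝ) : ℂ) ^ d * theta μ (fun _ => 1) ((t / lam) ^ 2) y))) := by
    have hU : ⋃ n, Ioc (ε n) 1 = Ioc 0 1 := by
      refine Subset.antisymm (iUnion_subset fun n => Ioc_subset_Ioc_left (hε0 n).le) ?_
      intro t ht
      obtain ⟨n, hn⟩ := exists_nat_one_div_lt ht.1
      exact mem_iUnion.2 ⟨n, hn, ht.2⟩
    have h1 := tendsto_setIntegral_of_monotone (μ := volume) (s := fun n => Ioc (ε n) 1)
      (fun n => measurableSet_Ioc) (fun a b hab => Ioc_subset_Ioc_left (hεanti hab))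
      (hU ▸ hint)
    rw [hU] at h1
    refine h1.congr fun n => ?_
    rw [hu, pairing_gaussMix hlam y w (hε0 n) (φ n) (hφ n)]
  refine ⟨?_, ⟨φ, hTφ⟩, fun φ' hφ' => ?_⟩
  · rw [hg]
    exact ⟨h01.1, fun m j hj => ⟨_, h01.2 m j hj⟩⟩
  · refine tendsto_of_tendstoSk hk ?_ hTφ hφ' hlimu
    rw [hg]
    exact h01.1

/-! ### Convolution with a superposition of Gaussians, as a distribution -/

/-- The mass `(t / λ) ^ d` of the Gaussian cancels the `-d` in the exponent, which is why `Re ν > 0`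
suffices for the distributional statement. -/
theorem norm_two_mul_cpow_mul_pow {lam t : ℝ} (hlam : 0 < lam) (ht : 0 < t) (ν : ℂ) :
    ‖2 * (t : ℂ) ^ (ν - d - 1) * ((t / lam : ℝ) : ℂ) ^ d‖ = 2 * lam⁻¹ ^ d * t ^ (ν.re - 1) := by
  rw [norm_mul, norm_mul, norm_pow, Complex.norm_real, Complex.norm_cpow_eq_rpow_re_of_pos ht,
    Real.norm_of_nonneg (by positivity : 0 ≤ t / lam), Complex.norm_ofNat, div_eq_mul_inv,
    mul_pow]
  have h : t ^ (ν.re - 1) = t ^ (ν - d - 1).re * t ^ d := by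
    rw [← Real.rpow_natCast t d, ← Real.rpow_add ht]
    congr 1
    simp
    ring
  rw [h]
  ring

theorem exists_norm_gaussian_one_le (m : ℕ) : ∃ C : ℝ, 0 ≤ C ∧ ∀ v : Space d,
    (1 + ‖v‖) ^ m * ‖gaussian (d := d) 1 one_pos v‖ ≤ C * (1 + ‖v‖) ^ (-((d + 1 : ℕ) : ℝ)) := by
  obtain ⟨C, hC, h⟩ := schwartz_decay_uniform (gaussian (d := d) 1 one_pos) (m + (d + 1)) 0
  refine ⟨C, hC, fun v => ?_⟩
  have := h 0 le_rfl v
  rw [norm_iteratedFDeriv_zero, pow_add] at this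
  rw [Real.rpow_neg (by positivity), Real.rpow_natCast, ← div_eq_mul_inv,
    le_div_iff₀ (by positivity)]
  linarith

/-- The translates of `φ` whose superposition is the convolution of `φ` with
`∫_0^1 2 t^(ν-d-1) exp (-π λ² |·|² / t²) dt`. -/
def mixTerm (lam : ℝ) (ν : ℂ) (φ : 𝓢(Space d, ℂ)) (p : ℝ × Space d) (x : Space d) : ℂ :=
  2 * (p.1 : ℂ) ^ (ν - d - 1) * ((p.1 / lam : ℝ) : ℂ) ^ d * gaussian 1 one_pos p.2 *
    φ (x - (p.1 / lam) • p.2)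

theorem measurable_mixTerm (lam : ℝ) (ν : ℂ) (φ : 𝓢(Space d, ℂ)) :
    Measurable (Function.uncurry (mixTerm lam ν φ)) := by
  have h1 : Measurable (gaussian (d := d) 1 one_pos) :=
    (gaussian (d := d) 1 one_pos).continuous.measurable
  have h2 : Measurable φ := φ.continuous.measurable
  have h3 := h1.comp (f := fun q : (ℝ × Space d) × Space d => q.1.2) (by fun_prop)
  have h4 := h2.comp (f := fun q : (ℝ × Space d) × Space d => q.2 - (q.1.1 / lam) • q.1.2)
    (by fun_prop)
  exact Measurable.mul (Measurable.mul (by fun_prop) h3) h4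

theorem contDiff_mixTerm (lam : ℝ) (ν : ℂ) (φ : 𝓢(Space d, ℂ)) (p : ℝ × Space d) :
    ContDiff ℝ ∞ (mixTerm lam ν φ p) :=
  contDiff_const.mul ((φ.smooth ⊤).comp (by fun_prop))

/-- All derivatives fall on the translate of `φ` and none on the Gaussian, so no negative powers of
`t` appear beyond the exponent of the weight. -/
theorem norm_iteratedFDeriv_mixTerm_le {lam : ℝ} (hlam : 0 < lam) (ν : ℂ) (φ : 𝓢(Space d, ℂ))
    (m j : ℕ) : ∃ C : ℝ, 0 ≤ C ∧ ∀ t ∈ Ioc (0 : ℝ) 1, ∀ v x : Space d,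
      (1 + ‖x‖) ^ m * ‖iteratedFDeriv ℝ j (mixTerm lam ν φ (t, v)) x‖ ≤
        C * t ^ (ν.re - 1) * (1 + ‖v‖) ^ (-((d + 1 : ℕ) : ℝ)) := by
  obtain ⟨C₁, hC₁, h₁⟩ := schwartz_decay_uniform φ m j
  obtain ⟨C₂, hC₂, h₂⟩ := exists_norm_gaussian_one_le (d := d) m
  set A : ℝ := 1 + lam⁻¹ with hA
  have hl : 0 < lam⁻¹ := by positivity
  refine ⟨2 * lam⁻¹ ^ d * A ^ m * C₁ * C₂, by positivity, fun t ht v x => ?_⟩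
  set W : ℂ := 2 * (t : ℂ) ^ (ν - d - 1) * ((t / lam : ℝ) : ℂ) ^ d * gaussian 1 one_pos v with hW
  set z : Space d := x - (t / lam) • v with hz
  have hd : iteratedFDeriv ℝ j (mixTerm lam ν φ (t, v)) x = W • iteratedFDeriv ℝ j φ z := by
    have hs : ContDiff ℝ j fun x => φ (x - (t / lam) • v) := (φ.smooth j).comp (by fun_prop)
    rw [hz, ← iteratedFDeriv_comp_sub]
    exact iteratedFDeriv_const_smul_apply' (a := W) hs.contDiffAt
  have hWn : ‖W‖ = 2 * lam⁻¹ ^ d * t ^ (ν.re - 1) * ‖gaussian (d := d) 1 one_pos v‖ := by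
    rw [hW, norm_mul, norm_two_mul_cpow_mul_pow hlam ht.1]
  have hx : 1 + ‖x‖ ≤ A * (1 + ‖v‖) * (1 + ‖z‖) := by
    have h3 : ‖x‖ ≤ ‖z‖ + ‖(t / lam) • v‖ := by
      have := norm_add_le z ((t / lam) • v)
      rwa [hz, sub_add_cancel] at this
    have h4 : ‖(t / lam) • v‖ ≤ lam⁻¹ * ‖v‖ := by
      rw [norm_smul, Real.norm_of_nonneg (by have := ht.1; positivity), div_eq_mul_inv]
      gcongr
      exact mul_le_of_le_one_left hl.le ht.2
    have h5 := norm_nonneg v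
    have h6 := norm_nonneg z
    nlinarith [mul_nonneg hl.le h5, mul_nonneg hl.le h6, mul_nonneg h5 h6,
      mul_nonneg hl.le (mul_nonneg h5 h6)]
  have ht0 : 0 ≤ t ^ (ν.re - 1) := Real.rpow_nonneg ht.1.le _
  rw [hd, norm_smul, hWn]
  calc _ ≤ (A * (1 + ‖v‖) * (1 + ‖z‖)) ^ m * (2 * lam⁻¹ ^ d * t ^ (ν.re - 1) *
        ‖gaussian (d := d) 1 one_pos v‖ * ‖iteratedFDeriv ℝ j φ z‖) := by gcongr
    _ = 2 * lam⁻¹ ^ d * A ^ m * t ^ (ν.re - 1) * ((1 + ‖z‖) ^ m * ‖iteratedFDeriv ℝ j φ z‖) *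
        ((1 + ‖v‖) ^ m * ‖gaussian (d := d) 1 one_pos v‖) := by
        rw [mul_pow, mul_pow]; ring
    _ ≤ 2 * lam⁻¹ ^ d * A ^ m * t ^ (ν.re - 1) * C₁ *
        (C₂ * (1 + ‖v‖) ^ (-((d + 1 : ℕ) : ℝ))) := by
        refine mul_le_mul ?_ (h₂ v) (by positivity) (by positivity)
        gcongr
        exact h₁ j le_rfl z
    _ = _ := by ring

theorem integrable_rpow_mul_one_add_norm {ν : ℂ} (hν : 0 < ν.re) (C : ℝ) :
    Integrable (fun p : ℝ × Space d =>
      C * p.1 ^ (ν.re - 1) * (1 + ‖p.2‖) ^ (-((d + 1 : ℕ) : ℝ)))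
      ((volume.restrict (Ioc 0 1)).prod volume) :=
  Integrable.mul_prod (f := fun t : ℝ => C * t ^ (ν.re - 1))
    ((integrableOn_rpow_Ioc_zero (by linarith)).const_mul C)
    (integrable_one_add_norm (E := Space d) (r := ((d + 1 : ℕ) : ℝ)) (by simp))

theorem ae_fst_mem_Ioc : ∀ᵐ p : ℝ × Space d ∂((volume.restrict (Ioc 0 1)).prod volume),
    p.1 ∈ Ioc (0 : ℝ) 1 :=
  Measure.quasiMeasurePreserving_fst.ae (ae_restrict_mem measurableSet_Ioc)

theorem exists_schwartz_mixTerm {lam : ℝ} (hlam : 0 < lam) {ν : ℂ} (hν : 0 < ν.re)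
    (φ : 𝓢(Space d, ℂ)) : ∃ θ : 𝓢(Space d, ℂ), ⇑θ = fun x =>
      ∫ p, mixTerm lam ν φ p x ∂((volume.restrict (Ioc 0 1)).prod volume) := by
  choose C hC h using fun m j => norm_iteratedFDeriv_mixTerm_le hlam ν φ m j
  refine ⟨schwartzIntegral (F := mixTerm lam ν φ)
    (B := fun m j p => C m j * p.1 ^ (ν.re - 1) * (1 + ‖p.2‖) ^ (-((d + 1 : ℕ) : ℝ)))
    (contDiff_mixTerm lam ν φ) (fun x => ?_) (fun m j => integrable_rpow_mul_one_add_norm hν _)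
    (fun m j => ?_), rfl⟩
  · exact ((measurable_mixTerm lam ν φ).comp
      (measurable_id.prodMk measurable_const)).aestronglyMeasurable
  · filter_upwards [ae_fst_mem_Ioc] with p hp x
    refine le_trans ?_ (h m j p.1 hp p.2 x)
    gcongr
    linarith

theorem integrable_mixTerm {lam : ℝ} (hlam : 0 < lam) {ν : ℂ} (hν : 0 < ν.re)
    (φ : 𝓢(Space d, ℂ)) (x : Space d) :
    Integrable (fun p => mixTerm lam ν φ p x) ((volume.restrict (Ioc 0 1)).prod volume) := by
  obtain ⟨C, hC, h⟩ := norm_iteratedFDeriv_mixTerm_le hlam ν φ 0 0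
  refine (integrable_rpow_mul_one_add_norm hν C).mono' ((measurable_mixTerm lam ν φ).comp
    (measurable_id.prodMk measurable_const)).aestronglyMeasurable ?_
  filter_upwards [ae_fst_mem_Ioc] with p hp
  simpa using h p.1 hp p.2 x

theorem fourier_mixTerm (lam : ℝ) (ν : ℂ) (φ : 𝓢(Space d, ℂ)) (p : ℝ × Space d) (ξ : Space d) :
    𝓕 (mixTerm lam ν φ p) ξ = 2 * (p.1 : ℂ) ^ (ν - d - 1) * ((p.1 / lam : ℝ) : ℂ) ^ d *
      (Complex.exp ((-2 * Real.pi * inner ℝ p.2 ((p.1 / lam) • ξ) : ℝ) * Complex.I) *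
        gaussian 1 one_pos p.2) * 𝓕 φ ξ := by
  rw [SchwartzMap.fourier_coe, Real.fourier_eq', Real.fourier_eq', ← integral_const_mul,
    ← integral_add_right_eq_self _ ((p.1 / lam) • p.2)]
  refine integral_congr_ae (Eventually.of_forall fun x => ?_)
  simp only [mixTerm, add_sub_cancel_right, smul_eq_mul, inner_add_left, real_inner_smul_left,
    real_inner_smul_right]
  have : ((-2 * Real.pi * (inner ℝ x ξ + p.1 / lam * inner ℝ p.2 ξ) : ℝ) : ℂ) * Complex.I =
      (-2 * Real.pi * inner ℝ x ξ : ℝ) * Complex.I +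
        (-2 * Real.pi * (p.1 / lam * inner ℝ p.2 ξ) : ℝ) * Complex.I := by
    push_cast; ring
  rw [this, Complex.exp_add]
  ring

theorem fourier_gaussian_one_smul (s : ℝ) (ξ : Space d) :
    ∫ v, Complex.exp ((-2 * Real.pi * inner ℝ v (s • ξ) : ℝ) * Complex.I) *
      gaussian (d := d) 1 one_pos v = Complex.exp (heatPhase ξ (s ^ 2, 0)) := by
  have h := fourier_gaussian_apply (d := d) 1 one_pos (s • ξ)
  rw [SchwartzMap.fourier_coe, Real.fourier_eq'] at h
  simp only [smul_eq_mul] at h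
  rw [h, heatPhase_apply, norm_smul, inner_zero_right, mul_pow, Real.norm_eq_abs, sq_abs]
  push_cast
  simp only [one_pow, one_mul, mul_one, mul_zero, sub_zero]
  congr 1
  ring

theorem fourier_schwartz_mixTerm {lam : ℝ} (hlam : 0 < lam) {ν : ℂ} (hν : 0 < ν.re)
    (φ θ : 𝓢(Space d, ℂ)) (hθ : ⇑θ = fun x =>
      ∫ p, mixTerm lam ν φ p x ∂((volume.restrict (Ioc 0 1)).prod volume)) (ξ : Space d) :
    𝓕 θ ξ = ∫ t in Ioc (0 : ℝ) 1, 2 * (t : ℂ) ^ (ν - d - 1) * ((t / lam : ℝ) : ℂ) ^ d *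
      Complex.exp (heatPhase ξ ((t / lam) ^ 2, 0)) * 𝓕 φ ξ := by
  obtain ⟨C, hC, h⟩ := norm_iteratedFDeriv_mixTerm_le hlam ν φ (d + 1) 0
  have hbd : ∀ᵐ p : ℝ × Space d ∂((volume.restrict (Ioc 0 1)).prod volume), ∀ x,
      ‖mixTerm lam ν φ p x‖ ≤ (C * p.1 ^ (ν.re - 1) * (1 + ‖p.2‖) ^ (-((d + 1 : ℕ) : ℝ))) *
        (1 + ‖x‖) ^ (-((d + 1 : ℕ) : ℝ)) := by
    filter_upwards [ae_fst_mem_Ioc] with p hp x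
    have := h p.1 hp p.2 x
    rw [norm_iteratedFDeriv_zero] at this
    rw [Real.rpow_neg (by positivity : 0 ≤ 1 + ‖x‖), Real.rpow_natCast (1 + ‖x‖),
      ← div_eq_mul_inv, le_div_iff₀ (by positivity), mul_comm]
    exact this
  rw [SchwartzMap.fourier_coe, hθ, fourier_integral_superposition
    (measurable_mixTerm lam ν φ).aestronglyMeasurable (integrable_rpow_mul_one_add_norm hν C) hbd]
  simp only [fourier_mixTerm]
  rw [integral_prod]
  · refine integral_congr_ae (Eventually.of_forall fun t => ?_)
    simp only [integral_mul_const, integral_const_mul, fourier_gaussian_one_smul]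
  · have hi : Integrable (fun p : ℝ × Space d => 𝓕 (mixTerm lam ν φ p) ξ)
        ((volume.restrict (Ioc 0 1)).prod volume) := by
      simp only [Real.fourier_eq', smul_eq_mul]
      refine Integrable.integral_prod_left
        (f := fun q : (ℝ × Space d) × Space d =>
          Complex.exp ((-2 * Real.pi * inner ℝ q.2 ξ : ℝ) * Complex.I) * mixTerm lam ν φ q.1 q.2)
        (integrable_prod_of_norm_le ?_ (integrable_rpow_mul_one_add_norm hν C)
          (integrable_one_add_norm (E := Space d) (r := ((d + 1 : ℕ) : ℝ)) (by simp)) ?_)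
      · exact (Measurable.mul (by fun_prop) (measurable_mixTerm lam ν φ)).aestronglyMeasurable
      · filter_upwards [hbd] with p hp x
        rw [norm_mul, Complex.norm_exp_ofReal_mul_I, one_mul]
        exact hp x
    exact hi.congr (Eventually.of_forall fun p => fourier_mixTerm lam ν φ p ξ)

theorem integral_norm_mul_gauss_le (φ : 𝓢(Space d, ℂ)) : ∃ C : ℝ, 0 ≤ C ∧
    ∀ (s : ℝ), 0 < s → ∀ x : Space d, ∫ y, ‖gauss s (x - y) * φ y‖ ≤ C * s ^ d := by
  obtain ⟨C, hC, h⟩ := schwartz_decay_uniform φ 0 0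
  have hφ : ∀ y, ‖φ y‖ ≤ C := fun y => by simpa using h 0 le_rfl y
  refine ⟨C * ∫ v, ‖gaussian (d := d) 1 one_pos v‖, by positivity, fun s hs x => ?_⟩
  have hn : ∀ z : Space d, ((‖gauss s z‖ : ℝ) : ℂ) = gauss s z := fun z => by
    rw [gauss_eq_exp, ← Complex.ofReal_neg, ← Complex.ofReal_exp, Complex.norm_real,
      Real.norm_of_nonneg (Real.exp_pos _).le]
  have h1 : ((∫ y, ‖gauss s (x - y) * φ y‖ : ℝ) : ℂ) =
      (s : ℂ) ^ d * ∫ v, (‖φ (x - s • v)‖ : ℂ) * gaussian 1 one_pos v := by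
    rw [← integral_mul_reflect_gaussian (fun y => (‖φ y‖ : ℂ)) s hs x, ← integral_complex_ofReal]
    refine integral_congr_ae (Eventually.of_forall fun y => ?_)
    simp only [norm_mul, Complex.ofReal_mul, hn, reflect_apply, ← gauss_eq_gaussian s hs]
    ring
  have h2 : ∫ y, ‖gauss s (x - y) * φ y‖ =
      ‖((∫ y, ‖gauss s (x - y) * φ y‖ : ℝ) : ℂ)‖ := by
    rw [Complex.norm_real, Real.norm_of_nonneg (integral_nonneg fun _ => norm_nonneg _)]
  rw [h2, h1, norm_mul, norm_pow, Complex.norm_real, Real.norm_of_nonneg hs.le, mul_comm]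
  gcongr
  rw [← integral_const_mul]
  refine norm_integral_le_of_norm_le
    ((gaussian (d := d) 1 one_pos).integrable.norm.const_mul C)
    (Eventually.of_forall fun v => ?_)
  rw [norm_mul, Complex.norm_real, norm_norm]
  gcongr
  exact hφ _

/-- The kernel may be singular on the diagonal, so integrability is tested by integrating over space
first: this gains `t ^ d` and leaves `t ^ (Re ν - 1)`. -/
theorem integrable_cpow_mul_gauss_mul {lam : ℝ} (hlam : 0 < lam) {ν : ℂ} (hν : 0 < ν.re)
    (φ : 𝓢(Space d, ℂ)) (x : Space d) :
    Integrable (fun p : ℝ × Space d =>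
      2 * (p.1 : ℂ) ^ (ν - d - 1) * gauss (p.1 / lam) (x - p.2) * φ p.2)
      ((volume.restrict (Ioc 0 1)).prod volume) := by
  obtain ⟨C, hC, h⟩ := integral_norm_mul_gauss_le φ
  have hm : Measurable fun p : ℝ × Space d =>
      2 * (p.1 : ℂ) ^ (ν - d - 1) * gauss (p.1 / lam) (x - p.2) * φ p.2 :=
    (measurable_gauss_term lam x _).mul (φ.continuous.measurable.comp measurable_snd)
  refine (integrable_prod_iff hm.aestronglyMeasurable).2 ⟨?_, ?_⟩
  · refine (ae_restrict_iff' measurableSet_Ioc).2 (Eventually.of_forall fun t ht => ?_)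
    have hs : 0 < t / lam := div_pos ht.1 hlam
    obtain ⟨C', hC', h'⟩ := schwartz_decay_uniform (reflect (gaussian (t / lam) hs) x) 0 0
    refine (φ.integrable.norm.const_mul (‖2 * (t : ℂ) ^ (ν - d - 1)‖ * C')).mono'
      (hm.comp (measurable_const.prodMk measurable_id)).aestronglyMeasurable
      (Eventually.of_forall fun y => ?_)
    have h1 := h' 0 le_rfl y
    rw [pow_zero, one_mul, norm_iteratedFDeriv_zero, reflect_apply,
      ← gauss_eq_gaussian (t / lam) hs] at h1
    rw [norm_mul, norm_mul]
    gcongr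
  · have hb : IntegrableOn (fun t : ℝ => C * (2 * lam⁻¹ ^ d * t ^ (ν.re - 1))) (Ioc 0 1) :=
      ((integrableOn_rpow_Ioc_zero (by linarith)).const_mul _).const_mul C
    refine hb.mono' hm.aestronglyMeasurable.norm.integral_prod_right'
      ((ae_restrict_iff' measurableSet_Ioc).2 (Eventually.of_forall fun t ht => ?_))
    have hs : 0 < t / lam := div_pos ht.1 hlam
    rw [Real.norm_of_nonneg (integral_nonneg fun _ => norm_nonneg _)]
    simp only [mul_assoc (2 * (t : ℂ) ^ (ν - d - 1)), norm_mul (2 * (t : ℂ) ^ (ν - d - 1)),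
      integral_const_mul]
    rw [← norm_two_mul_cpow_mul_pow hlam ht.1, norm_mul _ (((t / lam : ℝ) : ℂ) ^ d), norm_pow,
      Complex.norm_real, Real.norm_of_nonneg hs.le]
    calc _ ≤ ‖2 * (t : ℂ) ^ (ν - d - 1)‖ * (C * (t / lam) ^ d) := by
          gcongr
          exact h _ hs x
      _ = _ := by ring

/-- A point is a null set except in dimension `0`, where `Re ν > 0` is already `Re ν > d`. -/
theorem ae_ne_or_lt_re {ν : ℂ} (hν : 0 < ν.re) (x : Space d) :
    ∀ᵐ y : Space d, y - x ≠ 0 ∨ (d : ℝ) < ν.re := by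
  rcases Nat.eq_zero_or_pos d with rfl | hd
  · exact Eventually.of_forall fun y => Or.inr (by simpa using hν)
  · have : Nonempty (Fin d) := ⟨⟨0, hd⟩⟩
    have : ∀ᵐ y : Space d, y ≠ x := by
      rw [ae_iff]
      simp
    filter_upwards [this] with y hy using Or.inl (sub_ne_zero.2 hy)

theorem crandallG_convolution {lam : ℝ} (hlam : 0 < lam) {ν : ℂ} (hν : 0 < ν.re)
    (φ : 𝓢(Space d, ℂ)) (x : Space d) :
    Integrable (fun y => crandallG (d - ν) (lam • (y - x)) * φ y) ∧
      ∫ p, mixTerm lam ν φ p x ∂((volume.restrict (Ioc 0 1)).prod volume) =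
        ∫ y, crandallG (d - ν) (lam • (y - x)) * φ y := by
  have hK := integrable_cpow_mul_gauss_mul hlam hν φ x
  have hae : (fun y => ∫ t in Ioc (0 : ℝ) 1,
      2 * (t : ℂ) ^ (ν - d - 1) * gauss (t / lam) (x - y) * φ y) =ᵐ[volume]
      fun y => crandallG (d - ν) (lam • (y - x)) * φ y := by
    filter_upwards [ae_ne_or_lt_re hν x] with y hy
    rw [integral_mul_const, crandallG_smul hlam ν (y - x) hy]
    simp only [gauss_eq_exp, norm_sub_rev x y]
  refine ⟨hK.integral_prod_right.congr hae, ?_⟩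
  rw [← integral_congr_ae hae, integral_integral_swap (f := fun (y : Space d) (t : ℝ) =>
    2 * (t : ℂ) ^ (ν - d - 1) * gauss (t / lam) (x - y) * φ y) hK.swap,
    integral_prod _ (integrable_mixTerm hlam hν φ x)]
  refine setIntegral_congr_fun measurableSet_Ioc fun t ht => ?_
  have hs : 0 < t / lam := div_pos ht.1 hlam
  have h1 := integral_mul_reflect_gaussian φ (t / lam) hs x
  simp only [mixTerm, mul_assoc, integral_const_mul]
  congr 2
  simp only [reflect_apply, ← gauss_eq_gaussian _ hs, mul_comm (φ _)] at h1
  exact h1.symm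

/-! ### Applying the distribution to the smeared superposition. -/

section Pairing

variable {μ : Measure (Space d)} [μ.HasTemperateGrowth] [SFinite μ]

theorem integral_exp_heatPhase_mul_fourier {s : ℝ} (hs : 0 < s) (φ : 𝓢(Space d, ℂ)) :
    ∫ ξ, Complex.exp (heatPhase ξ (s, 0)) * 𝓕 φ ξ ∂μ =
      ∫ y, theta μ (fun _ => 1) s y * φ y := by
  have h1 : ∀ ξ, Complex.exp (heatPhase ξ (s, 0)) * 𝓕 φ ξ =
      ∫ y, Complex.exp (heatPhase ξ (s, y)) * φ y := by
    intro ξ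
    rw [SchwartzMap.fourier_coe, Real.fourier_eq', ← integral_const_mul]
    refine integral_congr_ae (Eventually.of_forall fun y => ?_)
    simp only [smul_eq_mul, ← mul_assoc, ← Complex.exp_add, heatPhase_apply, inner_zero_right]
    congr 2
    rw [real_inner_comm]
    push_cast
    ring
  simp only [h1]
  rw [integral_integral_swap (integrable_prod_of_norm_le ?_ (integrable_mul_exp (μ := μ)
    (one_hasTemperateGrowth (d := d)) hs) φ.integrable.norm (Eventually.of_forall fun ξ y => ?_))]
  · simp only [integral_mul_const, theta, one_mul]
  · refine Measurable.aestronglyMeasurable ?_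
    refine Measurable.mul ?_ (φ.continuous.measurable.comp measurable_snd)
    simp only [heatPhase_apply]
    fun_prop
  · simp only [Function.uncurry, norm_mul, norm_exp_heatPhase, norm_one, one_mul, le_refl]

theorem measurable_theta {μ : Measure (Space d)} [SFinite μ] :
    Measurable fun p : ℝ × Space d => theta μ (fun _ => 1) p.1 p.2 := by
  have : Measurable fun q : (ℝ × Space d) × Space d =>
      1 * Complex.exp (heatPhase q.2 (q.1.1, q.1.2)) := by
    simp only [heatPhase_apply]
    fun_prop
  exact this.stronglyMeasurable.integral_prod_right.measurable

/-- The exchange with `μ` is dominated by `|φ̂|`, the heat factor being at most `1`. The exchange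
with the `y`-integral needs `theta` bounded on the support of `φ` down to `s = 0`; this is where the
support must avoid the singular set. -/
theorem pairing_schwartz_mixTerm {lam : ℝ} (hlam : 0 < lam) {ν : ℂ} (hν : 0 < ν.re)
    {U : Set (Space d)} (hcont : ContinuousOn
      (fun p : ℝ × Space d => thetaExt μ (fun _ => 1) p.1 p.2) (Ici 0 ×ˢ U))
    (φ θ : 𝓢(Space d, ℂ)) (hc : HasCompactSupport φ) (hs : tsupport φ ⊆ U) (hθ : ⇑θ = fun x =>
      ∫ p, mixTerm lam ν φ p x ∂((volume.restrict (Ioc 0 1)).prod volume)) :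
    pairing μ (fun _ => 1) θ = ∫ y, (∫ t in Ioc (0 : ℝ) 1, 2 * (t : ℂ) ^ (ν - d - 1) *
      (((t / lam : ℝ) : ℂ) ^ d * theta μ (fun _ => 1) ((t / lam) ^ 2) y)) * φ y := by
  have hb : IntegrableOn (fun t : ℝ => 2 * lam⁻¹ ^ d * t ^ (ν.re - 1)) (Ioc 0 1) :=
    (integrableOn_rpow_Ioc_zero (by linarith)).const_mul _
  have hI1 : Integrable (Function.uncurry fun (t : ℝ) (ξ : Space d) =>
      2 * (t : ℂ) ^ (ν - d - 1) * ((t / lam : ℝ) : ℂ) ^ d *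
      Complex.exp (heatPhase ξ ((t / lam) ^ 2, 0)) * 𝓕 φ ξ)
      ((volume.restrict (Ioc 0 1)).prod μ) := by
    refine integrable_prod_of_norm_le ?_ hb ((𝓕 φ).integrable (μ := μ)).norm
      ((ae_restrict_iff' measurableSet_Ioc).2 (Eventually.of_forall fun t ht ξ => ?_))
    · refine Measurable.aestronglyMeasurable ?_
      have := (measurable_exp_heatPhase (0 : Space d)).comp
        (f := fun p : ℝ × Space d => (p.1 / lam, p.2)) (by fun_prop)
      exact Measurable.mul (Measurable.mul (by fun_prop) this)
        ((𝓕 φ).continuous.measurable.comp measurable_snd)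
    · simp only [Function.uncurry]
      rw [norm_mul, norm_mul, norm_two_mul_cpow_mul_pow hlam ht.1, norm_exp_heatPhase]
      have h0 : 0 ≤ t ^ (ν.re - 1) := Real.rpow_nonneg ht.1.le _
      have hpi := Real.pi_pos
      have h1 : Real.exp (-(Real.pi * (t / lam) ^ 2 * ‖ξ‖ ^ 2)) ≤ 1 :=
        Real.exp_le_one_iff.2 (neg_nonpos.2 (by positivity))
      exact mul_le_mul_of_nonneg_right (mul_le_of_le_one_right (by positivity) h1)
        (norm_nonneg _)
  obtain ⟨C, hC⟩ := ((isCompact_Icc (a := (0 : ℝ)) (b := lam⁻¹ ^ 2)).prod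
    (show IsCompact (tsupport φ) from hc)).exists_bound_of_continuousOn
    (hcont.mono (prod_mono Icc_subset_Ici_self hs))
  have hC' : ∀ t ∈ Ioc (0 : ℝ) 1, ∀ y, ‖theta μ (fun _ => 1) ((t / lam) ^ 2) y * φ y‖ ≤
      C * ‖φ y‖ := by
    intro t ht y
    by_cases hy : y ∈ tsupport φ
    · have hpos : 0 < (t / lam) ^ 2 := pow_pos (div_pos ht.1 hlam) 2
      have hle : (t / lam) ^ 2 ≤ lam⁻¹ ^ 2 := by
        have := ht.1
        rw [div_eq_mul_inv]
        gcongr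
        exact mul_le_of_le_one_left (by positivity) ht.2
      have := hC ((t / lam) ^ 2, y) ⟨⟨hpos.le, hle⟩, hy⟩
      simp only [thetaExt_of_pos μ _ hpos] at this
      rw [norm_mul]
      gcongr
    · rw [image_eq_zero_of_notMem_tsupport hy]
      simp
  have hI2 : Integrable (Function.uncurry fun (t : ℝ) (y : Space d) =>
      2 * (t : ℂ) ^ (ν - d - 1) * ((t / lam : ℝ) : ℂ) ^ d *
      (theta μ (fun _ => 1) ((t / lam) ^ 2) y * φ y))
      ((volume.restrict (Ioc 0 1)).prod volume) := by
    refine integrable_prod_of_norm_le ?_ hb (φ.integrable.norm.const_mul C)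
      ((ae_restrict_iff' measurableSet_Ioc).2 (Eventually.of_forall fun t ht y => ?_))
    · refine Measurable.aestronglyMeasurable ?_
      have := (measurable_theta (μ := μ)).comp
        (f := fun p : ℝ × Space d => ((p.1 / lam) ^ 2, p.2)) (by fun_prop)
      exact Measurable.mul (by fun_prop)
        (this.mul (φ.continuous.measurable.comp measurable_snd))
    · simp only [Function.uncurry]
      rw [norm_mul, norm_two_mul_cpow_mul_pow hlam ht.1]
      have h0 : 0 ≤ t ^ (ν.re - 1) := Real.rpow_nonneg ht.1.le _
      gcongr
      exact hC' t ht y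
  rw [pairing_apply one_hasTemperateGrowth]
  simp only [one_mul, fourier_schwartz_mixTerm hlam hν φ θ hθ]
  rw [← integral_integral_swap hI1]
  simp only [← integral_mul_const]
  have e : ∀ y : Space d, (∫ t in Ioc (0 : ℝ) 1, 2 * (t : ℂ) ^ (ν - d - 1) *
      (((t / lam : ℝ) : ℂ) ^ d * theta μ (fun _ => 1) ((t / lam) ^ 2) y) * φ y) =
      ∫ t in Ioc (0 : ℝ) 1, 2 * (t : ℂ) ^ (ν - d - 1) * ((t / lam : ℝ) : ℂ) ^ d *
      (theta μ (fun _ => 1) ((t / lam) ^ 2) y * φ y) := fun y =>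
    integral_congr_ae (Eventually.of_forall fun t => by ring)
  simp only [e]
  rw [← integral_integral_swap hI2]
  refine setIntegral_congr_fun measurableSet_Ioc fun t ht => ?_
  have hpos : 0 < (t / lam) ^ 2 := pow_pos (div_pos ht.1 hlam) 2
  simp only [mul_assoc (2 * (t : ℂ) ^ (ν - d - 1) * ((t / lam : ℝ) : ℂ) ^ d), integral_const_mul,
    integral_exp_heatPhase_mul_fourier hpos φ]

theorem isConvOn_crandallG {u : 𝓢'(Space d, ℂ)} (hu : ∀ φ, u φ = pairing μ (fun _ => 1) φ)
    {lam : ℝ} (hlam : 0 < lam) {ν : ℂ} (hν : 0 < ν.re)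
    {U : Set (Space d)} (hcont : ContinuousOn
      (fun p : ℝ × Space d => thetaExt μ (fun _ => 1) p.1 p.2) (Ici 0 ×ˢ U)) :
    IsConvOn u (fun z => crandallG (d - ν) (lam • z)) U fun y =>
      ∫ t in Ioc (0 : ℝ) 1, 2 * (t : ℂ) ^ (ν - d - 1) *
        (((t / lam : ℝ) : ℂ) ^ d * theta μ (fun _ => 1) ((t / lam) ^ 2) y) := by
  intro φ hc hs
  obtain ⟨θ, hθ⟩ := exists_schwartz_mixTerm hlam hν φ
  refine ⟨θ, fun x => ?_, ?_⟩
  · rw [hθ]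
    exact crandallG_convolution hlam hν φ x
  · rw [hu, pairing_schwartz_mixTerm hlam hν hcont φ θ hc hs hθ]

end Pairing

/-! ### The Hadamard integral and the convolution -/

/-- The behaviour of the Mellin transform under powers, applied to a function cut off to `(0, 1]`,
an interval that squaring preserves. -/
theorem integral_cpow_mul_comp_sq (f : ℝ → ℂ) (ν : ℂ) :
    ∫ t in (0 : ℝ)..1, (t : ℂ) ^ (ν - 1) * f (t ^ 2) =
      2⁻¹ * ∫ s in (0 : ℝ)..1, (s : ℂ) ^ (ν / 2 - 1) * f s := by
  have h := mellin_comp_rpow ((Ioc 0 1).indicator f) ν 2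
  rw [Complex.ofReal_ofNat, mellin_indicator_Ioc, abs_two, Complex.real_smul,
    Complex.ofReal_inv, Complex.ofReal_ofNat] at h
  rw [← h, ← mellin_indicator_Ioc]
  refine setIntegral_congr_fun measurableSet_Ioi fun t ht => ?_
  have ht0 : (0 : ℝ) < t := ht
  have hiff : t ^ 2 ∈ Ioc (0 : ℝ) 1 ↔ t ∈ Ioc (0 : ℝ) 1 :=
    ⟨fun h => ⟨ht0, by nlinarith [h.2]⟩, fun h => ⟨by positivity, pow_le_one₀ ht0.le h.2⟩⟩
  simp only [Real.rpow_ofNat]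
  by_cases hm : t ∈ Ioc (0 : ℝ) 1
  · rw [indicator_of_mem hm, indicator_of_mem (hiff.2 hm)]
  · rw [indicator_of_notMem hm, indicator_of_notMem (fun h => hm (hiff.1 h))]

/-- The extension to `t = 0` of the convolution of the distribution `φ ↦ ∫ φ̂ dμ` with
`exp (-π |·|² / t²)`. -/
def psiExt (μ : Measure (Space d)) (t : ℝ) (y : Space d) : ℂ :=
  (t : ℂ) ^ d * thetaExt μ (fun _ => 1) (t ^ 2) y

/-- The entire continuation of `2 Γ(ν/2)⁻¹ ∫_0^1 t^(ν-d-1) ψ(t/λ, y) dt`. -/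
def convEntire (μ : Measure (Space d)) (lam : ℝ) (ν : ℂ) (y : Space d) : ℂ :=
  (lam⁻¹ : ℂ) ^ d * heatEntire μ (lam⁻¹ ^ 2) (fun _ => 1) (ν / 2) y

section Regular

variable {μ : Measure (Space d)} [μ.HasTemperateGrowth] {Ω : Set (Space d)} {lam : ℝ}

theorem cpow_mul_psiExt {μ : Measure (Space d)} {t : ℝ} (ht : 0 < t) (lam : ℝ) (ν : ℂ)
    (y : Space d) :
    (t : ℂ) ^ (ν - d - 1) * psiExt μ (t / lam) y = (lam⁻¹ : ℂ) ^ d *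
      ((t : ℂ) ^ (ν - 1) * thetaExt μ (fun _ => 1) (lam⁻¹ ^ 2 * t ^ 2) y) := by
  have ht0 : (t : ℂ) ≠ 0 := by exact_mod_cast ht.ne'
  have h1 : (t : ℂ) ^ (ν - 1) = (t : ℂ) ^ (ν - d - 1) * (t : ℂ) ^ d := by
    rw [← Complex.cpow_natCast, ← Complex.cpow_add _ _ ht0]
    congr 1
    ring
  have h2 : (t / lam) ^ 2 = lam⁻¹ ^ 2 * t ^ 2 := by
    rw [div_eq_mul_inv, mul_pow, mul_comm]
  rw [psiExt, h1, h2, div_eq_mul_inv, Complex.ofReal_mul, mul_pow, Complex.ofReal_inv]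
  ring

theorem intervalIntegrable_cpow_mul_psiExt (hΩ : IsOpen Ω) (hP : RegularOn μ Ω fun _ => 1)
    {y : Space d} (hy : y ∈ Ω) (lam : ℝ) {ν : ℂ} (hν : 0 < ν.re) :
    IntervalIntegrable (fun t : ℝ => (t : ℂ) ^ (ν - d - 1) * psiExt μ (t / lam) y)
      volume 0 1 := by
  have h : IntervalIntegrable (fun t : ℝ => (lam⁻¹ : ℂ) ^ d *
      ((t : ℂ) ^ (ν - 1) * thetaExt μ (fun _ => 1) (lam⁻¹ ^ 2 * t ^ 2) y)) volume 0 1 := by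
    refine (IntervalIntegrable.mul_continuousOn
      (intervalIntegral.intervalIntegrable_cpow' (by simpa using hν)) ?_).const_mul _
    exact (continuousOn_thetaExt_slice hΩ (sq_nonneg lam⁻¹) hP hy).comp
      (f := fun t : ℝ => t ^ 2) (by fun_prop) fun t _ => mem_Ici.2 (sq_nonneg t)
  refine h.congr fun t ht => ?_
  rw [uIoc_of_le zero_le_one] at ht
  exact (cpow_mul_psiExt ht.1 lam ν y).symm

theorem integral_cpow_mul_psiExt (hΩ : IsOpen Ω) (hP : RegularOn μ Ω fun _ => 1)
    {y : Space d} (hy : y ∈ Ω) (hlam : 0 < lam) {ν : ℂ} (hν : 0 < ν.re) :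
    ∫ t in (0 : ℝ)..1, (t : ℂ) ^ (ν - d - 1) * psiExt μ (t / lam) y =
      Complex.Gamma (ν / 2) / 2 * convEntire μ lam ν y := by
  have hν2 : 0 < (ν / 2).re := by
    rw [Complex.div_ofNat_re]
    positivity
  have h1 : ∫ t in (0 : ℝ)..1, (t : ℂ) ^ (ν - d - 1) * psiExt μ (t / lam) y =
      ∫ t in (0 : ℝ)..1, (lam⁻¹ : ℂ) ^ d *
        ((t : ℂ) ^ (ν - 1) * thetaExt μ (fun _ => 1) (lam⁻¹ ^ 2 * t ^ 2) y) := by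
    rw [intervalIntegral.integral_of_le zero_le_one, intervalIntegral.integral_of_le zero_le_one]
    exact setIntegral_congr_fun measurableSet_Ioc fun t ht => cpow_mul_psiExt ht.1 lam ν y
  rw [h1, intervalIntegral.integral_const_mul, convEntire,
    heatEntire_eq hΩ (pow_pos (inv_pos.2 hlam) 2) hP hy hν2, heatInt,
    integral_cpow_mul_comp_sq (fun s => thetaExt μ (fun _ => 1) (lam⁻¹ ^ 2 * s) y) ν]
  have := Complex.Gamma_ne_zero_of_re_pos hν2
  field_simp

theorem setIntegral_theta_eq_convEntire (hΩ : IsOpen Ω) (hP : RegularOn μ Ω fun _ => 1)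
    {y : Space d} (hy : y ∈ Ω) (hlam : 0 < lam) {ν : ℂ} (hν : 0 < ν.re) :
    IntegrableOn (fun t : ℝ => 2 * (t : ℂ) ^ (ν - d - 1) *
      (((t / lam : ℝ) : ℂ) ^ d * theta μ (fun _ => 1) ((t / lam) ^ 2) y)) (Ioc 0 1) ∧
    1 / Complex.Gamma (ν / 2) * (∫ t in Ioc (0 : ℝ) 1, 2 * (t : ℂ) ^ (ν - d - 1) *
      (((t / lam : ℝ) : ℂ) ^ d * theta μ (fun _ => 1) ((t / lam) ^ 2) y)) =
        convEntire μ lam ν y := by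
  have hν2 : 0 < (ν / 2).re := by
    rw [Complex.div_ofNat_re]
    positivity
  have e : ∀ t ∈ Ioc (0 : ℝ) 1, 2 * ((t : ℂ) ^ (ν - d - 1) * psiExt μ (t / lam) y) =
      2 * (t : ℂ) ^ (ν - d - 1) *
        (((t / lam : ℝ) : ℂ) ^ d * theta μ (fun _ => 1) ((t / lam) ^ 2) y) := by
    intro t ht
    rw [psiExt, thetaExt_of_pos μ _ (pow_pos (div_pos ht.1 hlam) 2), mul_assoc]
  have hi := ((intervalIntegrable_cpow_mul_psiExt hΩ hP hy lam hν).const_mul 2)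
  rw [intervalIntegrable_iff_integrableOn_Ioc_of_le zero_le_one] at hi
  refine ⟨hi.congr_fun e measurableSet_Ioc, ?_⟩
  rw [← setIntegral_congr_fun measurableSet_Ioc e, integral_const_mul,
    ← intervalIntegral.integral_of_le zero_le_one, integral_cpow_mul_psiExt hΩ hP hy hlam hν]
  have := Complex.Gamma_ne_zero_of_re_pos hν2
  field_simp

theorem differentiable_convEntire (hΩ : IsOpen Ω) (hP : RegularOn μ Ω fun _ => 1)
    {y : Space d} (hy : y ∈ Ω) (hlam : 0 < lam) :
    Differentiable ℂ fun ν => convEntire μ lam ν y :=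
  ((differentiable_heatEntire hΩ (pow_pos (inv_pos.2 hlam) 2) hP hy).comp
    (differentiable_id.div_const 2)).const_mul _

theorem isHadamardIntegral_psiExt (hΩ : IsOpen Ω) (hP : RegularOn μ Ω fun _ => 1)
    {y : Space d} (hy : y ∈ Ω) (hlam : 0 < lam) :
    IsHadamardIntegral (fun ν t => (t : ℂ) ^ (ν - d - 1) * psiExt μ (t / lam) y)
      (fun ν => Complex.Gamma (ν / 2) / 2 * convEntire μ lam ν y) := by
  refine ⟨fun ν _ => ?_, 0, fun ν hν =>
    ⟨intervalIntegrable_cpow_mul_psiExt hΩ hP hy lam hν,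
      (integral_cpow_mul_psiExt hΩ hP hy hlam hν).symm⟩⟩
  have h1 : MeromorphicAt (fun ν : ℂ => Complex.Gamma (ν / 2)) ν :=
    (Meromorphic.Gamma (ν / 2)).comp_analyticAt (g := fun ν : ℂ => ν / 2) (by fun_prop)
  exact (h1.div (MeromorphicAt.const 2 ν)).mul
    ((differentiable_convEntire hΩ hP hy hlam).analyticAt ν).meromorphicAt

end Regular

section LocallyRegular

variable {μ : Measure (Space d)} [μ.HasTemperateGrowth] {U : Set (Space d)}

/-- The extension is defined by a limit and involves no choice of neighbourhood or representing
function, so the local statements glue. -/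
theorem contDiffOn_thetaExt_of_locally
    (hU : ∀ y ∈ U, ∃ Ω, IsOpen Ω ∧ y ∈ Ω ∧ RegularOn μ Ω fun _ => 1) :
    ContDiffOn ℝ ∞ (fun p : ℝ × Space d => thetaExt μ (fun _ => 1) p.1 p.2) (Ici 0 ×ˢ U) := by
  rintro ⟨s, y⟩ ⟨hs, hy⟩
  obtain ⟨Ω, hΩ, hyΩ, hP⟩ := hU y hy
  refine (contDiffOn_thetaExt hΩ hP (s, y) ⟨hs, hyΩ⟩).mono_of_mem_nhdsWithin ?_
  filter_upwards [self_mem_nhdsWithin,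
    nhdsWithin_le_nhds (continuous_snd.continuousAt.preimage_mem_nhds (hΩ.mem_nhds hyΩ))]
    with p hp hp' using ⟨hp.1, hp'⟩

theorem contDiffOn_psiExt (hU : ∀ y ∈ U, ∃ Ω, IsOpen Ω ∧ y ∈ Ω ∧ RegularOn μ Ω fun _ => 1) :
    ContDiffOn ℝ ∞ (fun p : ℝ × Space d => psiExt μ p.1 p.2) (Ici 0 ×ˢ U) := by
  have h1 : ContDiff ℝ ∞ fun p : ℝ × Space d => (p.1 : ℂ) ^ d :=
    (Complex.ofRealCLM.contDiff.comp contDiff_fst).pow d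
  exact h1.contDiffOn.mul ((contDiffOn_thetaExt_of_locally hU).comp
    (g := fun p : ℝ × Space d => thetaExt μ (fun _ => 1) p.1 p.2)
    (f := fun p : ℝ × Space d => (p.1 ^ 2, p.2))
    (by fun_prop) fun p hp => ⟨mem_Ici.2 (sq_nonneg p.1), hp.2⟩)

theorem contDiffOn_convEntire {lam : ℝ} (hlam : 0 < lam)
    (hU : ∀ y ∈ U, ∃ Ω, IsOpen Ω ∧ y ∈ Ω ∧ RegularOn μ Ω fun _ => 1) (ν : ℂ) :
    ContDiffOn ℝ ∞ (convEntire μ lam ν) U := by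
  intro y hy
  obtain ⟨Ω, hΩ, hyΩ, hP⟩ := hU y hy
  have h := contDiffOn_heatEntire hΩ (pow_pos (inv_pos.2 hlam) 2) hP (ν / 2)
  exact (contDiffAt_const.mul (h.contDiffAt (hΩ.mem_nhds hyΩ))).contDiffWithinAt

end LocallyRegular

/-! ### The form factor -/

section FormFactor

variable {L : Set (Space d)} (hL : UniformlyDiscrete L)

theorem UniformlyDiscrete.countable {L : Set (Space d)} (hL : UniformlyDiscrete L) :
    Countable L := by
  obtain ⟨ε, hε, hsep⟩ := hL
  have := Set.PairwiseDisjoint.countable_of_isOpen (ι := L) (a := univ)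
    (s := fun z : L => Metric.ball (z : Space d) (ε / 2))
    (fun z _ w _ hzw => Metric.ball_disjoint_ball (by
      have := hsep z z.2 w w.2 fun h => hzw (Subtype.ext h)
      linarith))
    (fun z _ => Metric.isOpen_ball) (fun z _ => ⟨z, Metric.mem_ball_self (half_pos hε)⟩)
  exact Set.countable_univ_iff.mp this

theorem UniformlyDiscrete.sFinite_combMeasure {L : Set (Space d)} (hL : UniformlyDiscrete L) :
    SFinite (combMeasure L) := by
  have := hL.countable
  rw [combMeasure]
  infer_instance

theorem formFactor_apply [(combMeasure L).HasTemperateGrowth] (φ : 𝓢(Space d, ℂ)) :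
    formFactor L hL φ = pairing (combMeasure L) (fun _ => 1) φ := by
  rw [pairing_apply one_hasTemperateGrowth]
  simp only [one_mul]
  rfl

theorem exists_hasOrderLE_formFactor : ∃ k, HasOrderLE (formFactor L hL) k := by
  have := combMeasure_hasTemperateGrowth hL
  obtain ⟨m, k, C, -, h⟩ := exists_bound_of_continuous
    (pairing (combMeasure L) fun _ => 1).toLinearMap
    (pairing (combMeasure L) fun _ => 1).continuous
  refine ⟨k, m, C, fun φ => ?_⟩
  rw [formFactor_apply hL]
  exact h φ

theorem exists_regularOn_of_notMem_dualSet [(combMeasure L).HasTemperateGrowth] {y : Space d}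
    (hy : y ∈ (dualSet L hL)ᶜ) :
    ∃ Ω, IsOpen Ω ∧ y ∈ Ω ∧ RegularOn (combMeasure L) Ω fun _ => 1 := by
  rw [dualSet, singSupp, compl_compl] at hy
  obtain ⟨Ω, hΩ, hyΩ, f, hf, h⟩ := hy
  refine ⟨Ω, hΩ, hyΩ, one_hasTemperateGrowth, f, hf, fun φ hc hs => ?_⟩
  rw [← formFactor_apply hL]
  exact h φ hc hs

theorem psiExt_eq_psi [(combMeasure L).HasTemperateGrowth] {t : ℝ} (ht : 0 < t) (y : Space d) :
    psiExt (combMeasure L) t y = psi L hL t ht y := by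
  rw [psi, conv, formFactor_apply hL, pairing_reflect_gaussian one_hasTemperateGrowth, psiExt,
    thetaExt_of_pos _ _ (pow_pos ht 2)]

end FormFactor

end SetZeta
end
-- The integral representation.
theorem theorem3p6 (d : ℕ) (L : Set (SetZeta.Space d)) (hL : SetZeta.UniformlyDiscrete L)
    (lam : ℝ) (hlam : 0 < lam) :
    ∃ (ψ : ℝ → SetZeta.Space d → ℂ) (M H : ℂ → SetZeta.Space d → ℂ),
      -- `ψ` is the smooth extension of `ψ_L` to `t = 0`
      (ContDiffOn ℝ ∞ (fun p : ℝ × SetZeta.Space d => ψ p.1 p.2)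
          (Set.Ici 0 ×ˢ (SetZeta.dualSet L hL)ᶜ) ∧
        ∀ (t : ℝ) (ht : 0 < t), ∀ y ∉ SetZeta.dualSet L hL,
          ψ t y = SetZeta.psi L hL t ht y) ∧
      -- `M ν y` is the Hadamard integral of `t ^ (ν - d - 1) ψ_L (t / λ, y)` over `[0, 1]`
      (∀ y ∉ SetZeta.dualSet L hL,
        SetZeta.IsHadamardIntegral
          (fun ν t => (t : ℂ) ^ (ν - d - 1) * ψ (t / lam) y) (fun ν => M ν y)) ∧
      -- `H ν y` is the right-hand side; it is entire in `ν`, and the removable singularities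
      -- at the poles `0, -2, -4, …` of `Γ (ν / 2)` are removed
      (∀ y ∉ SetZeta.dualSet L hL,
        Differentiable ℂ (fun ν => H ν y) ∧
        ∀ ν : ℂ, (∀ n : ℕ, ν ≠ -2 * (n : ℂ)) →
          H ν y = 2 / Complex.Gamma (ν / 2) * M ν y) ∧
      -- the right-hand side represents the convolution: pointwise, as the pairing of the form
      -- factor, a distribution of finite order `k`, with an element of `𝓢^k`, if `Re ν > d + k`
      (∃ k : ℕ, SetZeta.HasOrderLE (SetZeta.formFactor L hL) k) ∧
      (∀ k : ℕ, SetZeta.HasOrderLE (SetZeta.formFactor L hL) k →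
        ∀ ν : ℂ, (d : ℝ) + k < ν.re → ∀ y ∉ SetZeta.dualSet L hL,
          ∃ c : ℂ,
            SetZeta.HasConvAt (SetZeta.formFactor L hL) k
              (fun z => SetZeta.crandallG (d - ν) (lam • z)) y c ∧
            1 / Complex.Gamma (ν / 2) * c = H ν y) ∧
      -- and as a convolution of distributions, if `Re ν > 0`, that is, if `G_{d - ν}` is
      -- integrable
      (∀ ν : ℂ, 0 < ν.re →
        ∃ F : SetZeta.Space d → ℂ,
          SetZeta.IsConvOn (SetZeta.formFactor L hL)
            (fun z => SetZeta.crandallG (d - ν) (lam • z)) (SetZeta.dualSet L hL)ᶜ F ∧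
          ∀ y ∉ SetZeta.dualSet L hL, 1 / Complex.Gamma (ν / 2) * F y = H ν y) ∧
      -- the right-hand side is smooth in `y` for every `ν`
      (∀ ν : ℂ, ContDiffOn ℝ ∞ (H ν) (SetZeta.dualSet L hL)ᶜ) := by
  have := SetZeta.combMeasure_hasTemperateGrowth hL
  have := hL.sFinite_combMeasure
  have hU := fun y (hy : y ∈ (SetZeta.dualSet L hL)ᶜ) =>
    SetZeta.exists_regularOn_of_notMem_dualSet hL hy
  -- The entire function `convEntire` comes first and the Hadamard integral is defined as `Γ(ν/2)/2`
  -- times it, so the poles of the latter can come only from the Gamma factor.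
  refine ⟨SetZeta.psiExt (SetZeta.combMeasure L),
    fun ν y => Complex.Gamma (ν / 2) / 2 * SetZeta.convEntire (SetZeta.combMeasure L) lam ν y,
    SetZeta.convEntire (SetZeta.combMeasure L) lam,
    ⟨SetZeta.contDiffOn_psiExt hU, fun t ht y _ => SetZeta.psiExt_eq_psi hL ht y⟩,
    fun y hy => ?_, fun y hy => ⟨?_, fun ν hν => ?_⟩, SetZeta.exists_hasOrderLE_formFactor hL,
    fun k hk ν hν y hy => ?_, fun ν hν => ⟨_, SetZeta.isConvOn_crandallG
      (SetZeta.formFactor_apply hL) hlam hν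
      (SetZeta.contDiffOn_thetaExt_of_locally hU).continuousOn, fun y hy => ?_⟩,
    SetZeta.contDiffOn_convEntire hlam hU⟩
  · obtain ⟨Ω, hΩ, hyΩ, hP⟩ := hU y hy
    exact SetZeta.isHadamardIntegral_psiExt hΩ hP hyΩ hlam
  · obtain ⟨Ω, hΩ, hyΩ, hP⟩ := hU y hy
    exact SetZeta.differentiable_convEntire hΩ hP hyΩ hlam
  -- The excluded `ν` are the poles of `Γ(ν/2)`, where `Complex.Gamma` has the default value `0` and
  -- the cancellation would fail.
  · have hΓ : Complex.Gamma (ν / 2) ≠ 0 := Complex.Gamma_ne_zero fun n hn =>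
      hν n (by linear_combination 2 * hn)
    field_simp
  · obtain ⟨Ω, hΩ, hyΩ, hP⟩ := hU y hy
    have hν0 : 0 < ν.re := lt_of_le_of_lt (by positivity) hν
    obtain ⟨hint, heq⟩ := SetZeta.setIntegral_theta_eq_convEntire hΩ hP hyΩ hlam hν0
    exact ⟨_, SetZeta.hasConvAt_gaussMix (SetZeta.formFactor_apply hL) hk hlam hν y hint, heq⟩
  · obtain ⟨Ω, hΩ, hyΩ, hP⟩ := hU y hy
    exact (SetZeta.setIntegral_theta_eq_convEntire hΩ hP hyΩ hlam hν).2
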